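/- All Hilbert spaces are finite-dimensional and nonzero, with fixed orthonormal bases; transposes and partial transposes are taken in these bases, $X\le Y$ means that $Y-X$ is positive semidefinite, and $E^{S}$ denotes the partial trace of an operator $E$ onto the systems $S$. Write $|\phi\rangle^{X\tilde X}=|X|^{-1/2}\sum_i|i\rangle|i\rangle$ and $\phi^{X\tilde X}=|\phi\rangle\langle\phi|$. **Codes.** Let $\mathcal N^{A'\to BC}$ be a quantum channel (completely positive and trace-preserving) with Choi matrix $N^{A'BC}=\sum_{i,j}|i\rangle\langle j|\otimes\mathcal N(|i\rangle\langle j|)$. A forward-assisted code of size $(r_1,r_2)$, where $r_1,r_2\ge1$, consists of a finite-dimensional system $R$, an isometric encoding $\mathcal E^{A\to A'R}$ with $A=A_1A_2$, and a decoding channel $\mathcal D^{RBC\to B'C'}$, where $|A_1|=|B'|=r_1$ and $|A_2|=|C'|=r_2$. It defines the tripartite operation $\mathcal Z^{ABC\to A'B'C'}=\mathcal D\circ\mathcal E$ and the channel $\mathcal M^{A_1A_2\to B'C'}=\mathcal D\circ\mathcal N\circ\mathcal E$. Its average channel input is $\mathrm{Tr}_{\tilde A_1\tilde A_2R}\,\mathcal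 E(\phi^{A_1\tilde A_1}\otimes\phi^{A_2\tilde A_2})$, and its channel fidelity is $\mathrm{Tr}\big[(\phi^{\tilde A_1B'}\otimes\phi^{\tilde A_2C'})\,\mathcal M(\phi^{A_1\tilde A_1}\otimes\phi^{A_2\tilde A_2})\big]$. A bipartite operation $\Phi^{XY\to X'Y'}$ is *no-signalling from $X$ to $Y$* if $\mathrm{Tr}_{X'}\circ\Phi=\Psi\circ\mathrm{Tr}_X$ for some channel $\Psi^{Y\to Y'}$. It is *PPT-preserving* if, for all reference systems $K$ (on the side of $X$) and $L$ (on the side of $Y$), $\mathrm{id}^{KL}\otimes\Phi$ maps every $M\ge0$ on $KLXY$ with $M^{T_{KX}}\ge0$ to an operator whose partial transpose over $KX'$ is positive semidefinite (equivalently, the partial transpose of the Choi matrix of $\Phi$ over $XX'$ is positive semidefinite). The code is *PPT-preserving* if $\mathcal Z$ is PPT-preserving across each of the cuts $A|BC$, $B|AC$, $C|AB$. It is *no-signalling* if for $\mathcal Z$ no party can signal to the other two ($A\not\to BC$, $B\not\to AC$, $C\not\to AB$) and no two parties can signal to the third ($BC\not\to A$, $AC\not\to B$, $AB\not\to C$).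 **Constraints.** For an operator $\rho$ on $A'$, a real number $f_c$, and operators $E_1,E_2,E_3$ on $A'BC$, consider: - (Basic) $\mathrm{Tr}\,\rho=1$, $\; f_c=\mathrm{Tr}\,E_1N^T$, $\; E_1,E_2,E_3\ge0$, and $$E_1+(r_2^2-1)E_2+(r_1^2-1)E_3\le\rho\otimes\mathbb 1^{BC}.$$ - (NS) $E_i^{BC}=\dfrac{\mathbb 1^{BC}}{r_1^2r_2^2}$ for $i=1,2,3$, and $$E_1+(r_1^2-1)E_3=\big(E_1^{A'C}+(r_1^2-1)E_3^{A'C}\big)\otimes\frac{\mathbb 1^B}{|B|},\qquad E_1+(r_2^2-1)E_2=\big(E_1^{A'B}+(r_2^2-1)E_2^{A'B}\big)\otimes\frac{\mathbb 1^C}{|C|}.$$ - (PPT) With $\rho$ short for $\rho\otimes\mathbb 1^{BC}$: PPT$_A$: $$-\tfrac{1}{r_1r_2}\rho-\big(1+\tfrac1{r_2}+\tfrac1{r_1}\big)E_1^{T_{BC}}\le\tfrac{r_2^2-1}{r_2}E_2^{T_{BC}}+\tfrac{r_1^2-1}{r_1}E_3^{T_{BC}}\le\tfrac{1}{r_1r_2}\rho+\big(1-\tfrac1{r_2}-\tfrac1{r_1}\big)E_1^{T_{BC}},$$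 $$-\tfrac{1}{r_1r_2}\rho+\big(1-\tfrac1{r_2}+\tfrac1{r_1}\big)E_1^{T_{BC}}\le\tfrac{r_2^2-1}{r_2}E_2^{T_{BC}}-\tfrac{r_1^2-1}{r_1}E_3^{T_{BC}}\le\tfrac{1}{r_1r_2}\rho-\big(1+\tfrac1{r_2}-\tfrac1{r_1}\big)E_1^{T_{BC}};$$ PPT$_B$: $$-(r_1-1)E_3^{T_B}\le E_1^{T_B}\le(r_1+1)E_3^{T_B},$$ $$-\big(\rho-(r_1^2-1)E_3^{T_B}-E_1^{T_B}\big)\le r_1(r_2^2-1)E_2^{T_B}\le\rho-(r_1^2-1)E_3^{T_B}-E_1^{T_B};$$ PPT$_C$: $$-(r_2-1)E_2^{T_C}\le E_1^{T_C}\le(r_2+1)E_2^{T_C},$$ $$-\big(\rho-(r_2^2-1)E_2^{T_C}-E_1^{T_C}\big)\le r_2(r_1^2-1)E_3^{T_C}\le\rho-(r_2^2-1)E_2^{T_C}-E_1^{T_C}.$$ **Theorem.** Let $\mathcal N^{A'\to BC}$ be a quantum broadcast channel, $r_1,r_2\ge1$ integers, $\rho$ an operator on $A'$ and $f_c\in\mathbb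 R$. 1. There is a no-signalling forward-assisted code of size $(r_1,r_2)$ with average channel input $\rho$ and channel fidelity $f_c$ if and only if there are operators $E_1,E_2,E_3$ on $A'BC$ which satisfy (Basic) and (NS). 2. There is a forward-assisted code of size $(r_1,r_2)$ with average channel input $\rho$ and channel fidelity $f_c$ that is both PPT-preserving and no-signalling if and only if there are operators $E_1,E_2,E_3$ on $A'BC$ which satisfy (Basic), (NS) and (PPT). 3. If $(r_1,r_2)\ne(1,1)$, there is a PPT-preserving forward-assisted code of size $(r_1,r_2)$ with average channel input $\rho$ and channel fidelity $f_c$ if and only if there are operators $E_1,E_2,E_3$ on $A'BC$ which satisfy (Basic) and (PPT). -/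

import Mathlib

open scoped ComplexOrder MatrixOrder Kronecker Matrix

noncomputable section

/-- Linear maps `L(X) → L(Y)` between the operators on two finite-dimensional Hilbert spaces with
orthonormal bases indexed by `X` and `Y`. -/
abbrev SuperOp (X Y : Type*) := Matrix X X ℂ →ₗ[ℂ] Matrix Y Y ℂ

namespace SuperOp

variable {X Y X' Y' : Type*}

/-- The map `id_K ⊗ Φ`. -/
def idTensor (K : Type*) (Φ : SuperOp X Y) : SuperOp (K × X) (K × Y) where
  toFun M := Matrix.of fun p q => Φ (Matrix.of fun x x' => M (p.1, x) (q.1, x')) p.2 q.2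
  map_add' M M' := by
    ext p q
    exact congrFun (congrFun (Φ.map_add (Matrix.of fun x x' => M (p.1, x) (q.1, x'))
      (Matrix.of fun x x' => M' (p.1, x) (q.1, x'))) p.2) q.2
  map_smul' c M := by
    ext p q
    exact congrFun (congrFun (Φ.map_smul c (Matrix.of fun x x' => M (p.1, x) (q.1, x'))) p.2) q.2

/-- The map `M ↦ V M V†`. -/
def conj [Fintype X] (V : Matrix Y X ℂ) : SuperOp X Y where
  toFun M := V * M * Vᴴ
  map_add' M M' := by rw [Matrix.mul_add, Matrix.add_mul]
  map_smul' c M := by simp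

/-- Relabelling of the tensor factors of an operator along a bijection of the basis labels. -/
def relabel (e : X ≃ Y) : SuperOp X Y := (Matrix.reindexLinearEquiv ℂ ℂ e e).toLinearMap

/-- The partial trace over the first tensor factor. -/
def traceFst [Fintype X] : SuperOp (X × Y) Y where
  toFun M := Matrix.of fun y y' => ∑ x, M (x, y) (x, y')
  map_add' M M' := by ext; simp [Finset.sum_add_distrib]
  map_smul' c M := by ext; simp [Finset.mul_sum]

/-- The partial trace over the second tensor factor. -/
def traceSnd [Fintype Y] : SuperOp (X × Y) X where
  toFun M := Matrix.of fun x x' => ∑ y, M (x, y) (x', y)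
  map_add' M M' := by ext; simp [Finset.sum_add_distrib]
  map_smul' c M := by ext; simp [Finset.mul_sum]

/-- Quantum channels: completely positive and trace-preserving linear maps. -/
structure IsChannel [Fintype X] [Fintype Y] (Φ : SuperOp X Y) : Prop where
  completelyPositive : ∀ (k : ℕ) (M : Matrix (Fin k × X) (Fin k × X) ℂ),
    M.PosSemidef → (idTensor (Fin k) Φ M).PosSemidef
  tracePreserving : ∀ M : Matrix X X ℂ, (Φ M).trace = M.trace

/-- The Choi matrix `(id ⊗ Φ)(∑ i j, |i⟩⟨j| ⊗ |i⟩⟨j|)`. -/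
def choi [DecidableEq X] (Φ : SuperOp X Y) : Matrix (X × Y) (X × Y) ℂ :=
  Matrix.of fun p q => Φ (Matrix.single p.1 q.1 1) p.2 q.2

/-- A bipartite map `L(X ⊗ Y) → L(X' ⊗ Y')` is no-signalling from the first to the second party:
`Tr_{X'} ∘ Φ = Ψ ∘ Tr_X` for some channel `Ψ : L(Y) → L(Y')`. -/
def NoSignalling [Fintype X] [Fintype Y] [Fintype X'] [Fintype Y']
    (Φ : SuperOp (X × Y) (X' × Y')) : Prop :=
  ∃ Ψ : SuperOp Y Y', Ψ.IsChannel ∧ traceFst ∘ₗ Φ = Ψ ∘ₗ traceFst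

/-- For operators on `(K ⊗ L) ⊗ (X ⊗ Y)`, where the first party holds `K` and `X` and the second
party holds `L` and `Y`: the partial transpose over the first party, i.e. over `K ⊗ X`. -/
def cutTranspose {K L : Type*} (M : Matrix ((K × L) × (X × Y)) ((K × L) × (X × Y)) ℂ) :
    Matrix ((K × L) × (X × Y)) ((K × L) × (X × Y)) ℂ :=
  Matrix.of fun p q =>
    M ((q.1.1, p.1.2), (q.2.1, p.2.2)) ((p.1.1, q.1.2), (p.2.1, q.2.2))

/-- A bipartite map is (completely) PPT-preserving: with reference systems `K` and `L` of arbitrary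
dimension held by the first and the second party, every positive operator with positive partial
transpose is mapped to an operator with positive partial transpose. -/
def PPTPreserving (Φ : SuperOp (X × Y) (X' × Y')) : Prop :=
  ∀ (k l : ℕ) (M : Matrix ((Fin k × Fin l) × (X × Y)) ((Fin k × Fin l) × (X × Y)) ℂ),
    M.PosSemidef → (cutTranspose M).PosSemidef →
      (cutTranspose (idTensor (Fin k × Fin l) Φ M)).PosSemidef

/-- A bipartite map with the two parties exchanged. -/
def swapParties (Φ : SuperOp (X × Y) (X' × Y')) : SuperOp (Y × X) (Y' × X') :=
  relabel (Equiv.prodComm X' Y') ∘ₗ Φ ∘ₗ relabel (Equiv.prodComm Y X)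

section Tripartite

variable {A B C A' B' C' : Type*}

/-- `A(BC) ≃ B(AC)` -/
def regroupB (A B C : Type*) : A × (B × C) ≃ B × (A × C) where
  toFun p := (p.2.1, (p.1, p.2.2))
  invFun p := (p.2.1, (p.1, p.2.2))
  left_inv _ := rfl
  right_inv _ := rfl

/-- `A(BC) ≃ C(AB)` -/
def regroupC (A B C : Type*) : A × (B × C) ≃ C × (A × B) where
  toFun p := (p.2.2, (p.1, p.2.1))
  invFun p := (p.2.1, (p.2.2, p.1))
  left_inv _ := rfl
  right_inv _ := rfl

/-- A tripartite map regarded as a bipartite map across the cut `B - AC`. -/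
def cutB (Φ : SuperOp (A × (B × C)) (A' × (B' × C'))) : SuperOp (B × (A × C)) (B' × (A' × C')) :=
  relabel (regroupB A' B' C') ∘ₗ Φ ∘ₗ relabel (regroupB A B C).symm

/-- A tripartite map regarded as a bipartite map across the cut `C - AB`. -/
def cutC (Φ : SuperOp (A × (B × C)) (A' × (B' × C'))) : SuperOp (C × (A × B)) (C' × (A' × B')) :=
  relabel (regroupC A' B' C') ∘ₗ Φ ∘ₗ relabel (regroupC A B C).symm

end Tripartite

end SuperOp

/-- The EPR pair `φ^{X X̃}`, i.e. the projection onto `|X|^{-1/2} ∑ i, |i⟩|i⟩`. -/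
def eprPair (X : Type*) [Fintype X] [DecidableEq X] : Matrix (X × X) (X × X) ℂ :=
  Matrix.of fun p q => if p.1 = p.2 ∧ q.1 = q.2 then (Fintype.card X : ℂ)⁻¹ else 0

/-- The state `φ^{X X̃} ⊗ φ^{Y Ỹ}` of two EPR pairs, with the tensor factors ordered as
`(X ⊗ Y) ⊗ (X̃ ⊗ Ỹ)`. -/
def eprPairs (X Y : Type*) [Fintype X] [DecidableEq X] [Fintype Y] [DecidableEq Y] :
    Matrix ((X × Y) × (X × Y)) ((X × Y) × (X × Y)) ℂ :=
  SuperOp.relabel (Equiv.prodProdProdComm X X Y Y) (eprPair X ⊗ₖ eprPair Y)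

/-- A forward-assisted code of size `(r₁, r₂)` for broadcast channels from `A'` to `B` and `C`.
Here `A = A₁ ⊗ A₂`, with `|A₁| = |B'| = r₁` and `|A₂| = |C'| = r₂`. -/
structure ForwardAssistedCode (A' B C : Type*) [Fintype A'] [Fintype B] [Fintype C]
    (r₁ r₂ : ℕ) where
  /-- The dimension of the system `R`, sent from Alice to Bob and Charlie by an ideal channel. -/
  dimR : ℕ
  /-- Alice's encoding isometry `A → A' ⊗ R`. -/
  enc : Matrix (A' × Fin dimR) (Fin r₁ × Fin r₂) ℂ
  enc_isometry : encᴴ * enc = 1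
  /-- Bob and Charlie's joint decoding channel `R ⊗ (B ⊗ C) → B' ⊗ C'`. -/
  dec : SuperOp (Fin dimR × (B × C)) (Fin r₁ × Fin r₂)
  dec_isChannel : dec.IsChannel

namespace ForwardAssistedCode

open SuperOp

variable {A' B C : Type*} [Fintype A'] [Fintype B] [Fintype C] {r₁ r₂ : ℕ}

/-- The tripartite operation `D ∘ E : A ⊗ (B ⊗ C) → A' ⊗ (B' ⊗ C')` of the code. -/
def operation [DecidableEq B] [DecidableEq C] (Z : ForwardAssistedCode A' B C r₁ r₂) :
    SuperOp ((Fin r₁ × Fin r₂) × (B × C)) (A' × (Fin r₁ × Fin r₂)) :=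
  idTensor A' Z.dec ∘ₗ relabel (Equiv.prodAssoc A' (Fin Z.dimR) (B × C)) ∘ₗ
    conj (Z.enc ⊗ₖ (1 : Matrix (B × C) (B × C) ℂ))

/-- The map `D ∘ N ∘ E : A₁ ⊗ A₂ → B' ⊗ C'` which results from a use of the channel `N`. -/
def inducedMap (Z : ForwardAssistedCode A' B C r₁ r₂) (N : SuperOp A' (B × C)) :
    SuperOp (Fin r₁ × Fin r₂) (Fin r₁ × Fin r₂) :=
  Z.dec ∘ₗ idTensor (Fin Z.dimR) N ∘ₗ relabel (Equiv.prodComm A' (Fin Z.dimR)) ∘ₗ conj Z.enc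

/-- The average channel input: the state of `A'` when halves of two EPR pairs are encoded. -/
def averageInput (Z : ForwardAssistedCode A' B C r₁ r₂) : Matrix A' A' ℂ :=
  traceSnd (traceFst (idTensor (Fin r₁ × Fin r₂) (conj Z.enc) (eprPairs (Fin r₁) (Fin r₂))))

/-- The channel fidelity: the overlap of the two EPR pairs with the state that results from them
when one half of each is encoded, sent through `N` and decoded. -/
def channelFidelity (Z : ForwardAssistedCode A' B C r₁ r₂) (N : SuperOp A' (B × C)) : ℂ :=
  (eprPairs (Fin r₁) (Fin r₂) *
    idTensor (Fin r₁ × Fin r₂) (Z.inducedMap N) (eprPairs (Fin r₁) (Fin r₂))).trace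

/-- The code is PPT-preserving across each of the cuts `A - BC`, `B - AC` and `C - AB`. -/
structure IsPPTPreserving [DecidableEq B] [DecidableEq C]
    (Z : ForwardAssistedCode A' B C r₁ r₂) : Prop where
  pptA : Z.operation.PPTPreserving
  pptB : Z.operation.cutB.PPTPreserving
  pptC : Z.operation.cutC.PPTPreserving

/-- The code is no-signalling: no party can signal to the other two, and no two parties can
signal to the third one. -/
structure IsNoSignalling [DecidableEq B] [DecidableEq C]
    (Z : ForwardAssistedCode A' B C r₁ r₂) : Prop where
  a_bc : Z.operation.NoSignalling
  b_ac : Z.operation.cutB.NoSignalling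
  c_ab : Z.operation.cutC.NoSignalling
  bc_a : Z.operation.swapParties.NoSignalling
  ac_b : Z.operation.cutB.swapParties.NoSignalling
  ab_c : Z.operation.cutC.swapParties.NoSignalling

end ForwardAssistedCode

namespace BroadcastSDP

variable {A' B C : Type*}

/-- The operators on `A' ⊗ B ⊗ C`. -/
abbrev Op (A' B C : Type*) := Matrix (A' × (B × C)) (A' × (B × C)) ℂ

/-- `E^{T_B}` -/
def transB (E : Op A' B C) : Op A' B C :=
  Matrix.of fun p q => E (p.1, (q.2.1, p.2.2)) (q.1, (p.2.1, q.2.2))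

/-- `E^{T_C}` -/
def transC (E : Op A' B C) : Op A' B C :=
  Matrix.of fun p q => E (p.1, (p.2.1, q.2.2)) (q.1, (q.2.1, p.2.2))

/-- `E^{T_{BC}}` -/
def transBC (E : Op A' B C) : Op A' B C :=
  Matrix.of fun p q => E (p.1, q.2) (q.1, p.2)

/-- `Tr_B E ⊗ 1^B / |B|`, as an operator on `A' ⊗ B ⊗ C`. -/
def mixB [Fintype B] [DecidableEq B] (E : Op A' B C) : Op A' B C :=
  Matrix.of fun p q => (∑ b, E (p.1, (b, p.2.2)) (q.1, (b, q.2.2))) *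
    (if p.2.1 = q.2.1 then (Fintype.card B : ℂ)⁻¹ else 0)

/-- `Tr_C E ⊗ 1^C / |C|`, as an operator on `A' ⊗ B ⊗ C`. -/
def mixC [Fintype C] [DecidableEq C] (E : Op A' B C) : Op A' B C :=
  Matrix.of fun p q => (∑ c, E (p.1, (p.2.1, c)) (q.1, (q.2.1, c))) *
    (if p.2.2 = q.2.2 then (Fintype.card C : ℂ)⁻¹ else 0)

variable [Fintype A'] [DecidableEq A'] [Fintype B] [DecidableEq B] [Fintype C] [DecidableEq C]

/-- The part of the semidefinite program which is common to all classes of codes. -/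
structure Basic (N : SuperOp A' (B × C)) (r₁ r₂ : ℕ) (ρ : Matrix A' A' ℂ) (f : ℝ)
    (E₁ E₂ E₃ : Op A' B C) : Prop where
  trace_input : ρ.trace = 1
  fidelity : (f : ℂ) = (E₁ * N.choiᵀ).trace
  cp₁ : 0 ≤ E₁
  cp₂ : 0 ≤ E₂
  cp₃ : 0 ≤ E₃
  bc_a : E₁ + ((r₂ : ℂ) ^ 2 - 1) • E₂ + ((r₁ : ℂ) ^ 2 - 1) • E₃ ≤
    ρ ⊗ₖ (1 : Matrix (B × C) (B × C) ℂ)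

/-- The no-signalling constraints. -/
structure NS (r₁ r₂ : ℕ) (E₁ E₂ E₃ : Op A' B C) : Prop where
  a_bc₁ : SuperOp.traceFst E₁ = ((r₁ : ℂ) ^ 2 * (r₂ : ℂ) ^ 2)⁻¹ • 1
  a_bc₂ : SuperOp.traceFst E₂ = ((r₁ : ℂ) ^ 2 * (r₂ : ℂ) ^ 2)⁻¹ • 1
  a_bc₃ : SuperOp.traceFst E₃ = ((r₁ : ℂ) ^ 2 * (r₂ : ℂ) ^ 2)⁻¹ • 1
  b_ac : E₁ + ((r₁ : ℂ) ^ 2 - 1) • E₃ = mixB (E₁ + ((r₁ : ℂ) ^ 2 - 1) • E₃)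
  c_ab : E₁ + ((r₂ : ℂ) ^ 2 - 1) • E₂ = mixC (E₁ + ((r₂ : ℂ) ^ 2 - 1) • E₂)

/-- The constraints for the positive partial transposes. -/
structure PPT (r₁ r₂ : ℕ) (ρ : Matrix A' A' ℂ) (E₁ E₂ E₃ : Op A' B C) : Prop where
  a₁ : -((1 / ((r₁ : ℂ) * r₂)) • (ρ ⊗ₖ (1 : Matrix (B × C) (B × C) ℂ)))
      - (1 + 1 / (r₂ : ℂ) + 1 / (r₁ : ℂ)) • transBC E₁ ≤
    (((r₂ : ℂ) ^ 2 - 1) / r₂) • transBC E₂ + (((r₁ : ℂ) ^ 2 - 1) / r₁) • transBC E₃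
  a₂ : (((r₂ : ℂ) ^ 2 - 1) / r₂) • transBC E₂ + (((r₁ : ℂ) ^ 2 - 1) / r₁) • transBC E₃ ≤
    (1 / ((r₁ : ℂ) * r₂)) • (ρ ⊗ₖ (1 : Matrix (B × C) (B × C) ℂ))
      + (1 - 1 / (r₂ : ℂ) - 1 / (r₁ : ℂ)) • transBC E₁
  a₃ : -((1 / ((r₁ : ℂ) * r₂)) • (ρ ⊗ₖ (1 : Matrix (B × C) (B × C) ℂ)))
      + (1 - 1 / (r₂ : ℂ) + 1 / (r₁ : ℂ)) • transBC E₁ ≤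
    (((r₂ : ℂ) ^ 2 - 1) / r₂) • transBC E₂ - (((r₁ : ℂ) ^ 2 - 1) / r₁) • transBC E₃
  a₄ : (((r₂ : ℂ) ^ 2 - 1) / r₂) • transBC E₂ - (((r₁ : ℂ) ^ 2 - 1) / r₁) • transBC E₃ ≤
    (1 / ((r₁ : ℂ) * r₂)) • (ρ ⊗ₖ (1 : Matrix (B × C) (B × C) ℂ))
      - (1 + 1 / (r₂ : ℂ) - 1 / (r₁ : ℂ)) • transBC E₁
  b₁ : -(((r₁ : ℂ) - 1) • transB E₃) ≤ transB E₁
  b₂ : transB E₁ ≤ ((r₁ : ℂ) + 1) • transB E₃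
  b₃ : -(ρ ⊗ₖ (1 : Matrix (B × C) (B × C) ℂ) - ((r₁ : ℂ) ^ 2 - 1) • transB E₃ - transB E₁) ≤
    ((r₁ : ℂ) * ((r₂ : ℂ) ^ 2 - 1)) • transB E₂
  b₄ : ((r₁ : ℂ) * ((r₂ : ℂ) ^ 2 - 1)) • transB E₂ ≤
    ρ ⊗ₖ (1 : Matrix (B × C) (B × C) ℂ) - ((r₁ : ℂ) ^ 2 - 1) • transB E₃ - transB E₁
  c₁ : -(((r₂ : ℂ) - 1) • transC E₂) ≤ transC E₁
  c₂ : transC E₁ ≤ ((r₂ : ℂ) + 1) • transC E₂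
  c₃ : -(ρ ⊗ₖ (1 : Matrix (B × C) (B × C) ℂ) - ((r₂ : ℂ) ^ 2 - 1) • transC E₂ - transC E₁) ≤
    ((r₂ : ℂ) * ((r₁ : ℂ) ^ 2 - 1)) • transC E₃
  c₄ : ((r₂ : ℂ) * ((r₁ : ℂ) ^ 2 - 1)) • transC E₃ ≤
    ρ ⊗ₖ (1 : Matrix (B × C) (B × C) ℂ) - ((r₂ : ℂ) ^ 2 - 1) • transC E₂ - transC E₁

end BroadcastSDP

end

/-! All properties of a code that matter here are read off the Choi matrix J of `operation`, a
positive operator on A, BC, A', B'C'. The problem is symmetric under U ⊗ Ū on A₁B' and V ⊗ V̄ on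
A₂C', so only four numbers' worth of J on these pairs count. Instead of averaging over unitaries,
the proof contracts J with P_i ⊗ P_j, where P₀ = φ and P₁ = 1 - φ (`components`). This gives four
positive operators D i j on A'BC that sum to ρ ⊗ 1, and the fidelity is Tr D₀₀ Nᵀ. The operators of
the theorem are E₁ = D₀₀, E₂ = D₀₁/(r₂² - 1), E₃ = D₁₀/(r₁² - 1); D₁₁ is the remainder, whence the
inequality in (Basic).

PPT: partial transposition turns φ into F/r with F the swap, hence 1 ± rφ into the positive
operators 1 ± F. Weighting the D i j by the coefficients of 1 ± rφ gives the constraints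
(`feasiblePPT_components`). No-signalling: the marginals of P_i are multiples of the identity, so a
no-signalling condition on J becomes a condition on a marginal of the D i j
(`feasibleNS_components`).

Conversely, `assemble` builds J from the D i j with the projections divided by their ranks, and the
same two computations run backwards. Such a J has trace over B'C' equal to the identity on A and BC
times ρ, and every such J comes from a code (`exists_of_choi`): Alice prepares a purification of ρ,
feeds one half to the channel and forwards the other half together with A.

The delicate point is r = 1, where 1 - φ = 0 and E₂ or E₃ drops out of (Basic). Then D₁₁ has to
vanish; (NS) forces this by a trace computation (`FeasibleNS.eq_zero`), while with (PPT) alone D₁₁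
is merged into a neighbouring component (`FeasiblePPT.exists_feasible`). If r₁ = r₂ = 1 this is
impossible: E₁ = E₂ = E₃ = ρ ⊗ 1/2 with ρ ≥ 0 of trace one satisfies (Basic) and (PPT) with fidelity
1/2, but every code has fidelity 1. -/

set_option linter.unusedSectionVars false

/-! ### Contraction of positive kernels -/

namespace Matrix

/-- Partial evaluation of a positive kernel along vectors yields a positive kernel. -/
theorem PosSemidef.sum_mul_star {I R T : Type*} [Finite I] [Fintype R] [Finite T]
    {J : Matrix (R × T) (R × T) ℂ} (hJ : J.PosSemidef) (w : I → R → ℂ) (t : I → T) :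
    (Matrix.of fun i j => ∑ r, ∑ r', w i r * star (w j r') * J (r, t i) (r', t j)).PosSemidef := by
  classical
  have := Fintype.ofFinite I
  have := Fintype.ofFinite T
  convert hJ.mul_mul_conjTranspose_same
    (Matrix.of fun (i : I) (p : R × T) => if p.2 = t i then w i p.1 else 0) using 1
  ext i j
  simp only [of_apply, mul_apply, conjTranspose_apply, Fintype.sum_prod_type, ite_mul, zero_mul,
    apply_ite star, star_zero, mul_ite, mul_zero, Finset.sum_ite_eq', Finset.mem_univ, if_true,
    Finset.sum_mul]
  rw [Finset.sum_comm]
  exact Finset.sum_congr rfl fun r _ => Finset.sum_congr rfl fun r' _ => by ring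

/-- Contraction of two positive kernels over the first tensor factor. -/
theorem PosSemidef.sum_mul {I R T : Type*} [Finite I] [Fintype R] [Finite T]
    {P : Matrix (R × I) (R × I) ℂ} {J : Matrix (R × T) (R × T) ℂ}
    (hP : P.PosSemidef) (hJ : J.PosSemidef) :
    (Matrix.of fun i j : I × T => ∑ r, ∑ r', P (r, i.1) (r', j.1) * J (r, i.2) (r', j.2)).PosSemidef := by
  classical
  have := Fintype.ofFinite I
  obtain ⟨B, rfl⟩ := CStarAlgebra.nonneg_iff_eq_star_mul_self.mp hP.nonneg
  -- Each row of B contributes a rank-one kernel to P = B*B, so the contraction is a sum over the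
  -- rows.
  have h := Matrix.posSemidef_sum (Finset.univ : Finset (R × I)) fun k _ =>
    hJ.sum_mul_star (fun (i : I × T) r => star (B k (r, i.1))) (fun i => i.2)
  convert h using 1
  ext i j
  simp only [of_apply, sum_apply, star_star, star_eq_conjTranspose, mul_apply,
    conjTranspose_apply, Finset.sum_mul]
  exact (Finset.sum_congr rfl fun r _ => Finset.sum_comm).trans Finset.sum_comm

end Matrix

/-! ### Choi matrices of channels, PPT-preserving maps and no-signalling maps -/

namespace SuperOp

variable {X Y X' Y' X₁ Y₁ : Type*}

/-- The map with a given Choi matrix. -/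
noncomputable def ofChoi [Fintype X] (J : Matrix (X × Y) (X × Y) ℂ) : SuperOp X Y where
  toFun M := Matrix.of fun y y' => ∑ x, ∑ x', M x x' * J (x, y) (x', y')
  map_add' M M' := by ext; simp [add_mul, Finset.sum_add_distrib]
  map_smul' c M := by ext; simp [Finset.mul_sum, mul_assoc]

theorem apply_eq_sum_choi [Fintype X] [DecidableEq X] (Φ : SuperOp X Y) (M : Matrix X X ℂ)
    (y y' : Y) : Φ M y y' = ∑ x, ∑ x', M x x' * choi Φ (x, y) (x', y') := by
  conv_lhs => rw [Matrix.matrix_eq_sum_single M]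
  simp only [map_sum, Matrix.sum_apply]
  refine Finset.sum_congr rfl fun x _ => Finset.sum_congr rfl fun x' _ => ?_
  rw [show Matrix.single x x' (M x x') = M x x' • Matrix.single x x' 1 by
    rw [Matrix.smul_single, smul_eq_mul, mul_one], map_smul]
  rfl

@[simp]
theorem choi_ofChoi [Fintype X] [DecidableEq X] (J : Matrix (X × Y) (X × Y) ℂ) :
    choi (ofChoi J) = J := by
  ext p q
  simp [choi, ofChoi, Matrix.single_apply, ite_and]

theorem idTensor_apply_eq_sum_choi [Fintype X] [DecidableEq X] {K : Type*} (Φ : SuperOp X Y)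
    (M : Matrix (K × X) (K × X) ℂ) (p q : K × Y) :
    idTensor K Φ M p q = ∑ x, ∑ x', M (p.1, x) (q.1, x') * choi Φ (x, p.2) (x', q.2) :=
  apply_eq_sum_choi Φ _ _ _

/-- The output is the contraction of M with the Choi matrix over the input system. -/
theorem idTensor_posSemidef [Fintype X] [DecidableEq X] [Finite Y] {K : Type*} [Finite K]
    {Φ : SuperOp X Y} (hΦ : (choi Φ).PosSemidef) {M : Matrix (K × X) (K × X) ℂ}
    (hM : M.PosSemidef) : (idTensor K Φ M).PosSemidef := by
  convert (hM.submatrix Prod.swap).sum_mul hΦ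
  ext p q
  exact idTensor_apply_eq_sum_choi Φ M p q

/-- The vector `∑ x, |x⟩|x⟩`, up to a relabelling of the first factor, as a projection. -/
theorem posSemidef_maxEntangled [DecidableEq X] [Finite X] {K : Type*} [Finite K] (e : K → X) :
    (Matrix.of fun p q : K × X => if e p.1 = p.2 ∧ e q.1 = q.2 then (1 : ℂ) else 0).PosSemidef := by
  convert Matrix.posSemidef_vecMulVec_self_star
    (fun p : K × X => if e p.1 = p.2 then (1 : ℂ) else 0)
  ext p q
  by_cases h₁ : e p.1 = p.2 <;> simp [Matrix.vecMulVec_apply, h₁]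

theorem IsChannel.choi_posSemidef [Fintype X] [Fintype Y] [DecidableEq X] {Φ : SuperOp X Y}
    (hΦ : Φ.IsChannel) : (choi Φ).PosSemidef := by
  have h := (hΦ.completelyPositive (Fintype.card X) _
    (posSemidef_maxEntangled (Fintype.equivFin X).symm)).submatrix
      (Prod.map (Fintype.equivFin X) id : X × Y → _)
  convert h using 1
  ext p q
  simp [idTensor_apply_eq_sum_choi, ite_and]

theorem sum_choi_of_tracePreserving [Fintype X] [Fintype Y] [DecidableEq X] {Φ : SuperOp X Y}
    (hΦ : ∀ M, (Φ M).trace = M.trace) (x x' : X) :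
    ∑ y, choi Φ (x, y) (x', y) = if x = x' then 1 else 0 := by
  have h := hΦ (Matrix.single x x' 1)
  rw [Matrix.trace] at h
  simp only [choi, Matrix.of_apply]
  refine h.trans ?_
  split_ifs with hx
  · subst hx; simp
  · simp [hx]

theorem isChannel_of_choi [Fintype X] [Fintype Y] [DecidableEq X] {Φ : SuperOp X Y}
    (h₁ : (choi Φ).PosSemidef)
    (h₂ : ∀ x x', ∑ y, choi Φ (x, y) (x', y) = if x = x' then 1 else 0) : Φ.IsChannel where
  completelyPositive _ _ hM := idTensor_posSemidef h₁ hM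
  tracePreserving M := by
    simp only [Matrix.trace, Matrix.diag, apply_eq_sum_choi Φ M]
    rw [Finset.sum_comm]
    simp_rw [Finset.sum_comm (s := (Finset.univ : Finset Y)), ← Finset.mul_sum, h₂]
    simp

theorem choi_relabel [DecidableEq X] [DecidableEq X₁] (Φ : SuperOp X Y) (e : X₁ ≃ X)
    (f : Y ≃ Y₁) (p q : X₁ × Y₁) :
    choi (relabel f ∘ₗ Φ ∘ₗ relabel e) p q =
      choi Φ (e p.1, f.symm p.2) (e q.1, f.symm q.2) := by
  simp [choi, relabel]

theorem IsChannel.relabel [Fintype X] [Fintype Y] [Fintype X₁] [Fintype Y₁]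
    {Φ : SuperOp X Y} (hΦ : Φ.IsChannel) (e : X₁ ≃ X)
    (f : Y ≃ Y₁) : IsChannel (relabel f ∘ₗ Φ ∘ₗ relabel e) := by
  classical
  refine isChannel_of_choi ?_ fun x x' => ?_
  · convert hΦ.choi_posSemidef.submatrix (Prod.map e f.symm)
    ext p q
    exact choi_relabel Φ e f p q
  · simp only [choi_relabel]
    rw [Equiv.sum_comp f.symm (fun y => choi Φ (e x, y) (e x', y)),
      sum_choi_of_tracePreserving hΦ.tracePreserving]
    simp

/-- PPT-preservation in terms of the Choi matrix. -/
theorem pptPreserving_iff [Fintype X] [Fintype Y] [Finite X'] [Finite Y'] [DecidableEq X]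
    [DecidableEq Y] (Φ : SuperOp (X × Y) (X' × Y')) :
    Φ.PPTPreserving ↔ (cutTranspose (choi Φ)).PosSemidef := by
  constructor
  · intro h
    -- Each party entangles its input maximally with a reference, so the output is the Choi matrix.
    -- This input is a product across the cut and is equal to its own cut transpose.
    have := (h (Fintype.card X) (Fintype.card Y) _ (posSemidef_maxEntangled
      (Prod.map (Fintype.equivFin X).symm (Fintype.equivFin Y).symm)) ?_).submatrix
        (Prod.map (Prod.map (Fintype.equivFin X) (Fintype.equivFin Y)) id :
          (X × Y) × (X' × Y') → _)
    · convert this using 1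
      ext ⟨⟨x, y⟩, p⟩ ⟨⟨x', y'⟩, q⟩
      simp [cutTranspose, idTensor_apply_eq_sum_choi, ite_and]
    · convert posSemidef_maxEntangled
        (Prod.map (Fintype.equivFin X).symm (Fintype.equivFin Y).symm) using 1
      ext p q
      simp only [cutTranspose, Matrix.of_apply, Prod.map, Prod.ext_iff]
      congr 1
      apply propext
      tauto
  · intro h k l M _ hM
    -- The cut transpose of the output is the image of the cut transpose of M under the map whose
    -- Choi matrix is the transposed one, and that map is completely positive.
    convert idTensor_posSemidef (Φ := ofChoi (cutTranspose (choi Φ))) (by simpa using h) hM using 1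
    ext p q
    simp only [cutTranspose, Matrix.of_apply, idTensor_apply_eq_sum_choi, Fintype.sum_prod_type,
      choi_ofChoi]
    refine (Finset.sum_congr rfl fun x _ => Finset.sum_comm).trans
      (Finset.sum_comm.trans (Finset.sum_congr rfl fun x' _ => Finset.sum_comm))

theorem traceFst_single [Fintype X] [DecidableEq X] [DecidableEq Y] (x x' : X) (y y' : Y) :
    traceFst (Matrix.single (x, y) (x', y') (1 : ℂ)) =
      if x = x' then Matrix.single y y' 1 else 0 := by
  ext a b
  split_ifs with h
  · subst h
    simp [traceFst, Matrix.single_apply, ite_and]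
  · simp [traceFst, Matrix.single_apply, ite_and]
    exact fun _ hx => absurd hx.symm h

/-- No-signalling in terms of the Choi matrix. -/
theorem noSignalling_iff [Fintype X] [Fintype Y] [Fintype X'] [Fintype Y'] [DecidableEq X]
    [DecidableEq Y] [Nonempty X] {Φ : SuperOp (X × Y) (X' × Y')} (hΦ : Φ.IsChannel) :
    Φ.NoSignalling ↔ ∃ G : Matrix (Y × Y') (Y × Y') ℂ, ∀ x x₁ y y₁ y' y₁',
      ∑ x', choi Φ ((x, y), (x', y')) ((x₁, y₁), (x', y₁')) =
        if x = x₁ then G (y, y') (y₁, y₁') else 0 := by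
  constructor
  · rintro ⟨Ψ, hΨ, h⟩
    refine ⟨choi Ψ, fun x x₁ y y₁ y' y₁' => ?_⟩
    have := congrFun (congrFun (LinearMap.congr_fun h (Matrix.single (x, y) (x₁, y₁) 1)) y') y₁'
    refine this.trans ?_
    rw [LinearMap.comp_apply, traceFst_single]
    split_ifs
    · rfl
    · simp
  · rintro ⟨G, hG⟩
    -- G is a sum of diagonal blocks of the Choi matrix at one fixed input of the first party, hence
    -- positive.
    refine ⟨ofChoi G, isChannel_of_choi ?_ fun y y₁ => ?_, ?_⟩
    · rw [choi_ofChoi]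
      convert Matrix.posSemidef_sum Finset.univ fun (x' : X') _ =>
        hΦ.choi_posSemidef.submatrix fun p : Y × Y' => ((Classical.arbitrary X, p.1), (x', p.2))
      ext p q
      simpa [Matrix.sum_apply] using
        (hG (Classical.arbitrary X) (Classical.arbitrary X) p.1 q.1 p.2 q.2).symm
    · have h := sum_choi_of_tracePreserving hΦ.tracePreserving (Classical.arbitrary X, y)
        (Classical.arbitrary X, y₁)
      rw [Fintype.sum_prod_type, Finset.sum_comm] at h
      simpa [hG] using h
    · ext M y' y₁'
      simp only [LinearMap.comp_apply, traceFst, LinearMap.coe_mk, AddHom.coe_mk, Matrix.of_apply,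
        apply_eq_sum_choi Φ M, ofChoi]
      rw [Finset.sum_comm]
      simp_rw [Finset.sum_comm (s := (Finset.univ : Finset X')), ← Finset.mul_sum,
        Fintype.sum_prod_type, hG, mul_ite, mul_zero]
      simp_rw [Finset.sum_mul]
      have h (x : X) (y : Y) : (∑ x₁, ∑ y₁, if x = x₁ then
          M (x, y) (x₁, y₁) * G (y, y') (y₁, y₁') else 0) =
          ∑ y₁, M (x, y) (x, y₁) * G (y, y') (y₁, y₁') := by
        rw [Finset.sum_comm]
        simp
      simp_rw [h]
      exact Finset.sum_comm.trans (Finset.sum_congr rfl fun y _ => Finset.sum_comm)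

end SuperOp

/-! ### Supports of positive operators and purifications -/

namespace Matrix

variable {R T U S : Type*} [Fintype R]

/-- For J = B*B the trace is the squared Hilbert–Schmidt norm of QB*. -/
theorem PosSemidef.mul_eq_zero_of_trace {m n : Type*} [Fintype m] [Fintype n]
    {J : Matrix n n ℂ} (hJ : J.PosSemidef) (Q : Matrix m n ℂ) (h : (Q * J * Qᴴ).trace = 0) :
    Q * J = 0 := by
  classical
  obtain ⟨B, rfl⟩ := CStarAlgebra.nonneg_iff_eq_star_mul_self.mp hJ.nonneg
  rw [star_eq_conjTranspose] at *
  have h' : Q * Bᴴ = 0 := by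
    rw [← trace_mul_conjTranspose_self_eq_zero_iff, ← h]
    simp only [conjTranspose_mul, conjTranspose_conjTranspose, Matrix.mul_assoc]
  rw [← Matrix.mul_assoc, h', Matrix.zero_mul]

theorem kronecker_one_mul_mul_apply [Fintype T] [DecidableEq T] {m : Type*} (W : Matrix m R ℂ)
    (K : Matrix (R × T) (R × T) ℂ) (p q : m × T) :
    ((W ⊗ₖ (1 : Matrix T T ℂ)) * K * (W ⊗ₖ (1 : Matrix T T ℂ))ᴴ) p q =
      ∑ k, ∑ k', W p.1 k * star (W q.1 k') * K (k, p.2) (k', q.2) := by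
  simp only [mul_apply, conjTranspose_apply, kroneckerMap_apply, one_apply,
    Fintype.sum_prod_type, mul_ite, mul_one, mul_zero, ite_mul, zero_mul, apply_ite star, star_zero,
    Finset.sum_ite_eq, Finset.mem_univ, if_true, Finset.sum_mul]
  rw [Finset.sum_comm]
  exact Finset.sum_congr rfl fun r _ => Finset.sum_congr rfl fun r' _ => by ring

variable [DecidableEq R]

/-- The support of a positive J lies in the support of its marginal tensored with 1: the trace of (Q
⊗ 1) J (Q ⊗ 1)* depends on the marginal only. -/
theorem PosSemidef.kronecker_one_mul_eq_zero [Fintype T] [DecidableEq T]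
    {J : Matrix (R × T) (R × T) ℂ} (hJ : J.PosSemidef) (Q : Matrix R R ℂ)
    (h : Q * SuperOp.traceSnd J = 0) : (Q ⊗ₖ (1 : Matrix T T ℂ)) * J = 0 := by
  refine hJ.mul_eq_zero_of_trace _ ?_
  have h' : (Q * SuperOp.traceSnd J * Qᴴ).trace = 0 := by rw [h]; simp
  rw [← h']
  simp only [trace, diag, kronecker_one_mul_mul_apply, Fintype.sum_prod_type]
  refine Finset.sum_congr rfl fun a _ => ?_
  simp only [mul_apply, conjTranspose_apply, SuperOp.traceSnd, LinearMap.coe_mk, AddHom.coe_mk,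
    of_apply, Finset.sum_mul, Finset.mul_sum]
  rw [Finset.sum_comm]
  refine (Finset.sum_congr rfl fun _ _ => Finset.sum_comm).trans (Finset.sum_comm.trans ?_)
  refine Finset.sum_congr rfl fun _ _ => Finset.sum_congr rfl fun _ _ =>
    Finset.sum_congr rfl fun _ _ => by ring

/-- Every positive matrix `ρ` has a square factor `W` with a one-sided partial inverse. -/
theorem PosSemidef.exists_factor {ρ : Matrix R R ℂ} (hρ : ρ.PosSemidef) :
    ∃ (W G : Matrix R R ℂ) (z : R → ℂ), W * Wᴴ = ρ ∧ 0 ≤ z ∧ W * diagonal z = 0 ∧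
      G * ρ * Gᴴ + diagonal z = 1 ∧ W * G * ρ = ρ := by
  obtain ⟨U, l, hUU, hl, rfl⟩ : ∃ (U : Matrix R R ℂ) (l : R → ℝ), Uᴴ * U = 1 ∧ (∀ i, 0 ≤ l i) ∧
      ρ = U * diagonal (fun i => (l i : ℂ)) * Uᴴ := by
    refine ⟨hρ.1.eigenvectorUnitary, hρ.1.eigenvalues, ?_, hρ.eigenvalues_nonneg, ?_⟩
    · rw [← star_eq_conjTranspose]; exact Unitary.coe_star_mul_self _
    · have := hρ.1.spectral_theorem
      simpa [Unitary.conjStarAlgAut_apply, Function.comp_def, star_eq_conjTranspose] using this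
  have hUU' (M : Matrix R R ℂ) : Uᴴ * (U * M) = M := by
    rw [← Matrix.mul_assoc, hUU, Matrix.one_mul]
  have hc (v : R → ℝ) : (diagonal fun i => ((v i : ℝ) : ℂ))ᴴ = diagonal fun i => ((v i : ℝ) : ℂ) := by
    rw [diagonal_conjTranspose]
    congr 1
    ext i
    simp
  have hd (v w : R → ℝ) (M : Matrix R R ℂ) : (diagonal fun i => ((v i : ℝ) : ℂ)) *
      ((diagonal fun i => ((w i : ℝ) : ℂ)) * M) =
      (diagonal fun i => (((v i * w i : ℝ)) : ℂ)) * M := by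
    rw [← Matrix.mul_assoc, diagonal_mul_diagonal]
    simp
  have hs (i : R) : √(l i) * √(l i) = l i := Real.mul_self_sqrt (hl i)
  -- Here W = U√l and G = (√l)⁻¹U*. Since 0⁻¹ = 0, G is a pseudo-inverse of W, and z marks the zero
  -- eigenvalues that it misses.
  refine ⟨U * diagonal fun i => ((√(l i) : ℝ) : ℂ), diagonal (fun i => (((√(l i))⁻¹ : ℝ) : ℂ)) * Uᴴ,
    fun i => if l i = 0 then 1 else 0, ?_, ?_, ?_, ?_, ?_⟩
  · simp only [conjTranspose_mul, hc, Matrix.mul_assoc, hd, hs]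
  · intro i
    dsimp
    split_ifs <;> simp
  · rw [Matrix.mul_assoc, diagonal_mul_diagonal]
    convert Matrix.mul_zero U
    ext i j
    by_cases h : l i = 0 <;> simp [diagonal_apply, h]
  · simp only [conjTranspose_mul, conjTranspose_conjTranspose, hc, Matrix.mul_assoc, hUU', hd]
    rw [diagonal_mul_diagonal, diagonal_add, ← diagonal_one]
    congr 1
    ext i
    by_cases h : l i = 0
    · simp [h]
    · have h' : √(l i) ≠ 0 := (Real.sqrt_ne_zero (hl i)).mpr h
      simp only [h, if_false, add_zero, ← Complex.ofReal_mul]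
      rw [← hs i]
      field_simp
      simp [h']
  · simp only [Matrix.mul_assoc, hUU', hd]
    congr 3
    ext i
    by_cases h : l i = 0
    · simp [h]
    · have h' : √(l i) ≠ 0 := (Real.sqrt_ne_zero (hl i)).mpr h
      rw [mul_inv_cancel₀ h', one_mul]

/-- A kernel with a constant marginal `ρ` is a channel applied to one half of a purification
of `ρ`. -/
theorem PosSemidef.exists_dilation [Fintype U] [DecidableEq U] [Fintype S] [DecidableEq S]
    [Nonempty S] {J : Matrix (R × (U × S)) (R × (U × S)) ℂ} (hJ : J.PosSemidef)
    {ρ : Matrix R R ℂ} (hρ : ρ.PosSemidef)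
    (h : ∀ a a' u u', ∑ s, J (a, (u, s)) (a', (u', s)) = if u = u' then ρ a a' else 0) :
    ∃ (W : Matrix R R ℂ) (K : Matrix (R × (U × S)) (R × (U × S)) ℂ), W * Wᴴ = ρ ∧
      K.PosSemidef ∧ (∀ a a' u u', ∑ s, K (a, (u, s)) (a', (u', s)) =
        if a = a' ∧ u = u' then 1 else 0) ∧
      (W ⊗ₖ (1 : Matrix (U × S) (U × S) ℂ)) * K * (W ⊗ₖ (1 : Matrix (U × S) (U × S) ℂ))ᴴ = J := by
  obtain ⟨W, G, z, hW, hz, hWz, hG, hWG⟩ := hρ.exists_factor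
  -- The first summand is J with ρ divided out. The second one sends the kernel directions to the
  -- maximally mixed state, which restores trace preservation and is annihilated by W.
  refine ⟨W, (G ⊗ₖ 1) * J * (G ⊗ₖ 1)ᴴ + diagonal z ⊗ₖ ((Fintype.card S : ℂ)⁻¹ • 1), hW, ?_, ?_, ?_⟩
  · refine (hJ.mul_mul_conjTranspose_same _).add ((PosSemidef.diagonal hz).kronecker ?_)
    refine PosSemidef.one.smul ?_
    positivity
  · intro a a' u u'
    have h' := congrFun (congrFun hG a) a'
    simp only [mul_apply, Matrix.add_apply, conjTranspose_apply, diagonal_apply, one_apply] at h'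
    have hS : (Fintype.card S : ℂ) ≠ 0 := Nat.cast_ne_zero.mpr Fintype.card_ne_zero
    simp only [Matrix.add_apply, kronecker_one_mul_mul_apply, diagonal_apply, one_apply,
      kroneckerMap_apply, smul_apply, Finset.sum_add_distrib]
    rw [Finset.sum_comm]
    simp_rw [Finset.sum_comm (s := (Finset.univ : Finset S)), ← Finset.mul_sum, h]
    by_cases hu : u = u'
    · simp only [hu, and_true, if_true, smul_eq_mul, mul_one, Finset.sum_const, Finset.card_univ,
        nsmul_eq_mul, ← h', Finset.sum_mul]
      rw [mul_inv_cancel₀ hS, mul_one, Finset.sum_comm]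
      congr 1
      exact Finset.sum_congr rfl fun r _ => Finset.sum_congr rfl fun r' _ => by ring
    · simp [hu]
  -- The marginal of J is |U| ρ and (1 - WG)ρ = 0, so WG acts as the identity on J.
  · have h1 : ((W * G) ⊗ₖ (1 : Matrix (U × S) (U × S) ℂ)) * J = J := by
      have := hJ.kronecker_one_mul_eq_zero (1 - W * G) ?_
      · have h' := add_kronecker (W * G) (1 - W * G) (1 : Matrix (U × S) (U × S) ℂ)
        rw [add_sub_cancel, one_kronecker_one] at h'
        have h'' := congrArg (· * J) h'
        simp only [Matrix.one_mul, Matrix.add_mul] at h''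
        rwa [this, add_zero, eq_comm] at h''
      · have : SuperOp.traceSnd J = (Fintype.card U : ℂ) • ρ := by
          ext a a'
          simp [SuperOp.traceSnd, Fintype.sum_prod_type, h]
        rw [this, Matrix.mul_smul, Matrix.sub_mul, hWG]
        simp
    have h2 : J * ((W * G) ⊗ₖ (1 : Matrix (U × S) (U × S) ℂ))ᴴ = J := by
      simpa [hJ.1.eq] using congrArg (fun M => Mᴴ) h1
    have h3 : ((W * G) ⊗ₖ (1 : Matrix (U × S) (U × S) ℂ)) = (W ⊗ₖ 1) * (G ⊗ₖ 1) := by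
      rw [← mul_kronecker_mul, Matrix.one_mul]
    rw [Matrix.mul_add, Matrix.add_mul, ← mul_kronecker_mul, hWz, zero_kronecker, Matrix.zero_mul,
      add_zero]
    rw [h3, conjTranspose_mul] at h2
    rw [h3, Matrix.mul_assoc] at h1
    calc _ = (W ⊗ₖ 1) * ((G ⊗ₖ 1) * (J * ((G ⊗ₖ 1)ᴴ * (W ⊗ₖ 1)ᴴ))) := by
          simp only [Matrix.mul_assoc]
      _ = J := by rw [h2, h1]

end Matrix

/-! ### The Choi matrix of a code, and codes with a prescribed Choi matrix -/

namespace ForwardAssistedCode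

open SuperOp

variable {A' B C : Type*} [Fintype A'] [Fintype B] [Fintype C] {r₁ r₂ : ℕ}

theorem eprPairs_apply (p q : (Fin r₁ × Fin r₂) × (Fin r₁ × Fin r₂)) :
    eprPairs (Fin r₁) (Fin r₂) p q =
      if p.1 = p.2 ∧ q.1 = q.2 then ((r₁ : ℂ) * r₂)⁻¹ else 0 := by
  obtain ⟨⟨a, b⟩, ⟨c, d⟩⟩ := p
  obtain ⟨⟨a', b'⟩, ⟨c', d'⟩⟩ := q
  simp only [eprPairs, relabel, eprPair, LinearEquiv.coe_coe, Matrix.coe_reindexLinearEquiv,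
    Matrix.reindex_apply, Matrix.submatrix_apply, Matrix.kroneckerMap_apply, Matrix.of_apply,
    Equiv.prodProdProdComm_symm, Equiv.prodProdProdComm_apply, Fintype.card_fin, Prod.mk.injEq]
  by_cases h₁ : a = c <;> by_cases h₂ : b = d <;> by_cases h₃ : a' = c' <;>
    by_cases h₄ : b' = d' <;> simp [h₁, h₂, h₃, h₄, mul_comm]

theorem sum_sum_sum_sum_comm {α β γ δ : Type*} [Fintype α] [Fintype β] [Fintype γ] [Fintype δ]
    (f : α → β → γ → δ → ℂ) :
    ∑ a, ∑ b, ∑ c, ∑ d, f a b c d = ∑ c, ∑ d, ∑ a, ∑ b, f a b c d := by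
  calc _ = ∑ a, ∑ c, ∑ d, ∑ b, f a b c d := Finset.sum_congr rfl fun a _ =>
        Finset.sum_comm.trans (Finset.sum_congr rfl fun c _ => Finset.sum_comm)
    _ = _ := Finset.sum_comm.trans (Finset.sum_congr rfl fun c _ => Finset.sum_comm)

theorem averageInput_apply (Z : ForwardAssistedCode A' B C r₁ r₂) (a' ā' : A') :
    Z.averageInput a' ā' =
      ((r₁ : ℂ) * r₂)⁻¹ * ∑ a, ∑ r, Z.enc (a', r) a * star (Z.enc (ā', r) a) := by
  simp only [averageInput, traceSnd, traceFst, idTensor, LinearMap.coe_mk, AddHom.coe_mk,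
    Matrix.of_apply, eprPairs_apply, conj, Matrix.mul_apply, Matrix.conjTranspose_apply]
  rw [Finset.sum_comm]
  simp only [Finset.mul_sum]
  refine Finset.sum_congr rfl fun a _ => Finset.sum_congr rfl fun r _ => ?_
  simp only [ite_and]
  simp
  ring

variable [DecidableEq B] [DecidableEq C]

theorem choi_operation (Z : ForwardAssistedCode A' B C r₁ r₂) (a ā : Fin r₁ × Fin r₂)
    (x x' : B × C) (a' ā' : A') (s s' : Fin r₁ × Fin r₂) :
    choi Z.operation ((a, x), (a', s)) ((ā, x'), (ā', s')) =
      ∑ r, ∑ r', Z.enc (a', r) a * star (Z.enc (ā', r') ā) *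
        choi Z.dec ((r, x), s) ((r', x'), s') := by
  rw [operation, choi, Matrix.of_apply, LinearMap.comp_apply, idTensor_apply_eq_sum_choi]
  simp only [LinearMap.comp_apply, relabel, conj, LinearMap.coe_mk, AddHom.coe_mk, LinearEquiv.coe_coe,
    Matrix.coe_reindexLinearEquiv, Matrix.reindex_apply, Matrix.submatrix_apply,
    Equiv.prodAssoc_symm_apply]
  have h (p q : (A' × Fin Z.dimR) × (B × C)) :
      ((Z.enc ⊗ₖ (1 : Matrix (B × C) (B × C) ℂ)) * Matrix.single (a, x) (ā, x') (1 : ℂ) *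
        (Z.enc ⊗ₖ (1 : Matrix (B × C) (B × C) ℂ))ᴴ) p q =
        if p.2 = x ∧ q.2 = x' then Z.enc p.1 a * star (Z.enc q.1 ā) else 0 := by
    rw [Matrix.mul_assoc, Matrix.mul_apply, Finset.sum_eq_single (a, x)]
    · rw [Matrix.single_mul_apply_same]
      by_cases h₁ : p.2 = x <;> by_cases h₂ : q.2 = x' <;>
        simp [h₁, h₂, Matrix.one_apply, Matrix.conjTranspose_apply]
    · intro y _ hy
      rw [Matrix.single_mul_apply_of_ne _ _ _ _ _ hy, mul_zero]
    · simp
  simp only [h, Fintype.sum_prod_type (α₁ := Fin Z.dimR)]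
  simp only [ite_mul, zero_mul, ite_and, Finset.sum_ite_irrel, Finset.sum_const_zero,
    Finset.sum_ite_eq', Finset.mem_univ, if_true]

theorem choi_operation_posSemidef (Z : ForwardAssistedCode A' B C r₁ r₂) :
    (choi Z.operation).PosSemidef := by
  convert ((Z.dec_isChannel.choi_posSemidef).submatrix
    (fun p : Fin Z.dimR × ((B × C) × (Fin r₁ × Fin r₂)) => ((p.1, p.2.1), p.2.2))).sum_mul_star
      (fun (i : ((Fin r₁ × Fin r₂) × (B × C)) × (A' × (Fin r₁ × Fin r₂))) r =>
        Z.enc (i.2.1, r) i.1.1) (fun i => (i.1.2, i.2.2))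
  ext ⟨⟨a, x⟩, ⟨a', s⟩⟩ ⟨⟨ā, x'⟩, ⟨ā', s'⟩⟩
  exact choi_operation Z a ā x x' a' ā' s s'

/-- Tracing out the output of the decoder removes it. The inputs at B and C then cannot influence
A', which is the no-signalling condition from BC to A, valid for every forward-assisted code. -/
theorem sum_choi_operation (Z : ForwardAssistedCode A' B C r₁ r₂) (a ā : Fin r₁ × Fin r₂)
    (x x' : B × C) (a' ā' : A') :
    ∑ s, choi Z.operation ((a, x), (a', s)) ((ā, x'), (ā', s)) =
      if x = x' then ∑ r, Z.enc (a', r) a * star (Z.enc (ā', r) ā) else 0 := by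
  simp only [choi_operation]
  rw [Finset.sum_comm]
  simp_rw [Finset.sum_comm (s := (Finset.univ : Finset (Fin r₁ × Fin r₂))), ← Finset.mul_sum,
    sum_choi_of_tracePreserving Z.dec_isChannel.tracePreserving]
  by_cases h : x = x' <;> simp [h]

theorem operation_isChannel (Z : ForwardAssistedCode A' B C r₁ r₂) : Z.operation.IsChannel := by
  refine isChannel_of_choi Z.choi_operation_posSemidef ?_
  rintro ⟨a, x⟩ ⟨ā, x'⟩
  rw [Fintype.sum_prod_type]
  simp only [sum_choi_operation]
  have h := congrFun (congrFun Z.enc_isometry ā) a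
  rw [Matrix.mul_apply, Fintype.sum_prod_type] at h
  simp only [Matrix.conjTranspose_apply, Matrix.one_apply] at h
  by_cases hx : x = x'
  · simp only [hx, if_true, Prod.mk.injEq, and_true, eq_comm (a := a)]
    rw [← h]
    exact Finset.sum_congr rfl fun r _ => Finset.sum_congr rfl fun r' _ => mul_comm _ _
  · simp [hx]

theorem sum_choi_operation_eq_averageInput (Z : ForwardAssistedCode A' B C r₁ r₂)
    (x x' : B × C) (a' ā' : A') (h₁ : 0 < r₁) (h₂ : 0 < r₂) :
    ∑ a, ∑ s, choi Z.operation ((a, x), (a', s)) ((a, x'), (ā', s)) =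
      if x = x' then (r₁ : ℂ) * r₂ * Z.averageInput a' ā' else 0 := by
  have h₁' : (r₁ : ℂ) ≠ 0 := by exact_mod_cast h₁.ne'
  have h₂' : (r₂ : ℂ) ≠ 0 := by exact_mod_cast h₂.ne'
  simp only [sum_choi_operation, averageInput_apply]
  split_ifs
  · rw [mul_inv_cancel_left₀ (mul_ne_zero h₁' h₂')]
  · simp

/-- Inserting the channel contracts the two Choi matrices over A', B and C, so encoder and decoder
enter through `operation` alone. -/
theorem choi_inducedMap [DecidableEq A'] (Z : ForwardAssistedCode A' B C r₁ r₂)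
    (N : SuperOp A' (B × C)) (a s ā s' : Fin r₁ × Fin r₂) :
    choi (Z.inducedMap N) (a, s) (ā, s') = ∑ t, ∑ t',
      choi Z.operation ((a, t.2), (t.1, s)) ((ā, t'.2), (t'.1, s')) * choi N t t' := by
  rw [inducedMap, choi, Matrix.of_apply, LinearMap.comp_apply, apply_eq_sum_choi]
  have h (p q : A' × Fin Z.dimR) : (Z.enc * Matrix.single a ā (1 : ℂ) * Z.encᴴ) p q =
      Z.enc p a * star (Z.enc q ā) := by
    rw [Matrix.mul_assoc, Matrix.mul_apply, Finset.sum_eq_single a]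
    · rw [Matrix.single_mul_apply_same, one_mul, Matrix.conjTranspose_apply]
    · intro y _ hy
      rw [Matrix.single_mul_apply_of_ne _ _ _ _ _ hy, mul_zero]
    · simp
  simp only [LinearMap.comp_apply, idTensor_apply_eq_sum_choi, relabel, conj, LinearMap.coe_mk,
    AddHom.coe_mk, LinearEquiv.coe_coe, Matrix.coe_reindexLinearEquiv, Matrix.reindex_apply,
    Matrix.submatrix_apply, Equiv.prodComm_symm, Equiv.prodComm_apply, Prod.swap, h,
    choi_operation]
  simp only [Finset.sum_mul, Fintype.sum_prod_type (α₁ := Fin Z.dimR),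
    Fintype.sum_prod_type (α₁ := A')]
  rw [sum_sum_sum_sum_comm]
  refine (Finset.sum_congr rfl fun k' _ => Finset.sum_congr rfl fun x' _ =>
    sum_sum_sum_sum_comm _).trans ((sum_sum_sum_sum_comm _).trans
      (Finset.sum_congr rfl fun a' _ => ?_))
  rw [Finset.sum_comm (s := (Finset.univ : Finset (B × C)))]
  refine Finset.sum_congr rfl fun ā' _ => (sum_sum_sum_sum_comm _).trans ?_
  rw [Finset.sum_comm]
  refine Finset.sum_congr rfl fun x _ => ?_
  rw [Finset.sum_comm (s := (Finset.univ : Finset (B × C)))]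
  refine Finset.sum_congr rfl fun k _ => ?_
  rw [Finset.sum_comm]
  exact Finset.sum_congr rfl fun x' _ => Finset.sum_congr rfl fun k' _ => mul_right_comm _ _ _

theorem channelFidelity_eq [DecidableEq A'] (Z : ForwardAssistedCode A' B C r₁ r₂)
    (N : SuperOp A' (B × C)) :
    Z.channelFidelity N = ∑ t, ∑ t', (((r₁ : ℂ) * r₂)⁻¹ ^ 2 * ∑ a, ∑ ā,
      choi Z.operation ((a, t.2), (t.1, a)) ((ā, t'.2), (t'.1, ā))) * choi N t t' := by
  have h : Z.channelFidelity N = ((r₁ : ℂ) * r₂)⁻¹ ^ 2 * ∑ a, ∑ ā,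
      choi (Z.inducedMap N) (a, a) (ā, ā) := by
    simp only [channelFidelity, Matrix.trace, Matrix.diag, Matrix.mul_apply, eprPairs_apply,
      idTensor_apply_eq_sum_choi, Fintype.sum_prod_type (α₁ := Fin r₁ × Fin r₂), ite_and]
    simp only [Finset.sum_ite_eq, Finset.mem_univ, if_true, ite_mul, zero_mul,
      Finset.sum_ite_irrel, Finset.sum_const_zero, Finset.mul_sum]
    rw [Finset.sum_comm]
    exact Finset.sum_congr rfl fun _ _ => Finset.sum_congr rfl fun _ _ => by ring
  rw [h]
  simp only [choi_inducedMap, Finset.mul_sum, Finset.sum_mul]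
  rw [sum_sum_sum_sum_comm]
  simp only [mul_assoc]

/-- Alice prepares the purification of ρ given by W, puts one half into A', and sends the other half
and her whole input A through R ≅ A' ⊗ A. The decoder is the channel with Choi matrix K from
`exists_dilation`. -/
theorem exists_of_choi [DecidableEq A'] (h₁ : 0 < r₁) (h₂ : 0 < r₂) {ρ : Matrix A' A' ℂ}
    (hρ : ρ.PosSemidef) (hρ' : ρ.trace = 1)
    {J : Matrix (((Fin r₁ × Fin r₂) × (B × C)) × (A' × (Fin r₁ × Fin r₂)))
      (((Fin r₁ × Fin r₂) × (B × C)) × (A' × (Fin r₁ × Fin r₂))) ℂ} (hJ : J.PosSemidef)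
    (h : ∀ a ā x x' a' ā', ∑ s, J ((a, x), (a', s)) ((ā, x'), (ā', s)) =
      if a = ā ∧ x = x' then ρ a' ā' else 0) :
    ∃ Z : ForwardAssistedCode A' B C r₁ r₂, choi Z.operation = J := by
  have : Nonempty (Fin r₁ × Fin r₂) := ⟨(⟨0, h₁⟩, ⟨0, h₂⟩)⟩
  obtain ⟨W, K, hW, hK, hK₁, hWK⟩ := (hJ.submatrix
    (fun p : A' × (((Fin r₁ × Fin r₂) × (B × C)) × (Fin r₁ × Fin r₂)) =>
      ((p.2.1.1, p.2.1.2), (p.1, p.2.2)))).exists_dilation hρ (by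
      rintro a' ā' ⟨a, x⟩ ⟨ā, x'⟩
      simpa using h a ā x x' a' ā')
  let e := (Fintype.equivFin (A' × (Fin r₁ × Fin r₂))).symm
  let g (p : (Fin (Fintype.card (A' × (Fin r₁ × Fin r₂))) × (B × C)) × (Fin r₁ × Fin r₂)) :
    A' × (((Fin r₁ × Fin r₂) × (B × C)) × (Fin r₁ × Fin r₂)) :=
    ((e p.1.1).1, (((e p.1.1).2, p.1.2), p.2))
  refine ⟨⟨_, Matrix.of fun p a => if a = (e p.2).2 then W p.1 (e p.2).1 else 0, ?_,
    ofChoi (K.submatrix g g), isChannel_of_choi ?_ ?_⟩, ?_⟩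
  -- The encoder is an isometry because Tr WW* = Tr ρ = 1.
  · ext a ā
    simp only [Matrix.mul_apply, Matrix.conjTranspose_apply, Matrix.of_apply,
      Fintype.sum_prod_type (α₁ := A')]
    refine (Finset.sum_congr rfl fun x _ => Equiv.sum_comp e fun k =>
      star (if a = k.2 then W x k.1 else 0) * (if ā = k.2 then W x k.1 else 0)).trans ?_
    rw [← hW] at hρ'
    simp only [Matrix.trace, Matrix.diag, Matrix.mul_apply, Matrix.conjTranspose_apply] at hρ'
    simp only [Fintype.sum_prod_type (α₁ := A'), Matrix.one_apply, apply_ite star, star_zero,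
      ite_mul, zero_mul, Finset.sum_ite_eq, Finset.mem_univ, if_true]
    by_cases h : a = ā
    · subst h
      simp only [if_true, ← hρ']
      exact Finset.sum_congr rfl fun _ _ => Finset.sum_congr rfl fun _ _ => mul_comm _ _
    · simp [h, Ne.symm h]
  · rw [choi_ofChoi]
    exact hK.submatrix _
  · rintro ⟨k, x⟩ ⟨k', x'⟩
    simp only [choi_ofChoi, Matrix.submatrix_apply, g, hK₁]
    congr 1
    apply propext
    constructor
    · rintro ⟨hk, hx⟩
      exact Prod.ext (e.injective (Prod.ext hk (Prod.ext_iff.mp hx).1)) (Prod.ext_iff.mp hx).2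
    · rintro ⟨⟩
      exact ⟨rfl, rfl⟩
  · ext ⟨⟨a, x⟩, ⟨a', s⟩⟩ ⟨⟨ā, x'⟩, ⟨ā', s'⟩⟩
    have := congrFun (congrFun hWK (a', ((a, x), s))) (ā', ((ā, x'), s'))
    rw [Matrix.kronecker_one_mul_mul_apply, Matrix.submatrix_apply] at this
    rw [choi_operation, ← this]
    simp only [choi_ofChoi, Matrix.submatrix_apply, Matrix.of_apply, g]
    rw [Equiv.sum_comp e (fun k => ∑ r', (if a = k.2 then W a' k.1 else 0) *
      star (if ā = (e r').2 then W ā' (e r').1 else 0) *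
      K (k.1, ((k.2, x), s)) ((e r').1, (((e r').2, x'), s')))]
    refine (Finset.sum_congr rfl fun k _ => Equiv.sum_comp e fun k' =>
      (if a = k.2 then W a' k.1 else 0) * star (if ā = k'.2 then W ā' k'.1 else 0) *
      K (k.1, ((k.2, x), s)) (k'.1, ((k'.2, x'), s'))).trans ?_
    simp only [Fintype.sum_prod_type (α₁ := A'), apply_ite star, star_zero, ite_mul, mul_ite,
      zero_mul, mul_zero, Finset.sum_ite_eq, Finset.mem_univ, if_true, Finset.sum_ite_irrel,
      Finset.sum_const_zero]

end ForwardAssistedCode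

noncomputable section

namespace BroadcastSDP

open SuperOp

/-! ### Two-qudit operators: φ, the swap F and partial transposes -/

section Pair

/-- The operators on two qudits which the symmetrised codes are built from. -/
abbrev Pair (r : ℕ) := Matrix (Fin r × Fin r) (Fin r × Fin r) ℂ

/-- The partial transpose of a bipartite operator over the first tensor factor. -/
def ptrans {X Y : Type*} (P : Matrix (X × Y) (X × Y) ℂ) : Matrix (X × Y) (X × Y) ℂ :=
  Matrix.of fun p q => P (q.1, p.2) (p.1, q.2)

/-- The swap operator. -/
def swapOp (r : ℕ) : Pair r := Matrix.of fun p q => if p.1 = q.2 ∧ p.2 = q.1 then 1 else 0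

/-- The operators `1 + F` and `1 - F`, where `F` is the swap operator. -/
def symOp (r : ℕ) : Fin 2 → Pair r := ![1 + swapOp r, 1 - swapOp r]

/-- The projections `φ` and `1 - φ`. -/
def proj (r : ℕ) : Fin 2 → Pair r := ![eprPair (Fin r), 1 - eprPair (Fin r)]

/-- The coefficients of `1 ± r φ` with respect to `φ` and `1 - φ`. -/
def coeff (r : ℕ) : Fin 2 → Fin 2 → ℂ := ![![r + 1, 1], ![1 - r, 1]]

/-- The traces of `φ` and `1 - φ`. -/
def rankProj (r : ℕ) : Fin 2 → ℂ := ![1, (r : ℂ) ^ 2 - 1]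

variable {r r₁ r₂ : ℕ}

theorem eprPair_apply (p q : Fin r × Fin r) :
    eprPair (Fin r) p q = if p.1 = p.2 ∧ q.1 = q.2 then (r : ℂ)⁻¹ else 0 := by
  simp [eprPair]

theorem swapOp_conjTranspose : (swapOp r)ᴴ = swapOp r := by
  ext p q
  simp only [Matrix.conjTranspose_apply, swapOp, Matrix.of_apply, apply_ite star, star_one,
    star_zero]
  congr 1
  apply propext
  constructor <;> exact fun h => ⟨h.2.symm, h.1.symm⟩

theorem swapOp_mul_swapOp : swapOp r * swapOp r = 1 := by
  ext ⟨a, b⟩ ⟨c, d⟩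
  simp [swapOp, Matrix.mul_apply, Fintype.sum_prod_type, ite_and, Matrix.one_apply]

/-- Applied to (1 ± F)² = 2(1 ± F) and to projections. -/
theorem posSemidef_of_mul_self {n : Type*} [Fintype n] {P : Matrix n n ℂ} (k : ℝ) (hk : 0 ≤ k)
    (h : Pᴴ = P) (h' : P = (k : ℂ) • (P * P)) : P.PosSemidef := by
  rw [h']
  refine Matrix.PosSemidef.smul ?_ (by exact_mod_cast hk)
  nth_rewrite 1 [← h]
  exact Matrix.posSemidef_conjTranspose_mul_self P

theorem symOp_posSemidef (s : Fin 2) : (symOp r s).PosSemidef := by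
  refine posSemidef_of_mul_self (1 / 2) (by norm_num) ?_ ?_
  · fin_cases s <;> simp [symOp, swapOp_conjTranspose]
  · fin_cases s
    · simp only [symOp, Fin.zero_eta, Matrix.cons_val_zero, add_mul, mul_add, one_mul, mul_one,
        swapOp_mul_swapOp]
      module
    · simp only [symOp, Fin.mk_one, Matrix.cons_val_one, Matrix.cons_val_zero, sub_mul, mul_sub,
        one_mul, mul_one, swapOp_mul_swapOp]
      module

theorem eprPair_mul_eprPair : eprPair (Fin r) * eprPair (Fin r) = eprPair (Fin r) := by
  ext ⟨a, b⟩ ⟨c, d⟩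
  simp only [eprPair_apply, Matrix.mul_apply, Fintype.sum_prod_type, ite_and]
  by_cases h : a = b <;> by_cases h' : c = d <;> simp [h, h']
  have : (r : ℂ) ≠ 0 := by
    have := Fin.pos a
    exact_mod_cast this.ne'
  field_simp

theorem eprPair_conjTranspose : (eprPair (Fin r))ᴴ = eprPair (Fin r) := by
  ext p q
  by_cases h₁ : p.1 = p.2 <;> by_cases h₂ : q.1 = q.2 <;>
    simp [Matrix.conjTranspose_apply, eprPair_apply, h₁, h₂]

theorem proj_posSemidef (i : Fin 2) : (proj r i).PosSemidef := by
  refine posSemidef_of_mul_self 1 (by norm_num) ?_ ?_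
  · fin_cases i <;> simp [proj, eprPair_conjTranspose]
  · fin_cases i <;>
      simp [proj, eprPair_mul_eprPair, sub_mul, mul_sub]

/-- The row `coeff r s` expands 1 ± rφ in φ and 1 - φ, and the partial transpose of φ is F/r. All
PPT constraints originate from this identity. -/
theorem sum_coeff_smul_ptrans_proj (hr : 0 < r) (s : Fin 2) :
    ∑ i, coeff r s i • ptrans (proj r i) = symOp r s := by
  have h : (r : ℂ) ≠ 0 := by exact_mod_cast hr.ne'
  have h₁ : ptrans (eprPair (Fin r)) = (r : ℂ)⁻¹ • swapOp r := by
    ext p q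
    simp [ptrans, eprPair_apply, swapOp, and_comm, eq_comm]
  have h₂ : ptrans (1 - eprPair (Fin r)) = 1 - (r : ℂ)⁻¹ • swapOp r := by
    rw [← h₁]
    ext p q
    simp only [ptrans, Matrix.of_apply, Matrix.sub_apply, Matrix.one_apply, Prod.ext_iff]
    congr 2
    apply propext
    constructor <;> exact fun h => ⟨h.1.symm, h.2⟩
  rw [Fin.sum_univ_two]
  fin_cases s <;>
  · simp only [coeff, proj, symOp, Fin.zero_eta, Fin.mk_one, Matrix.cons_val_zero,
      Matrix.cons_val_one, h₁, h₂, smul_smul]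
    ext p q
    simp only [Matrix.add_apply, Matrix.sub_apply, Matrix.smul_apply, smul_eq_mul]
    field_simp
    ring

theorem sum_proj : ∑ i, proj r i = 1 := by
  simp [Fin.sum_univ_two, proj]

theorem sum_proj_apply (hr : 0 < r) (i : Fin 2) (s s' : Fin r) :
    ∑ a, proj r i (a, s) (a, s') = if s = s' then rankProj r i / r else 0 := by
  have h : (r : ℂ) ≠ 0 := by exact_mod_cast hr.ne'
  fin_cases i
  · simp [proj, eprPair_apply, rankProj, ite_and]
  · simp [proj, eprPair_apply, rankProj, ite_and, Matrix.one_apply, Finset.sum_sub_distrib]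
    split_ifs
    · field_simp
    · simp

/-- In dimension one φ is the identity; this is the source of `eq_zero₁` and `eq_zero₂`. -/
theorem proj_one (i : Fin 2) (hr : r = 1) (hi : i = 1) : proj r i = 0 := by
  subst hr hi
  ext p q
  simp [proj, eprPair_apply, Subsingleton.elim p q, eq_iff_true_of_subsingleton]

/-- The operator `P ⊗ Q`, with the tensor factors grouped into `A` and `B' ⊗ C'`. -/
def pairOp (P : Pair r₁) (Q : Pair r₂) :
    Matrix ((Fin r₁ × Fin r₂) × (Fin r₁ × Fin r₂)) ((Fin r₁ × Fin r₂) × (Fin r₁ × Fin r₂)) ℂ :=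
  Matrix.of fun x y => P (x.1.1, x.2.1) (y.1.1, y.2.1) * Q (x.1.2, x.2.2) (y.1.2, y.2.2)

theorem pairOp_posSemidef {P : Pair r₁} {Q : Pair r₂} (hP : P.PosSemidef) (hQ : Q.PosSemidef) :
    (pairOp P Q).PosSemidef :=
  (hP.kronecker hQ).submatrix fun x : (Fin r₁ × Fin r₂) × (Fin r₁ × Fin r₂) =>
    ((x.1.1, x.2.1), (x.1.2, x.2.2))

theorem pairOp_sum {ι κ : Type*} [Fintype ι] [Fintype κ] (a : ι → ℂ) (b : κ → ℂ) (P : ι → Pair r₁)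
    (Q : κ → Pair r₂) : pairOp (∑ i, a i • P i) (∑ j, b j • Q j) =
      ∑ i, ∑ j, (a i * b j) • pairOp (P i) (Q j) := by
  ext x y
  simp only [pairOp, Matrix.of_apply, Matrix.sum_apply, Matrix.smul_apply, smul_eq_mul,
    Finset.sum_mul_sum]
  exact Finset.sum_congr rfl fun _ _ => Finset.sum_congr rfl fun _ _ => by ring

theorem pairOp_epr : pairOp (eprPair (Fin r₁)) (eprPair (Fin r₂)) = eprPairs (Fin r₁) (Fin r₂) :=
  rfl

theorem pairOp_one : pairOp (1 : Pair r₁) (1 : Pair r₂) = 1 := by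
  ext ⟨⟨a, b⟩, ⟨c, d⟩⟩ ⟨⟨a', b'⟩, ⟨c', d'⟩⟩
  simp only [pairOp, Matrix.of_apply, Matrix.one_apply, Prod.mk.injEq]
  by_cases h₁ : a = a' <;> by_cases h₂ : b = b' <;> by_cases h₃ : c = c' <;>
    by_cases h₄ : d = d' <;> simp [h₁, h₂, h₃, h₄]

end Pair

/-! ### Contraction of a Choi matrix over A, B' and C' -/

section Families

variable {A' B C : Type*} {r₁ r₂ : ℕ}

/-- The Choi matrices of tripartite operations. -/
abbrev ChoiOp (A' B C : Type*) (r₁ r₂ : ℕ) :=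
  Matrix (((Fin r₁ × Fin r₂) × (B × C)) × (A' × (Fin r₁ × Fin r₂)))
    (((Fin r₁ × Fin r₂) × (B × C)) × (A' × (Fin r₁ × Fin r₂))) ℂ

/-- Partial transpose of a Choi matrix over the input and the output of Bob. -/
def choiTransB (J : ChoiOp A' B C r₁ r₂) : ChoiOp A' B C r₁ r₂ := Matrix.of fun p q =>
  J ((p.1.1, (q.1.2.1, p.1.2.2)), (p.2.1, (q.2.2.1, p.2.2.2)))
    ((q.1.1, (p.1.2.1, q.1.2.2)), (q.2.1, (p.2.2.1, q.2.2.2)))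

/-- Partial transpose of a Choi matrix over the input and the output of Charlie. -/
def choiTransC (J : ChoiOp A' B C r₁ r₂) : ChoiOp A' B C r₁ r₂ := Matrix.of fun p q =>
  J ((p.1.1, (p.1.2.1, q.1.2.2)), (p.2.1, (p.2.2.1, q.2.2.2)))
    ((q.1.1, (q.1.2.1, p.1.2.2)), (q.2.1, (q.2.2.1, p.2.2.2)))

/-- The operator on `A' ⊗ B ⊗ C` which results from a Choi matrix by an evaluation of the systems
`A`, `B'` and `C'` against `P`. -/
def compress (J : ChoiOp A' B C r₁ r₂) :
    Matrix ((Fin r₁ × Fin r₂) × (Fin r₁ × Fin r₂)) ((Fin r₁ × Fin r₂) × (Fin r₁ × Fin r₂)) ℂ →ₗ[ℂ]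
      Op A' B C where
  toFun P := Matrix.of fun t t' => ((r₁ : ℂ) * r₂)⁻¹ *
    ∑ x, ∑ y, P x y * J ((x.1, t.2), (t.1, x.2)) ((y.1, t'.2), (t'.1, y.2))
  map_add' P Q := by
    ext
    simp only [Matrix.add_apply, Matrix.of_apply, add_mul, Finset.sum_add_distrib, mul_add]
  map_smul' c P := by
    ext
    simp only [Matrix.smul_apply, Matrix.of_apply, Finset.mul_sum, smul_eq_mul, RingHom.id_apply]
    exact Finset.sum_congr rfl fun _ _ => Finset.sum_congr rfl fun _ _ => by ring

theorem compress_apply (J : ChoiOp A' B C r₁ r₂) (P) (t t') : compress J P t t' =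
    ((r₁ : ℂ) * r₂)⁻¹ *
      ∑ x, ∑ y, P x y * J ((x.1, t.2), (t.1, x.2)) ((y.1, t'.2), (t'.1, y.2)) := rfl

theorem compress_posSemidef [Finite A'] [Finite B] [Finite C] {J : ChoiOp A' B C r₁ r₂}
    (hJ : J.PosSemidef) {P} (hP : P.PosSemidef) : (compress J P).PosSemidef := by
  -- All indices of P are contracted, so `Unit` serves as its remaining factor.
  have h := ((hP.submatrix (Prod.fst : _ × Unit → _)).sum_mul (hJ.submatrix
    (fun p : ((Fin r₁ × Fin r₂) × (Fin r₁ × Fin r₂)) × (A' × (B × C)) =>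
      ((p.1.1, p.2.2), (p.2.1, p.1.2))))).submatrix (fun t : A' × (B × C) => ((), t))
  have h' := h.smul (a := ((r₁ : ℂ) * r₂)⁻¹) (by positivity)
  exact h'

/-- Transposing BC is transposing A' followed by a full transpose. `cutTranspose` transposes A as
well, which `ptrans` compensates on the first factors of P and Q. -/
theorem transBC_compress (J : ChoiOp A' B C r₁ r₂) (P : Pair r₁) (Q : Pair r₂) :
    transBC (compress J (pairOp P Q)) =
      (compress (cutTranspose J) (pairOp (ptrans P) (ptrans Q)))ᵀ := by
  ext t t'
  simp only [transBC, Matrix.transpose_apply, compress_apply, Matrix.of_apply]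
  congr 1
  simp only [Fintype.sum_prod_type (α₁ := Fin r₁ × Fin r₂)]
  refine (Finset.sum_congr rfl fun a _ => Finset.sum_comm).trans (Finset.sum_comm.trans
    (Finset.sum_congr rfl fun a' _ => Finset.sum_comm))

/-- `choiTransB` also transposes B', the second factor of P. Transposing only that factor is
`ptrans` followed by the full transpose; Q is untouched. -/
theorem transB_compress (J : ChoiOp A' B C r₁ r₂) (P : Pair r₁) (Q : Pair r₂) :
    transB (compress J (pairOp P Q)) =
      compress (choiTransB J) (pairOp (ptrans P)ᵀ Q) := by
  ext t t'
  simp only [transB, compress_apply, Matrix.of_apply]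
  congr 1
  simp only [Fintype.sum_prod_type (α₁ := Fin r₁ × Fin r₂)]
  refine Finset.sum_congr rfl fun a _ => Finset.sum_comm.trans (Eq.trans ?_ Finset.sum_comm)
  refine Finset.sum_congr rfl fun a' _ => ?_
  simp only [Fintype.sum_prod_type]
  refine (Finset.sum_congr rfl fun b _ => Finset.sum_comm).trans (Finset.sum_comm.trans
    (Finset.sum_congr rfl fun b' _ => Finset.sum_comm))

theorem transC_compress (J : ChoiOp A' B C r₁ r₂) (P : Pair r₁) (Q : Pair r₂) :
    transC (compress J (pairOp P Q)) =
      compress (choiTransC J) (pairOp P (ptrans Q)ᵀ) := by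
  ext t t'
  simp only [transC, compress_apply, Matrix.of_apply]
  congr 1
  simp only [Fintype.sum_prod_type (α₁ := Fin r₁ × Fin r₂)]
  refine Finset.sum_congr rfl fun a _ => Finset.sum_comm.trans (Eq.trans ?_ Finset.sum_comm)
  refine Finset.sum_congr rfl fun a' _ => ?_
  simp only [Fintype.sum_prod_type]
  refine Finset.sum_congr rfl fun b _ => Finset.sum_comm.trans ((Finset.sum_congr rfl fun b' _ =>
    Finset.sum_comm).trans Finset.sum_comm)

end Families

end BroadcastSDP

end

/-! ### From a code to its components -/

noncomputable section

namespace BroadcastSDP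

open SuperOp

variable {A' B C : Type*} [Fintype A'] [Fintype B] [DecidableEq B] [Fintype C] [DecidableEq C]
  {r₁ r₂ : ℕ}

/-- The components of a symmetrised Choi matrix with respect to the projections `φ` and `1 - φ`. -/
structure Feasible (r₁ r₂ : ℕ) (ρ : Matrix A' A' ℂ) (D : Fin 2 → Fin 2 → Op A' B C) : Prop where
  posSemidef : ∀ i j, (D i j).PosSemidef
  sum_eq : ∑ i, ∑ j, D i j = ρ ⊗ₖ (1 : Matrix (B × C) (B × C) ℂ)
  trace_input : ρ.trace = 1
  eq_zero₁ : r₁ = 1 → ∀ j, D 1 j = 0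
  eq_zero₂ : r₂ = 1 → ∀ i, D i 1 = 0

/-- The no-signalling constraints for the components of a symmetrised Choi matrix. -/
structure FeasibleNS (r₁ r₂ : ℕ) (D : Fin 2 → Fin 2 → Op A' B C) : Prop where
  a_bc : ∀ i j, traceFst (D i j) =
    (rankProj r₁ i * rankProj r₂ j * ((r₁ : ℂ) ^ 2 * (r₂ : ℂ) ^ 2)⁻¹) • 1
  b_ac : D 0 0 + D 1 0 = mixB (D 0 0 + D 1 0)
  c_ab : D 0 0 + D 0 1 = mixC (D 0 0 + D 0 1)

/-- The PPT constraints for the components of a symmetrised Choi matrix. -/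
structure FeasiblePPT (r₁ r₂ : ℕ) (D : Fin 2 → Fin 2 → Op A' B C) : Prop where
  a : ∀ s t, (transBC (∑ i, ∑ j, (coeff r₁ s i * coeff r₂ t j) • D i j)).PosSemidef
  b : ∀ s j, (transB (∑ i, coeff r₁ s i • D i j)).PosSemidef
  c : ∀ i t, (transC (∑ j, coeff r₂ t j • D i j)).PosSemidef

section Cuts

variable (Φ : SuperOp ((Fin r₁ × Fin r₂) × (B × C)) (A' × (Fin r₁ × Fin r₂)))

theorem choi_cutB (b a c b' a' c' b₁ a₁ c₁ b₁' a₁' c₁') :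
    choi Φ.cutB ((b, (a, c)), (b', (a', c'))) ((b₁, (a₁, c₁)), (b₁', (a₁', c₁'))) =
      choi Φ ((a, (b, c)), (a', (b', c'))) ((a₁, (b₁, c₁)), (a₁', (b₁', c₁'))) := by
  rw [cutB, choi_relabel]
  rfl

theorem choi_cutC (b a c b' a' c' b₁ a₁ c₁ b₁' a₁' c₁') :
    choi Φ.cutC ((c, (a, b)), (c', (a', b'))) ((c₁, (a₁, b₁)), (c₁', (a₁', b₁'))) =
      choi Φ ((a, (b, c)), (a', (b', c'))) ((a₁, (b₁, c₁)), (a₁', (b₁', c₁'))) := by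
  rw [cutC, choi_relabel]
  rfl

theorem choi_swapParties {X Y X' Y' : Type*} [DecidableEq X] [DecidableEq Y]
    (Φ : SuperOp (X × Y) (X' × Y')) (x y x' y' x₁ y₁ x₁' y₁') :
    choi Φ.swapParties ((y, x), (y', x')) ((y₁, x₁), (y₁', x₁')) =
      choi Φ ((x, y), (x', y')) ((x₁, y₁), (x₁', y₁')) := by
  rw [swapParties, choi_relabel]
  rfl

theorem cutB_pptPreserving_iff :
    Φ.cutB.PPTPreserving ↔ (choiTransB (choi Φ)).PosSemidef := by
  rw [pptPreserving_iff]
  constructor <;> intro h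
  · convert h.submatrix (fun p : ((Fin r₁ × Fin r₂) × (B × C)) × (A' × (Fin r₁ × Fin r₂)) =>
      ((p.1.2.1, (p.1.1, p.1.2.2)), (p.2.2.1, (p.2.1, p.2.2.2)))) using 1
    ext ⟨⟨a, b, c⟩, a', b', c'⟩ ⟨⟨a₁, b₁, c₁⟩, a₁', b₁', c₁'⟩
    simp only [Matrix.submatrix_apply, cutTranspose, Matrix.of_apply, choi_cutB, choiTransB]
  · convert h.submatrix (fun p : (B × ((Fin r₁ × Fin r₂) × C)) × (Fin r₁ × (A' × Fin r₂)) =>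
      ((p.1.2.1, (p.1.1, p.1.2.2)), (p.2.2.1, (p.2.1, p.2.2.2)))) using 1
    ext ⟨⟨b, a, c⟩, b', a', c'⟩ ⟨⟨b₁, a₁, c₁⟩, b₁', a₁', c₁'⟩
    simp only [Matrix.submatrix_apply, cutTranspose, Matrix.of_apply, choi_cutB, choiTransB]

theorem cutC_pptPreserving_iff :
    Φ.cutC.PPTPreserving ↔ (choiTransC (choi Φ)).PosSemidef := by
  rw [pptPreserving_iff]
  constructor <;> intro h
  · convert h.submatrix (fun p : ((Fin r₁ × Fin r₂) × (B × C)) × (A' × (Fin r₁ × Fin r₂)) =>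
      ((p.1.2.2, (p.1.1, p.1.2.1)), (p.2.2.2, (p.2.1, p.2.2.1)))) using 1
    ext ⟨⟨a, b, c⟩, a', b', c'⟩ ⟨⟨a₁, b₁, c₁⟩, a₁', b₁', c₁'⟩
    simp only [Matrix.submatrix_apply, cutTranspose, Matrix.of_apply, choi_cutC, choiTransC]
  · convert h.submatrix (fun p : (C × ((Fin r₁ × Fin r₂) × B)) × (Fin r₂ × (A' × Fin r₁)) =>
      ((p.1.2.1, (p.1.2.2, p.1.1)), (p.2.2.1, (p.2.2.2, p.2.1)))) using 1
    ext ⟨⟨c, a, b⟩, c', a', b'⟩ ⟨⟨c₁, a₁, b₁⟩, c₁', a₁', b₁'⟩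
    simp only [Matrix.submatrix_apply, cutTranspose, Matrix.of_apply, choi_cutC, choiTransC]

theorem noSignalling_cutB_iff [Nonempty B] {Φ : SuperOp ((Fin r₁ × Fin r₂) × (B × C))
    (A' × (Fin r₁ × Fin r₂))} (hΦ : Φ.IsChannel) :
    Φ.cutB.NoSignalling ↔ ∃ G : Matrix (((Fin r₁ × Fin r₂) × C) × (A' × Fin r₂))
      (((Fin r₁ × Fin r₂) × C) × (A' × Fin r₂)) ℂ, ∀ b b₁ y y₁ y' y₁',
      ∑ b', choi Φ ((y.1, (b, y.2)), (y'.1, (b', y'.2)))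
        ((y₁.1, (b₁, y₁.2)), (y₁'.1, (b', y₁'.2))) = if b = b₁ then G (y, y') (y₁, y₁') else 0 := by
  have h : Φ.cutB.IsChannel := hΦ.relabel _ _
  rw [noSignalling_iff h]
  simp only [← choi_cutB]

theorem noSignalling_cutC_iff [Nonempty C] {Φ : SuperOp ((Fin r₁ × Fin r₂) × (B × C))
    (A' × (Fin r₁ × Fin r₂))} (hΦ : Φ.IsChannel) :
    Φ.cutC.NoSignalling ↔ ∃ G : Matrix (((Fin r₁ × Fin r₂) × B) × (A' × Fin r₁))
      (((Fin r₁ × Fin r₂) × B) × (A' × Fin r₁)) ℂ, ∀ c c₁ y y₁ y' y₁',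
      ∑ c', choi Φ ((y.1, (y.2, c)), (y'.1, (y'.2, c')))
        ((y₁.1, (y₁.2, c₁)), (y₁'.1, (y₁'.2, c'))) = if c = c₁ then G (y, y') (y₁, y₁') else 0 := by
  have h : Φ.cutC.IsChannel := hΦ.relabel _ _
  rw [noSignalling_iff h]
  simp only [← choi_cutC]

theorem noSignalling_swapParties_iff {X Y X' Y' : Type*} [Fintype X] [Fintype Y] [Fintype X']
    [Fintype Y'] [DecidableEq X] [DecidableEq Y] [Nonempty Y] {Φ : SuperOp (X × Y) (X' × Y')}
    (hΦ : Φ.IsChannel) :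
    Φ.swapParties.NoSignalling ↔ ∃ G : Matrix (X × X') (X × X') ℂ, ∀ y y₁ x x₁ x' x₁',
      ∑ y', choi Φ ((x, y), (x', y')) ((x₁, y₁), (x₁', y')) =
        if y = y₁ then G (x, x') (x₁, x₁') else 0 := by
  have h : Φ.swapParties.IsChannel := hΦ.relabel _ _
  rw [noSignalling_iff h]
  constructor <;> rintro ⟨G, hG⟩ <;> refine ⟨G, fun y y₁ x x₁ x' x₁' => ?_⟩ <;> rw [← hG] <;>
    simp only [choi_swapParties]

end Cuts

theorem mixB_eq_self [Nonempty B] {E : Op A' B C} (F : A' × C → A' × C → ℂ)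
    (h : ∀ a b c a₁ b₁ c₁, E (a, (b, c)) (a₁, (b₁, c₁)) = if b = b₁ then F (a, c) (a₁, c₁) else 0) :
    E = mixB E := by
  have hB : (Fintype.card B : ℂ) ≠ 0 := Nat.cast_ne_zero.mpr Fintype.card_ne_zero
  ext ⟨a, b, c⟩ ⟨a₁, b₁, c₁⟩
  simp only [mixB, Matrix.of_apply, h, if_true, Finset.sum_const, Finset.card_univ, nsmul_eq_mul]
  split_ifs
  · field_simp
  · simp

theorem mixC_eq_self [Nonempty C] {E : Op A' B C} (F : A' × B → A' × B → ℂ)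
    (h : ∀ a b c a₁ b₁ c₁, E (a, (b, c)) (a₁, (b₁, c₁)) = if c = c₁ then F (a, b) (a₁, b₁) else 0) :
    E = mixC E := by
  have hC : (Fintype.card C : ℂ) ≠ 0 := Nat.cast_ne_zero.mpr Fintype.card_ne_zero
  ext ⟨a, b, c⟩ ⟨a₁, b₁, c₁⟩
  simp only [mixC, Matrix.of_apply, h, if_true, Finset.sum_const, Finset.card_univ, nsmul_eq_mul]
  split_ifs
  · field_simp
  · simp

theorem sum_pairOp_proj (h₁ : 0 < r₁) (h₂ : 0 < r₂) (i j : Fin 2) (s s' : Fin r₁ × Fin r₂) :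
    ∑ a, pairOp (proj r₁ i) (proj r₂ j) (a, s) (a, s') =
      if s = s' then rankProj r₁ i * rankProj r₂ j * ((r₁ : ℂ) * r₂)⁻¹ else 0 := by
  simp only [pairOp, Matrix.of_apply, Fintype.sum_prod_type, ← Finset.mul_sum, ← Finset.sum_mul,
    sum_proj_apply h₁, sum_proj_apply h₂]
  by_cases h : s.1 = s'.1 <;> by_cases h' : s.2 = s'.2 <;> simp [h, h', Prod.ext_iff]
  field_simp

/-- The components of the Choi matrix `J`. -/
def components (J : ChoiOp A' B C r₁ r₂) (i j : Fin 2) : Op A' B C :=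
  compress J (pairOp (proj r₁ i) (proj r₂ j))

theorem sum_components₁ (J : ChoiOp A' B C r₁ r₂) (a : Fin 2 → ℂ) (j : Fin 2) :
    ∑ i, a i • components J i j =
      compress J (pairOp (∑ i, a i • proj r₁ i) (proj r₂ j)) := by
  have := pairOp_sum a (fun _ : Unit => 1) (proj r₁) (fun _ => proj r₂ j)
  simp only [Finset.univ_unique, Finset.sum_singleton, one_smul, mul_one] at this
  rw [this, map_sum]
  simp only [map_smul, components]

theorem sum_components₂ (J : ChoiOp A' B C r₁ r₂) (b : Fin 2 → ℂ) (i : Fin 2) :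
    ∑ j, b j • components J i j =
      compress J (pairOp (proj r₁ i) (∑ j, b j • proj r₂ j)) := by
  have := pairOp_sum (fun _ : Unit => 1) b (fun _ => proj r₁ i) (proj r₂)
  simp only [Finset.univ_unique, Finset.sum_singleton, one_smul, one_mul] at this
  rw [this, map_sum]
  simp only [map_smul, components]

theorem sum_components (J : ChoiOp A' B C r₁ r₂) (a b : Fin 2 → ℂ) :
    ∑ i, ∑ j, (a i * b j) • components J i j =
      compress J (pairOp (∑ i, a i • proj r₁ i) (∑ j, b j • proj r₂ j)) := by
  rw [pairOp_sum, map_sum]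
  simp only [map_sum, map_smul, components]

theorem ptrans_sum {X Y ι : Type*} [Fintype ι] (a : ι → ℂ)
    (P : ι → Matrix (X × Y) (X × Y) ℂ) :
    ptrans (∑ i, a i • P i) = ∑ i, a i • ptrans (P i) := by
  ext
  simp [ptrans, Matrix.sum_apply]

theorem ptrans_sum_coeff (h : 0 < r₁) (s : Fin 2) :
    ptrans (∑ i, coeff r₁ s i • proj r₁ i) = symOp r₁ s := by
  rw [ptrans_sum, sum_coeff_smul_ptrans_proj h]

/-- The weights `coeff` produce 1 ± F on each pair that the cut transposes, and an untouched pair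
keeps its projection. So each constraint is a contraction of a positive partial transpose with a
positive operator. -/
theorem feasiblePPT_components {J : ChoiOp A' B C r₁ r₂} (h₁ : 0 < r₁) (h₂ : 0 < r₂)
    (hA : (cutTranspose J).PosSemidef) (hB : (choiTransB J).PosSemidef)
    (hC : (choiTransC J).PosSemidef) : FeasiblePPT r₁ r₂ (components J) where
  a s t := by
    rw [sum_components, transBC_compress, ptrans_sum_coeff h₁, ptrans_sum_coeff h₂]
    exact (compress_posSemidef hA
      (pairOp_posSemidef (symOp_posSemidef s) (symOp_posSemidef t))).transpose
  b s j := by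
    rw [sum_components₁, transB_compress, ptrans_sum_coeff h₁]
    exact compress_posSemidef hB
      (pairOp_posSemidef (symOp_posSemidef s).transpose (proj_posSemidef j))
  c i t := by
    rw [sum_components₂, transC_compress, ptrans_sum_coeff h₂]
    exact compress_posSemidef hC
      (pairOp_posSemidef (proj_posSemidef i) (symOp_posSemidef t).transpose)

theorem feasible_components [Nonempty B] [Nonempty C] (h₁ : 0 < r₁) (h₂ : 0 < r₂)
    (Z : ForwardAssistedCode A' B C r₁ r₂) :
    Feasible r₁ r₂ Z.averageInput (components (choi Z.operation)) where
  posSemidef i j := compress_posSemidef Z.choi_operation_posSemidef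
    (pairOp_posSemidef (proj_posSemidef i) (proj_posSemidef j))
  sum_eq := by
    have h₁' : (r₁ : ℂ) ≠ 0 := by exact_mod_cast h₁.ne'
    have h₂' : (r₂ : ℂ) ≠ 0 := by exact_mod_cast h₂.ne'
    have := sum_components (choi Z.operation) (fun _ => 1) (fun _ => 1)
    simp only [mul_one, one_smul, sum_proj, pairOp_one] at this
    rw [this]
    ext t t'
    rw [compress_apply]
    simp only [Matrix.one_apply, ite_mul, one_mul, zero_mul, Finset.sum_ite_eq, Finset.mem_univ,
      if_true]
    simp only [Fintype.sum_prod_type (α₁ := Fin r₁ × Fin r₂),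
      Z.sum_choi_operation_eq_averageInput _ _ _ _ h₁ h₂, Matrix.kroneckerMap_apply,
      Matrix.one_apply]
    split_ifs
    · field_simp
    · simp
  trace_input := by
    have h₁' : (r₁ : ℂ) ≠ 0 := by exact_mod_cast h₁.ne'
    have h₂' : (r₂ : ℂ) ≠ 0 := by exact_mod_cast h₂.ne'
    simp only [Matrix.trace, Matrix.diag, Z.averageInput_apply, ← Finset.mul_sum]
    rw [Finset.sum_comm]
    have h (a) : ∑ x, ∑ r, Z.enc (x, r) a * star (Z.enc (x, r) a) = 1 := by
      have := congrFun (congrFun Z.enc_isometry a) a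
      simpa [Matrix.mul_apply, Fintype.sum_prod_type, mul_comm] using this
    simp only [h]
    simp
    field_simp
  eq_zero₁ h j := by
    simp only [components, proj_one 1 h rfl]
    convert (compress (choi Z.operation)).map_zero
    ext
    simp [pairOp]
  eq_zero₂ h i := by
    simp only [components, proj_one 1 h rfl]
    convert (compress (choi Z.operation)).map_zero
    ext
    simp [pairOp]

theorem fidelity_components [DecidableEq A'] (Z : ForwardAssistedCode A' B C r₁ r₂)
    (N : SuperOp A' (B × C)) :
    Z.channelFidelity N = (components (choi Z.operation) 0 0 * N.choiᵀ).trace := by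
  rw [Z.channelFidelity_eq]
  simp only [Matrix.trace, Matrix.diag, Matrix.mul_apply, Matrix.transpose_apply, components,
    compress_apply]
  refine Finset.sum_congr rfl fun t _ => Finset.sum_congr rfl fun t' _ => ?_
  congr 1
  simp only [proj, Matrix.cons_val_zero, pairOp_epr, ForwardAssistedCode.eprPairs_apply, ite_and,
    ite_mul, zero_mul, Finset.sum_ite_irrel, Finset.sum_const_zero,
    Fintype.sum_prod_type (α₁ := Fin r₁ × Fin r₂), Finset.sum_ite_eq, Finset.mem_univ, if_true,
    Finset.mul_sum]
  exact Finset.sum_congr rfl fun _ _ => Finset.sum_congr rfl fun _ _ => by ring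

theorem feasibleNS_components [Nonempty B] [Nonempty C] (h₁ : 0 < r₁) (h₂ : 0 < r₂)
    (Z : ForwardAssistedCode A' B C r₁ r₂) (hZ : Z.IsNoSignalling) :
    FeasibleNS r₁ r₂ (components (choi Z.operation)) where
  a_bc i j := by
    have h₁' : (r₁ : ℂ) ≠ 0 := by exact_mod_cast h₁.ne'
    have h₂' : (r₂ : ℂ) ≠ 0 := by exact_mod_cast h₂.ne'
    have : Nonempty (Fin r₁ × Fin r₂) := ⟨(⟨0, h₁⟩, ⟨0, h₂⟩)⟩
    -- Tracing out A' leaves 1 ⊗ G. The marginals of the projections on B'C' are multiples of the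
    -- identity, so only the trace of G over B'C', which is 1, survives.
    obtain ⟨G, hG⟩ := (noSignalling_iff Z.operation_isChannel).mp hZ.a_bc
    have hG' (x x') : ∑ s, G (x, s) (x', s) = if x = x' then 1 else 0 := by
      have := sum_choi_of_tracePreserving Z.operation_isChannel.tracePreserving
        ((⟨0, h₁⟩, ⟨0, h₂⟩), x) ((⟨0, h₁⟩, ⟨0, h₂⟩), x')
      rw [Fintype.sum_prod_type, Finset.sum_comm] at this
      simpa [hG] using this
    ext x x'
    simp only [traceFst, LinearMap.coe_mk, AddHom.coe_mk, Matrix.of_apply, components,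
      compress_apply, ← Finset.mul_sum]
    rw [Finset.sum_comm]
    simp_rw [Finset.sum_comm (s := (Finset.univ : Finset A')), ← Finset.mul_sum, hG]
    simp only [Fintype.sum_prod_type (α₁ := Fin r₁ × Fin r₂), mul_ite, mul_zero]
    have h (a s) : (∑ a', ∑ s', if a = a' then
        pairOp (proj r₁ i) (proj r₂ j) (a, s) (a', s') * G (x, s) (x', s') else 0) =
        ∑ s', pairOp (proj r₁ i) (proj r₂ j) (a, s) (a, s') * G (x, s) (x', s') := by
      rw [Finset.sum_comm]
      simp
    simp_rw [h]
    rw [Finset.sum_comm, Finset.sum_congr rfl fun s _ => Finset.sum_comm]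
    simp_rw [← Finset.sum_mul, sum_pairOp_proj h₁ h₂, ite_mul, zero_mul]
    simp only [Finset.sum_ite_eq, Finset.mem_univ, if_true, ← Finset.mul_sum, hG',
      Matrix.smul_apply, Matrix.one_apply, smul_eq_mul]
    field_simp
  b_ac := by
    -- Summing over i puts the identity on A₁B'. This traces out B', after which no-signalling
    -- leaves only the identity on B.
    obtain ⟨G, hG⟩ := (noSignalling_cutB_iff Z.operation_isChannel).mp hZ.b_ac
    have := sum_components₁ (choi Z.operation) (fun _ => 1) 0
    simp only [one_smul, sum_proj, Fin.sum_univ_two (f := fun i => components _ i _)] at this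
    rw [this]
    refine mixB_eq_self (fun u v => ((r₁ : ℂ) * r₂)⁻¹ * ∑ a₁, ∑ a₂, ∑ s, ∑ a₂', ∑ s',
      proj r₂ 0 (a₂, s) (a₂', s') *
        G (((a₁, a₂), u.2), (u.1, s)) (((a₁, a₂'), v.2), (v.1, s'))) fun a b c a' b' c' => ?_
    rw [compress_apply]
    simp only [pairOp, Matrix.of_apply, Fintype.sum_prod_type, Matrix.one_apply, Prod.mk.injEq,
      ite_and, ite_mul, one_mul, zero_mul, Finset.sum_ite_irrel, Finset.sum_const_zero,
      Finset.sum_ite_eq, Finset.mem_univ, if_true]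
    trans ((r₁ : ℂ) * r₂)⁻¹ * ∑ a₁, ∑ a₂, ∑ s, ∑ a₂', ∑ s', proj r₂ 0 (a₂, s) (a₂', s') *
      if b = b' then G (((a₁, a₂), c), (a, s)) (((a₁, a₂'), c'), (a', s')) else 0
    · congr 1
      refine Finset.sum_congr rfl fun a₁ _ => Finset.sum_congr rfl fun a₂ _ =>
        Finset.sum_comm.trans (Finset.sum_congr rfl fun s _ => Finset.sum_comm.trans
          (Finset.sum_congr rfl fun a₂' _ => Finset.sum_comm.trans
            (Finset.sum_congr rfl fun s' _ => ?_)))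
      rw [← Finset.mul_sum]
      congr 1
      exact hG b b' ((a₁, a₂), c) ((a₁, a₂'), c') (a, s) (a', s')
    · split_ifs <;> simp
  c_ab := by
    obtain ⟨G, hG⟩ := (noSignalling_cutC_iff Z.operation_isChannel).mp hZ.c_ab
    have := sum_components₂ (choi Z.operation) (fun _ => 1) 0
    simp only [one_smul, sum_proj, Fin.sum_univ_two (f := fun i => components _ _ i)] at this
    rw [this]
    refine mixC_eq_self (fun u v => ((r₁ : ℂ) * r₂)⁻¹ * ∑ a₁, ∑ a₂, ∑ s, ∑ a₁', ∑ s',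
      proj r₁ 0 (a₁, s) (a₁', s') *
        G (((a₁, a₂), u.2), (u.1, s)) (((a₁', a₂), v.2), (v.1, s'))) fun a b c a' b' c' => ?_
    rw [compress_apply]
    simp only [pairOp, Matrix.of_apply, Fintype.sum_prod_type, Matrix.one_apply, Prod.mk.injEq,
      ite_and, mul_ite, mul_one, mul_zero, ite_mul, zero_mul, Finset.sum_ite_irrel,
      Finset.sum_const_zero, Finset.sum_ite_eq, Finset.mem_univ, if_true]
    trans ((r₁ : ℂ) * r₂)⁻¹ * ∑ a₁, ∑ a₂, ∑ s, ∑ a₁', ∑ s', proj r₁ 0 (a₁, s) (a₁', s') *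
      if c = c' then G (((a₁, a₂), b), (a, s)) (((a₁', a₂), b'), (a', s')) else 0
    · congr 1
      refine Finset.sum_congr rfl fun a₁ _ => Finset.sum_congr rfl fun a₂ _ =>
        Finset.sum_congr rfl fun s _ => Finset.sum_comm.trans (Finset.sum_congr rfl fun a₁' _ =>
          Finset.sum_comm.trans (Finset.sum_congr rfl fun s' _ => ?_))
      rw [← Finset.mul_sum]
      congr 1
      exact hG c c' ((a₁, a₂), b) ((a₁', a₂), b') (a, s) (a', s')
    · split_ifs <;> simp

end BroadcastSDP

end

/-! ### Normalised projections and the reassembly of a Choi matrix -/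

noncomputable section

namespace BroadcastSDP

open SuperOp

section Pair

variable {r r₁ r₂ : ℕ}

/-- The operators `φ` and `(r² - 1)⁻¹ (1 - φ)`, with the latter replaced by `1` if `r = 1`. -/
def dualProj (r : ℕ) : Fin 2 → Pair r :=
  ![eprPair (Fin r), if r = 1 then 1 else ((r : ℂ) ^ 2 - 1)⁻¹ • (1 - eprPair (Fin r))]

/-- Multiples of `1 ± F` which the partial transposes of `dualProj` are combinations of. -/
def dualSym (r : ℕ) : Fin 2 → Pair r :=
  ![(2 * r * (r + 1) : ℂ)⁻¹ • (1 + swapOp r),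
    if r = 1 then (2 : ℂ)⁻¹ • 1 else (2 * r * (r - 1) : ℂ)⁻¹ • (1 - swapOp r)]

theorem sq_sub_one_nonneg (hr : 0 < r) : (0 : ℂ) ≤ (r : ℂ) ^ 2 - 1 := by
  have : (1 : ℝ) ≤ r := by exact_mod_cast hr
  have : (0 : ℝ) ≤ (r : ℝ) ^ 2 - 1 := by nlinarith
  exact_mod_cast this

theorem sub_one_nonneg (hr : 0 < r) : (0 : ℂ) ≤ (r : ℂ) - 1 := by
  have : (1 : ℝ) ≤ r := by exact_mod_cast hr
  have : (0 : ℝ) ≤ (r : ℝ) - 1 := by linarith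
  exact_mod_cast this

theorem sq_sub_one_ne_zero (hr : r ≠ 1) : (r : ℂ) ^ 2 - 1 ≠ 0 := by
  intro h
  have : ((r ^ 2 : ℕ) : ℂ) = (1 : ℕ) := by push_cast; linear_combination h
  have := Nat.cast_injective this
  exact hr (by simpa using this)

theorem sub_one_ne_zero (hr : r ≠ 1) : (r : ℂ) - 1 ≠ 0 := by
  intro h
  exact hr (by exact_mod_cast sub_eq_zero.mp h)

theorem dualProj_posSemidef (hr : 0 < r) (i : Fin 2) : (dualProj r i).PosSemidef := by
  fin_cases i
  · exact proj_posSemidef 0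
  · simp only [dualProj, Fin.mk_one, Matrix.cons_val_one, Matrix.cons_val_zero]
    split_ifs
    · exact Matrix.PosSemidef.one
    · exact (proj_posSemidef (r := r) 1).smul (inv_nonneg.mpr (sq_sub_one_nonneg hr))

theorem dualSym_posSemidef (hr : 0 < r) (s : Fin 2) : (dualSym r s).PosSemidef := by
  fin_cases s
  · exact (symOp_posSemidef (r := r) 0).smul (by positivity)
  · simp only [dualSym, Fin.mk_one, Matrix.cons_val_one, Matrix.cons_val_zero]
    split_ifs
    · exact Matrix.PosSemidef.one.smul (by positivity)
    · exact (symOp_posSemidef (r := r) 1).smul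
        (inv_nonneg.mpr (mul_nonneg (by positivity) (sub_one_nonneg hr)))

theorem one_apply_of_eq_one (hr : r = 1) (p q : Fin r × Fin r) : (1 : Pair r) p q = 1 := by
  subst hr
  rw [Matrix.one_apply, if_pos (Subsingleton.elim p q)]

theorem swapOp_apply_of_eq_one (hr : r = 1) (p q : Fin r × Fin r) : swapOp r p q = 1 := by
  subst hr
  simp [swapOp, eq_iff_true_of_subsingleton]

theorem eprPair_apply_of_eq_one (hr : r = 1) (p q : Fin r × Fin r) : eprPair (Fin r) p q = 1 := by
  subst hr
  simp [eprPair_apply, eq_iff_true_of_subsingleton]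

theorem ptrans_eprPair : ptrans (eprPair (Fin r)) = (r : ℂ)⁻¹ • swapOp r := by
  ext p q
  simp [ptrans, eprPair_apply, swapOp, and_comm, eq_comm]

theorem ptrans_one : ptrans (1 : Pair r) = 1 := by
  ext p q
  simp only [ptrans, Matrix.of_apply, Matrix.one_apply, Prod.ext_iff]
  congr 1
  apply propext
  constructor <;> exact fun h => ⟨h.1.symm, h.2⟩

theorem ptrans_sub (P Q : Pair r) : ptrans (P - Q) = ptrans P - ptrans Q := rfl

theorem ptrans_smul (c : ℂ) (P : Pair r) : ptrans (c • P) = c • ptrans P := rfl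

/-- The dual of `sum_coeff_smul_ptrans_proj`, with the matrix `coeff` transposed. The weights in
`dualSym` are 1/(2 Tr(1 ± F)). At r = 1, where 1 - F = 0, the second operator has to supply the
missing half of the identity. -/
theorem ptrans_dualProj (hr : 0 < r) (i : Fin 2) :
    ptrans (dualProj r i) = ∑ s, coeff r s i • dualSym r s := by
  have h : (r : ℂ) ≠ 0 := by exact_mod_cast hr.ne'
  have h' : (r : ℂ) + 1 ≠ 0 := by exact_mod_cast Nat.succ_ne_zero r
  rw [Fin.sum_univ_two]
  by_cases hr1 : r = 1
  · ext p q
    have hr1' : (r : ℂ) = 1 := by simp [hr1]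
    fin_cases i <;>
      simp [dualProj, dualSym, coeff, hr1, ptrans_eprPair, ptrans_one, one_apply_of_eq_one,
        swapOp_apply_of_eq_one] <;> norm_num
  · have h₁ := sub_one_ne_zero hr1
    have h₂ := sq_sub_one_ne_zero hr1
    ext p q
    fin_cases i
    · simp only [dualProj, dualSym, coeff, hr1, if_false, Fin.zero_eta, Matrix.cons_val_zero,
        Matrix.cons_val_one, ptrans_eprPair, Matrix.add_apply, Matrix.sub_apply,
        Matrix.smul_apply, smul_eq_mul]
      field_simp
      ring
    · simp only [dualProj, dualSym, coeff, hr1, if_false, Fin.mk_one, Matrix.cons_val_zero,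
        Matrix.cons_val_one, ptrans_eprPair, ptrans_smul, ptrans_sub, ptrans_one,
        Matrix.add_apply, Matrix.sub_apply, Matrix.smul_apply, smul_eq_mul]
      rw [show (r : ℂ) ^ 2 - 1 = (r + 1) * (r - 1) by ring]
      field_simp
      ring

theorem dualSym_transpose (s : Fin 2) : (dualSym r s)ᵀ = dualSym r s := by
  have h : (swapOp r)ᵀ = swapOp r := by
    ext p q
    simp [swapOp, Matrix.transpose_apply, and_comm, eq_comm]
  fin_cases s
  · simp [dualSym, h]
  · by_cases hr : r = 1 <;> simp [dualSym, h, hr]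

theorem dualProj_swap (i : Fin 2) (a b c d : Fin r) :
    dualProj r i (a, b) (c, d) = dualProj r i (b, a) (d, c) := by
  fin_cases i
  · simp [dualProj, eprPair_apply, eq_comm]
  · by_cases hr : r = 1
    · simp [dualProj, hr, one_apply_of_eq_one]
    · simp [dualProj, hr, eprPair_apply, Matrix.one_apply, eq_comm, and_comm]

/-- The marginals do not depend on i. At r = 1 this needs the value 1 in `dualProj`, as the rescaled
1 - φ would be zero. -/
theorem sum_dualProj_apply (hr : 0 < r) (i : Fin 2) (s s' : Fin r) :
    ∑ a, dualProj r i (a, s) (a, s') = if s = s' then (r : ℂ)⁻¹ else 0 := by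
  fin_cases i
  · simpa [dualProj, proj, rankProj] using sum_proj_apply hr 0 s s'
  · by_cases hr1 : r = 1
    · have : s = s' := by subst hr1; exact Subsingleton.elim _ _
      simp [dualProj, hr1, this]
    · have h₂ := sq_sub_one_ne_zero hr1
      have := sum_proj_apply hr 1 s s'
      simp only [proj, rankProj, Matrix.cons_val_one, Matrix.cons_val_zero] at this
      simp only [dualProj, hr1, if_false, Fin.mk_one, Matrix.cons_val_one, Matrix.cons_val_zero,
        Matrix.smul_apply, smul_eq_mul, ← Finset.mul_sum, this]
      split_ifs
      · field_simp
      · simp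

theorem sum_dualProj_apply' (hr : 0 < r) (i : Fin 2) (a a' : Fin r) :
    ∑ s, dualProj r i (a, s) (a', s) = if a = a' then (r : ℂ)⁻¹ else 0 := by
  simp_rw [dualProj_swap i a, sum_dualProj_apply hr]

theorem sum_rankProj_smul_dualProj : ∑ i, rankProj r i • dualProj r i = 1 := by
  rw [Fin.sum_univ_two]
  by_cases hr1 : r = 1
  · ext p q
    simp [rankProj, dualProj, hr1, one_apply_of_eq_one, eprPair_apply_of_eq_one]
  · simp [rankProj, dualProj, hr1, smul_smul, sq_sub_one_ne_zero hr1]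

/-- Biorthogonality to φ. It fails at r = 1, where both dual operators are 1. -/
theorem sum_eprPair_mul_dualProj (hr : 0 < r) (i : Fin 2) :
    ∑ x, ∑ y, eprPair (Fin r) x y * dualProj r i x y =
      if i = 0 ∨ r = 1 then 1 else 0 := by
  have h : (r : ℂ) ≠ 0 := by exact_mod_cast hr.ne'
  by_cases hr1 : r = 1
  · subst hr1
    fin_cases i <;> simp [dualProj, eprPair_apply_of_eq_one, one_apply_of_eq_one]
  · fin_cases i
    · simp [dualProj, eprPair_apply, hr1, ite_and, Fintype.sum_prod_type]
      field_simp
    · simp [dualProj, eprPair_apply, hr1, ite_and, Fintype.sum_prod_type, Matrix.one_apply]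
      have h' (x y : Fin r) : (if x = y then if x = y then (1 : ℂ) else 0 else 0) =
          if x = y then 1 else 0 := by split_ifs <;> rfl
      simp [h', ← Finset.mul_sum, Finset.sum_sub_distrib, h]

end Pair

section Assemble

variable {A' B C : Type*} {r₁ r₂ : ℕ}

/-- The Choi matrix with components `E i j` with respect to the operators `P i ⊗ Q j`. -/
def assemble (P : Fin 2 → Pair r₁) (Q : Fin 2 → Pair r₂) (E : Fin 2 → Fin 2 → Op A' B C) :
    ChoiOp A' B C r₁ r₂ :=
  Matrix.of fun p q => ((r₁ : ℂ) * r₂) * ∑ i, ∑ j,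
    pairOp (P i) (Q j) (p.1.1, p.2.2) (q.1.1, q.2.2) * E i j (p.2.1, p.1.2) (q.2.1, q.1.2)

theorem assemble_posSemidef [Finite A'] [Finite B] [Finite C] {P : Fin 2 → Pair r₁}
    {Q : Fin 2 → Pair r₂} {E : Fin 2 → Fin 2 → Op A' B C} (hP : ∀ i, (P i).PosSemidef)
    (hQ : ∀ j, (Q j).PosSemidef) (hE : ∀ i j, (E i j).PosSemidef) :
    (assemble P Q E).PosSemidef := by
  have := Fintype.ofFinite A'
  have := Fintype.ofFinite B
  have := Fintype.ofFinite C
  have h := (Matrix.posSemidef_sum Finset.univ fun i _ => Matrix.posSemidef_sum Finset.univ fun j _ =>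
    ((pairOp_posSemidef (hP i) (hQ j)).kronecker (hE i j)).submatrix
      fun p : ((Fin r₁ × Fin r₂) × (B × C)) × (A' × (Fin r₁ × Fin r₂)) =>
        ((p.1.1, p.2.2), (p.2.1, p.1.2))).smul (a := (r₁ : ℂ) * r₂) (by positivity)
  have h' : assemble P Q E = ((r₁ : ℂ) * r₂) • ∑ i, ∑ j, (pairOp (P i) (Q j) ⊗ₖ E i j).submatrix
      (fun p => ((p.1.1, p.2.2), (p.2.1, p.1.2))) (fun p => ((p.1.1, p.2.2), (p.2.1, p.1.2))) := by
    ext p q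
    simp [assemble]
  rw [h']
  exact h

theorem cutTranspose_assemble (P : Fin 2 → Pair r₁) (Q : Fin 2 → Pair r₂)
    (E : Fin 2 → Fin 2 → Op A' B C) :
    cutTranspose (assemble P Q E) =
      assemble (fun i => ptrans (P i)) (fun j => ptrans (Q j)) (fun i j => (transBC (E i j))ᵀ) :=
  rfl

theorem choiTransB_assemble (P : Fin 2 → Pair r₁) (Q : Fin 2 → Pair r₂)
    (E : Fin 2 → Fin 2 → Op A' B C) :
    choiTransB (assemble P Q E) =
      assemble (fun i => (ptrans (P i))ᵀ) Q (fun i j => transB (E i j)) :=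
  rfl

theorem choiTransC_assemble (P : Fin 2 → Pair r₁) (Q : Fin 2 → Pair r₂)
    (E : Fin 2 → Fin 2 → Op A' B C) :
    choiTransC (assemble P Q E) =
      assemble P (fun j => (ptrans (Q j))ᵀ) (fun i j => transC (E i j)) :=
  rfl

theorem assemble_sum₁ (c : Fin 2 → Fin 2 → ℂ) (P : Fin 2 → Pair r₁) (Q : Fin 2 → Pair r₂)
    (E : Fin 2 → Fin 2 → Op A' B C) :
    assemble (fun i => ∑ s, c s i • P s) Q E =
      assemble P Q (fun s j => ∑ i, c s i • E i j) := by
  ext p q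
  simp only [assemble, pairOp, Matrix.of_apply, Fin.sum_univ_two, Matrix.add_apply,
    Matrix.smul_apply, smul_eq_mul]
  ring

theorem assemble_sum₂ (c : Fin 2 → Fin 2 → ℂ) (P : Fin 2 → Pair r₁) (Q : Fin 2 → Pair r₂)
    (E : Fin 2 → Fin 2 → Op A' B C) :
    assemble P (fun j => ∑ t, c t j • Q t) E =
      assemble P Q (fun i t => ∑ j, c t j • E i j) := by
  ext p q
  simp only [assemble, pairOp, Matrix.of_apply, Fin.sum_univ_two, Matrix.add_apply,
    Matrix.smul_apply, smul_eq_mul]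
  ring

variable [Fintype A'] [Fintype B] [DecidableEq B] [Fintype C] [DecidableEq C]
  {D : Fin 2 → Fin 2 → Op A' B C} {ρ : Matrix A' A' ℂ}

/-- Expanding the transposed projections in `dualSym` shifts `coeff` onto the components. These
become the operators of `FeasiblePPT`, and assembling positive operators gives a positive one. -/
theorem FeasiblePPT.posSemidef_assemble (hD : FeasiblePPT r₁ r₂ D) (h₁ : 0 < r₁) (h₂ : 0 < r₂) :
    (cutTranspose (assemble (dualProj r₁) (dualProj r₂) D)).PosSemidef ∧
    (choiTransB (assemble (dualProj r₁) (dualProj r₂) D)).PosSemidef ∧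
    (choiTransC (assemble (dualProj r₁) (dualProj r₂) D)).PosSemidef := by
  refine ⟨?_, ?_, ?_⟩
  · rw [cutTranspose_assemble]
    simp_rw [ptrans_dualProj h₁, ptrans_dualProj h₂]
    rw [assemble_sum₁, assemble_sum₂]
    refine assemble_posSemidef (dualSym_posSemidef h₁) (dualSym_posSemidef h₂) fun s t => ?_
    have h : ∑ j, coeff r₂ t j • ∑ i, coeff r₁ s i • (transBC (D i j))ᵀ =
        (transBC (∑ i, ∑ j, (coeff r₁ s i * coeff r₂ t j) • D i j))ᵀ := by
      ext p q
      simp only [Fin.sum_univ_two, transBC, Matrix.add_apply, Matrix.smul_apply, smul_eq_mul,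
        Matrix.transpose_apply, Matrix.of_apply]
      ring
    rw [h]
    exact (hD.a s t).transpose
  · rw [choiTransB_assemble]
    simp_rw [ptrans_dualProj h₁, Matrix.transpose_sum, Matrix.transpose_smul, dualSym_transpose]
    rw [assemble_sum₁]
    refine assemble_posSemidef (dualSym_posSemidef h₁) (dualProj_posSemidef h₂) fun s j => ?_
    convert hD.b s j using 1
    ext p q
    simp only [Fin.sum_univ_two, transB, Matrix.add_apply, Matrix.smul_apply, smul_eq_mul,
      Matrix.of_apply]
  · rw [choiTransC_assemble]
    simp_rw [ptrans_dualProj h₂, Matrix.transpose_sum, Matrix.transpose_smul, dualSym_transpose]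
    rw [assemble_sum₂]
    refine assemble_posSemidef (dualProj_posSemidef h₁) (dualSym_posSemidef h₂) fun i t => ?_
    convert hD.c i t using 1
    ext p q
    simp only [Fin.sum_univ_two, transC, Matrix.add_apply, Matrix.smul_apply, smul_eq_mul,
      Matrix.of_apply]

theorem Feasible.input_posSemidef [Nonempty B] [Nonempty C] (hD : Feasible r₁ r₂ ρ D) :
    ρ.PosSemidef := by
  have h := Matrix.posSemidef_sum Finset.univ fun i _ => Matrix.posSemidef_sum Finset.univ fun j _ =>
    hD.posSemidef i j
  rw [hD.sum_eq] at h
  convert h.submatrix fun a : A' => (a, Classical.arbitrary (B × C))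
  ext
  simp

theorem sum_pairOp_dualProj (h₁ : 0 < r₁) (h₂ : 0 < r₂) (i j : Fin 2) (a a' : Fin r₁ × Fin r₂) :
    ∑ s, pairOp (dualProj r₁ i) (dualProj r₂ j) (a, s) (a', s) =
      if a = a' then ((r₁ : ℂ) * r₂)⁻¹ else 0 := by
  simp only [pairOp, Matrix.of_apply, Fintype.sum_prod_type, ← Finset.mul_sum, ← Finset.sum_mul,
    sum_dualProj_apply' h₁, sum_dualProj_apply' h₂]
  by_cases h : a.1 = a'.1 <;> by_cases h' : a.2 = a'.2 <;> simp [h, h', Prod.ext_iff, mul_comm]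

/-- All products of dual operators have the same marginal, so only the sum of the components, ρ ⊗ 1,
is seen. This is the input condition of `exists_of_choi`. -/
theorem Feasible.sum_assemble (hD : Feasible r₁ r₂ ρ D) (h₁ : 0 < r₁) (h₂ : 0 < r₂)
    (a ā : Fin r₁ × Fin r₂) (x x' : B × C) (a' ā' : A') :
    ∑ s, assemble (dualProj r₁) (dualProj r₂) D ((a, x), (a', s)) ((ā, x'), (ā', s)) =
      if a = ā ∧ x = x' then ρ a' ā' else 0 := by
  have h₁' : (r₁ : ℂ) ≠ 0 := by exact_mod_cast h₁.ne'
  have h₂' : (r₂ : ℂ) ≠ 0 := by exact_mod_cast h₂.ne'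
  have h := congrFun (congrFun hD.sum_eq (a', x)) (ā', x')
  simp only [Matrix.sum_apply, Matrix.kroneckerMap_apply, Matrix.one_apply] at h
  simp only [assemble, Matrix.of_apply, ← Finset.mul_sum]
  rw [Finset.sum_comm]
  simp_rw [Finset.sum_comm (s := (Finset.univ : Finset (Fin r₁ × Fin r₂))), ← Finset.sum_mul,
    sum_pairOp_dualProj h₁ h₂, ← Finset.mul_sum, h]
  by_cases ha : a = ā <;> by_cases hx : x = x' <;> simp [ha, hx]
  field_simp

theorem Feasible.components_assemble (hD : Feasible r₁ r₂ ρ D) (h₁ : 0 < r₁) (h₂ : 0 < r₂) :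
    components (assemble (dualProj r₁) (dualProj r₂) D) 0 0 = D 0 0 := by
  have h₁' : (r₁ : ℂ) ≠ 0 := by exact_mod_cast h₁.ne'
  have h₂' : (r₂ : ℂ) ≠ 0 := by exact_mod_cast h₂.ne'
  have h (i j) : ∑ x, ∑ y, pairOp (eprPair (Fin r₁)) (eprPair (Fin r₂)) x y *
      pairOp (dualProj r₁ i) (dualProj r₂ j) x y =
      (if i = 0 ∨ r₁ = 1 then 1 else 0) * (if j = 0 ∨ r₂ = 1 then 1 else 0) := by
    rw [← sum_eprPair_mul_dualProj h₁, ← sum_eprPair_mul_dualProj h₂]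
    let e := Equiv.prodProdProdComm (Fin r₁) (Fin r₂) (Fin r₁) (Fin r₂)
    let K (u v : (Fin r₁ × Fin r₁) × (Fin r₂ × Fin r₂)) : ℂ :=
      (eprPair (Fin r₁) u.1 v.1 * dualProj r₁ i u.1 v.1) *
        (eprPair (Fin r₂) u.2 v.2 * dualProj r₂ j u.2 v.2)
    trans ∑ x, ∑ y, K (e x) (e y)
    · exact Finset.sum_congr rfl fun x _ => Finset.sum_congr rfl fun y _ => mul_mul_mul_comm _ _ _ _
    · refine (Equiv.sum_comp e fun u => ∑ y, K u (e y)).trans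
        ((Finset.sum_congr rfl fun u _ => Equiv.sum_comp e (K u)).trans ?_)
      simp only [K, Fintype.sum_prod_type (α₁ := Fin r₁ × Fin r₁)]
      rw [Finset.sum_mul]
      refine Finset.sum_congr rfl fun p _ => Finset.sum_comm.trans ?_
      rw [Finset.sum_mul]
      refine Finset.sum_congr rfl fun p' _ => ?_
      simp only [Finset.mul_sum]
  ext t t'
  rw [components, compress_apply]
  simp only [assemble, Matrix.of_apply, proj, Matrix.cons_val_zero, Prod.mk.eta]
  have h' : ∑ x, ∑ y, pairOp (eprPair (Fin r₁)) (eprPair (Fin r₂)) x y * ((r₁ : ℂ) * r₂ * ∑ i, ∑ j,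
      pairOp (dualProj r₁ i) (dualProj r₂ j) x y * D i j t t') = (r₁ : ℂ) * r₂ * ∑ i, ∑ j,
      (∑ x, ∑ y, pairOp (eprPair (Fin r₁)) (eprPair (Fin r₂)) x y *
        pairOp (dualProj r₁ i) (dualProj r₂ j) x y) * D i j t t' := by
    simp only [Fin.sum_univ_two, mul_add, Finset.sum_add_distrib, Finset.mul_sum, Finset.sum_mul]
    congr 1 <;> congr 1 <;> exact Finset.sum_congr rfl fun _ _ => Finset.sum_congr rfl fun _ _ => by ring
  rw [h']
  simp only [h, Fin.sum_univ_two]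
  have e₁ := hD.eq_zero₁
  have e₂ := hD.eq_zero₂
  -- At r = 1 the contraction with φ also picks up components of index 1, which vanish by
  -- feasibility.
  by_cases hr₁ : r₁ = 1 <;> by_cases hr₂ : r₂ = 1
  · simp [hr₁, hr₂, e₁ hr₁, e₂ hr₂]
  · simp [hr₁, hr₂, e₁ hr₁]
    field_simp
  · simp [hr₁, hr₂, e₂ hr₂]
    field_simp
  · simp [hr₁, hr₂]
    field_simp

end Assemble

end BroadcastSDP

end

/-! ### From components back to a code, and its no-signalling conditions -/

noncomputable section

namespace BroadcastSDP

open SuperOp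

variable {A' B C : Type*} [Fintype A'] [Fintype B] [DecidableEq B] [Fintype C] [DecidableEq C]
  {r₁ r₂ : ℕ} {D : Fin 2 → Fin 2 → Op A' B C} {ρ : Matrix A' A' ℂ}

/-- The ranks in the traces of the components recombine the dual operators to the identity. Hence
B'C' is maximally mixed whatever the inputs are. -/
theorem FeasibleNS.sum_assemble (hD : FeasibleNS r₁ r₂ D) (h₁ : 0 < r₁) (h₂ : 0 < r₂)
    (a ā s s' : Fin r₁ × Fin r₂) (x x' : B × C) :
    ∑ a', assemble (dualProj r₁) (dualProj r₂) D ((a, x), (a', s)) ((ā, x'), (a', s')) =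
      if a = ā ∧ s = s' ∧ x = x' then ((r₁ : ℂ) * r₂)⁻¹ else 0 := by
  have h₁' : (r₁ : ℂ) ≠ 0 := by exact_mod_cast h₁.ne'
  have h₂' : (r₂ : ℂ) ≠ 0 := by exact_mod_cast h₂.ne'
  have h (i j) : ∑ a', D i j (a', x) (a', x') = if x = x' then
      (rankProj r₁ i * rankProj r₂ j * ((r₁ : ℂ) ^ 2 * (r₂ : ℂ) ^ 2)⁻¹) else 0 := by
    have := congrFun (congrFun (hD.a_bc i j) x) x'
    simpa [traceFst, Matrix.one_apply] using this
  have h' := congrFun (congrFun (pairOp_sum (rankProj r₁) (rankProj r₂) (dualProj r₁)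
    (dualProj r₂)) (a, s)) (ā, s')
  rw [sum_rankProj_smul_dualProj, sum_rankProj_smul_dualProj, pairOp_one] at h'
  simp only [Matrix.sum_apply, Matrix.smul_apply, smul_eq_mul, Matrix.one_apply,
    Prod.mk.injEq] at h'
  simp only [assemble, Matrix.of_apply, ← Finset.mul_sum]
  rw [Finset.sum_comm]
  simp_rw [Finset.sum_comm (s := (Finset.univ : Finset A')), ← Finset.mul_sum, h]
  by_cases hx : x = x'
  · simp only [hx, if_true, and_true]
    trans ((r₁ : ℂ) * r₂)⁻¹ * ∑ i, ∑ j, rankProj r₁ i * rankProj r₂ j *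
      pairOp (dualProj r₁ i) (dualProj r₂ j) (a, s) (ā, s')
    · simp only [Finset.mul_sum]
      refine Finset.sum_congr rfl fun i _ => Finset.sum_congr rfl fun j _ => ?_
      field_simp
    · rw [← h']
      simp
  · simp [hx]

/-- A feasible family of components belongs to a code. -/
theorem Feasible.exists_code [DecidableEq A'] [Nonempty B] [Nonempty C]
    (hD : Feasible r₁ r₂ ρ D) (h₁ : 0 < r₁) (h₂ : 0 < r₂) (N : SuperOp A' (B × C)) :
    ∃ Z : ForwardAssistedCode A' B C r₁ r₂,
      choi Z.operation = assemble (dualProj r₁) (dualProj r₂) D ∧ Z.averageInput = ρ ∧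
        Z.channelFidelity N = (D 0 0 * N.choiᵀ).trace := by
  obtain ⟨Z, hZ⟩ := ForwardAssistedCode.exists_of_choi h₁ h₂ hD.input_posSemidef hD.trace_input
    (assemble_posSemidef (dualProj_posSemidef h₁) (dualProj_posSemidef h₂) hD.posSemidef)
    (hD.sum_assemble h₁ h₂)
  refine ⟨Z, hZ, ?_, ?_⟩
  · have h₁' : (r₁ : ℂ) ≠ 0 := by exact_mod_cast h₁.ne'
    have h₂' : (r₂ : ℂ) ≠ 0 := by exact_mod_cast h₂.ne'
    ext a' ā'
    have h := Z.sum_choi_operation_eq_averageInput (Classical.arbitrary _) (Classical.arbitrary _)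
      a' ā' h₁ h₂
    simp only [hZ, hD.sum_assemble h₁ h₂] at h
    simpa [h₁.ne', h₂.ne', eq_comm] using h
  · rw [fidelity_components, hZ, hD.components_assemble h₁ h₂]

theorem FeasiblePPT.isPPTPreserving (hD : FeasiblePPT r₁ r₂ D) (h₁ : 0 < r₁) (h₂ : 0 < r₂)
    {Z : ForwardAssistedCode A' B C r₁ r₂}
    (hZ : choi Z.operation = assemble (dualProj r₁) (dualProj r₂) D) : Z.IsPPTPreserving := by
  obtain ⟨hA, hB, hC⟩ := hD.posSemidef_assemble h₁ h₂
  rw [← hZ] at hA hB hC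
  exact ⟨(pptPreserving_iff _).mpr hA, (cutB_pptPreserving_iff _).mpr hB,
    (cutC_pptPreserving_iff _).mpr hC⟩

theorem exists_of_eq_mixB {E : Op A' B C} (h : E = mixB E) :
    ∃ F : A' × C → A' × C → ℂ, ∀ a b c a₁ b₁ c₁,
      E (a, (b, c)) (a₁, (b₁, c₁)) = if b = b₁ then F (a, c) (a₁, c₁) else 0 := by
  refine ⟨fun p q => (∑ b, E (p.1, (b, p.2)) (q.1, (b, q.2))) * (Fintype.card B : ℂ)⁻¹,
    fun a b c a₁ b₁ c₁ => ?_⟩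
  conv_lhs => rw [h]
  simp [mixB]

theorem exists_of_eq_mixC {E : Op A' B C} (h : E = mixC E) :
    ∃ F : A' × B → A' × B → ℂ, ∀ a b c a₁ b₁ c₁,
      E (a, (b, c)) (a₁, (b₁, c₁)) = if c = c₁ then F (a, b) (a₁, b₁) else 0 := by
  refine ⟨fun p q => (∑ c, E (p.1, (p.2, c)) (q.1, (q.2, c))) * (Fintype.card C : ℂ)⁻¹,
    fun a b c a₁ b₁ c₁ => ?_⟩
  conv_lhs => rw [h]
  simp [mixC]

/-- Tracing out B' gives the same factor for both i, so only the sums of D i j over i enter. For j =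
0 the sum is the identity on B times F by hypothesis; for j = 1 it is ρ ⊗ 1 minus the former, which
has the same form. -/
theorem Feasible.noSignalling_b_ac [Nonempty B] [Nonempty C] (hD : Feasible r₁ r₂ ρ D)
    (hD' : FeasibleNS r₁ r₂ D) (h₁ : 0 < r₁) {Z : ForwardAssistedCode A' B C r₁ r₂}
    (hZ : choi Z.operation = assemble (dualProj r₁) (dualProj r₂) D) :
    Z.operation.cutB.NoSignalling := by
  have h₁' : (r₁ : ℂ) ≠ 0 := by exact_mod_cast h₁.ne'
  obtain ⟨F, hF⟩ := exists_of_eq_mixB hD'.b_ac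
  rw [noSignalling_cutB_iff Z.operation_isChannel, hZ]
  refine ⟨Matrix.of fun p q => if p.1.1.1 = q.1.1.1 then (r₂ : ℂ) *
    (dualProj r₂ 0 (p.1.1.2, p.2.2) (q.1.1.2, q.2.2) * F (p.2.1, p.1.2) (q.2.1, q.1.2) +
      dualProj r₂ 1 (p.1.1.2, p.2.2) (q.1.1.2, q.2.2) *
        ((if p.1.2 = q.1.2 then ρ p.2.1 q.2.1 else 0) - F (p.2.1, p.1.2) (q.2.1, q.1.2))) else 0, ?_⟩
  rintro b b₁ ⟨⟨a₁, a₂⟩, c⟩ ⟨⟨ā₁, ā₂⟩, c₁⟩ ⟨a', s⟩ ⟨ā', s₁⟩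
  have hF' := hF a' b c ā' b₁ c₁
  have hs := congrFun (congrFun hD.sum_eq (a', (b, c))) (ā', (b₁, c₁))
  have hp (i) := sum_dualProj_apply' h₁ i a₁ ā₁
  simp only [Fin.sum_univ_two, Matrix.add_apply, Matrix.kroneckerMap_apply, Matrix.one_apply,
    Prod.mk.injEq] at hs hF'
  have e : D 0 1 (a', (b, c)) (ā', (b₁, c₁)) + D 1 1 (a', (b, c)) (ā', (b₁, c₁)) =
      if b = b₁ then (if c = c₁ then ρ a' ā' else 0) - F (a', c) (ā', c₁) else 0 := by
    have : D 0 1 (a', (b, c)) (ā', (b₁, c₁)) + D 1 1 (a', (b, c)) (ā', (b₁, c₁)) =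
      (ρ a' ā' * if b = b₁ ∧ c = c₁ then 1 else 0) -
        (if b = b₁ then F (a', c) (ā', c₁) else 0) := by
      rw [← hs, ← hF']; ring
    rw [this]
    by_cases hb : b = b₁ <;> simp [hb]
  simp only [assemble, pairOp, Matrix.of_apply, Fin.sum_univ_two, ← Finset.mul_sum,
    Finset.sum_add_distrib, ← Finset.sum_mul, hp]
  by_cases ha : a₁ = ā₁
  · simp only [ha, if_true]
    trans (r₂ : ℂ) * (dualProj r₂ 0 (a₂, s) (ā₂, s₁) *
      (D 0 0 (a', (b, c)) (ā', (b₁, c₁)) + D 1 0 (a', (b, c)) (ā', (b₁, c₁))) +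
      dualProj r₂ 1 (a₂, s) (ā₂, s₁) *
      (D 0 1 (a', (b, c)) (ā', (b₁, c₁)) + D 1 1 (a', (b, c)) (ā', (b₁, c₁))))
    · field_simp
    · rw [hF', e]
      split_ifs <;> simp
  · simp [ha]

theorem Feasible.noSignalling_c_ab [Nonempty B] [Nonempty C] (hD : Feasible r₁ r₂ ρ D)
    (hD' : FeasibleNS r₁ r₂ D) (h₂ : 0 < r₂) {Z : ForwardAssistedCode A' B C r₁ r₂}
    (hZ : choi Z.operation = assemble (dualProj r₁) (dualProj r₂) D) :
    Z.operation.cutC.NoSignalling := by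
  have h₂' : (r₂ : ℂ) ≠ 0 := by exact_mod_cast h₂.ne'
  obtain ⟨F, hF⟩ := exists_of_eq_mixC hD'.c_ab
  rw [noSignalling_cutC_iff Z.operation_isChannel, hZ]
  refine ⟨Matrix.of fun p q => if p.1.1.2 = q.1.1.2 then (r₁ : ℂ) *
    (dualProj r₁ 0 (p.1.1.1, p.2.2) (q.1.1.1, q.2.2) * F (p.2.1, p.1.2) (q.2.1, q.1.2) +
      dualProj r₁ 1 (p.1.1.1, p.2.2) (q.1.1.1, q.2.2) *
        ((if p.1.2 = q.1.2 then ρ p.2.1 q.2.1 else 0) - F (p.2.1, p.1.2) (q.2.1, q.1.2))) else 0, ?_⟩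
  rintro c c₁ ⟨⟨a₁, a₂⟩, b⟩ ⟨⟨ā₁, ā₂⟩, b₁⟩ ⟨a', s⟩ ⟨ā', s₁⟩
  have hF' := hF a' b c ā' b₁ c₁
  have hs := congrFun (congrFun hD.sum_eq (a', (b, c))) (ā', (b₁, c₁))
  have hp (i) := sum_dualProj_apply' h₂ i a₂ ā₂
  simp only [Fin.sum_univ_two, Matrix.add_apply, Matrix.kroneckerMap_apply, Matrix.one_apply,
    Prod.mk.injEq] at hs hF'
  have e : D 1 0 (a', (b, c)) (ā', (b₁, c₁)) + D 1 1 (a', (b, c)) (ā', (b₁, c₁)) =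
      if c = c₁ then (if b = b₁ then ρ a' ā' else 0) - F (a', b) (ā', b₁) else 0 := by
    have : D 1 0 (a', (b, c)) (ā', (b₁, c₁)) + D 1 1 (a', (b, c)) (ā', (b₁, c₁)) =
      (ρ a' ā' * if b = b₁ ∧ c = c₁ then 1 else 0) -
        (if c = c₁ then F (a', b) (ā', b₁) else 0) := by
      rw [← hs, ← hF']; ring
    rw [this]
    by_cases hc : c = c₁ <;> simp [hc]
  simp only [assemble, pairOp, Matrix.of_apply, Fin.sum_univ_two, ← Finset.mul_sum,
    Finset.sum_add_distrib, ← Finset.sum_mul, hp]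
  by_cases ha : a₂ = ā₂
  · simp only [ha, if_true]
    trans (r₁ : ℂ) * (dualProj r₁ 0 (a₁, s) (ā₁, s₁) *
      (D 0 0 (a', (b, c)) (ā', (b₁, c₁)) + D 0 1 (a', (b, c)) (ā', (b₁, c₁))) +
      dualProj r₁ 1 (a₁, s) (ā₁, s₁) *
      (D 1 0 (a', (b, c)) (ā', (b₁, c₁)) + D 1 1 (a', (b, c)) (ā', (b₁, c₁))))
    · field_simp
      ring
    · rw [hF', e]
      split_ifs <;> simp
  · simp [ha]

theorem Feasible.isNoSignalling [Nonempty B] [Nonempty C] (hD : Feasible r₁ r₂ ρ D)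
    (hD' : FeasibleNS r₁ r₂ D) (h₁ : 0 < r₁) (h₂ : 0 < r₂)
    {Z : ForwardAssistedCode A' B C r₁ r₂}
    (hZ : choi Z.operation = assemble (dualProj r₁) (dualProj r₂) D) : Z.IsNoSignalling := by
  have : Nonempty (Fin r₁ × Fin r₂) := ⟨(⟨0, h₁⟩, ⟨0, h₂⟩)⟩
  have h₁' : (r₁ : ℂ) ≠ 0 := by exact_mod_cast h₁.ne'
  have h₂' : (r₂ : ℂ) ≠ 0 := by exact_mod_cast h₂.ne'
  have hB : Z.operation.cutB.IsChannel := Z.operation_isChannel.relabel _ _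
  have hC : Z.operation.cutC.IsChannel := Z.operation_isChannel.relabel _ _
  refine ⟨?_, hD.noSignalling_b_ac hD' h₁ hZ, hD.noSignalling_c_ab hD' h₂ hZ, ?_, ?_, ?_⟩
  · rw [noSignalling_iff Z.operation_isChannel, hZ]
    refine ⟨Matrix.of fun p q => if p.2 = q.2 ∧ p.1 = q.1 then ((r₁ : ℂ) * r₂)⁻¹ else 0,
      fun a a₁ x x₁ s s₁ => ?_⟩
    rw [hD'.sum_assemble h₁ h₂]
    by_cases ha : a = a₁ <;> simp [ha]
  · rw [noSignalling_swapParties_iff Z.operation_isChannel, hZ]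
    refine ⟨Matrix.of fun p q => if p.1 = q.1 then ρ p.2 q.2 else 0,
      fun x x₁ a a₁ a' a₁' => ?_⟩
    rw [hD.sum_assemble h₁ h₂]
    by_cases hx : x = x₁ <;> simp [hx]
  -- Without A' the output B'C' is maximally mixed; tracing out C' as well leaves 1/r₁ on B'.
  · rw [noSignalling_swapParties_iff hB]
    refine ⟨Matrix.of fun p q => if p.2 = q.2 ∧ p.1 = q.1 then (r₁ : ℂ)⁻¹ else 0, ?_⟩
    rintro ⟨a, c⟩ ⟨a₁, c₁⟩ b b₁ b' b₁'
    simp only [choi_cutB, hZ, Fintype.sum_prod_type (α₁ := A')]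
    rw [Finset.sum_comm]
    simp only [hD'.sum_assemble h₁ h₂, Prod.mk.injEq, and_true, Finset.sum_const, Finset.card_univ,
      Fintype.card_fin, nsmul_eq_mul, Matrix.of_apply]
    by_cases ha : a = a₁ <;> by_cases hb : b = b₁ <;> by_cases hb' : b' = b₁' <;>
      by_cases hc : c = c₁ <;> simp [ha, hb, hb', hc]
    field_simp
  · rw [noSignalling_swapParties_iff hC]
    refine ⟨Matrix.of fun p q => if p.2 = q.2 ∧ p.1 = q.1 then (r₂ : ℂ)⁻¹ else 0, ?_⟩
    rintro ⟨a, b⟩ ⟨a₁, b₁⟩ c c₁ c' c₁'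
    simp only [choi_cutC, hZ, Fintype.sum_prod_type (α₁ := A')]
    rw [Finset.sum_comm]
    simp only [hD'.sum_assemble h₁ h₂, Prod.mk.injEq, Finset.sum_const, Finset.card_univ,
      Fintype.card_fin, nsmul_eq_mul, Matrix.of_apply]
    by_cases ha : a = a₁ <;> by_cases hb : b = b₁ <;> by_cases hc' : c' = c₁' <;>
      by_cases hc : c = c₁ <;> simp [ha, hb, hc', hc]
    field_simp

end BroadcastSDP

end

/-! ### Dictionary between components and the operators E₁, E₂, E₃ -/

noncomputable section

namespace BroadcastSDP

open SuperOp

theorem posSemidef_smul_iff {n : Type*} {M : Matrix n n ℂ} {k : ℂ} (hk : 0 ≤ k) (hk' : k ≠ 0) :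
    (k • M).PosSemidef ↔ M.PosSemidef := by
  refine ⟨fun h => ?_, fun h => h.smul hk⟩
  have := h.smul (inv_nonneg.mpr hk)
  rwa [smul_smul, inv_mul_cancel₀ hk', one_smul] at this

variable {A' B C : Type*} [Fintype A'] [Fintype B] [DecidableEq B] [Fintype C] [DecidableEq C]
  {r₁ r₂ : ℕ} {D : Fin 2 → Fin 2 → Op A' B C} {ρ : Matrix A' A' ℂ} {E₁ E₂ E₃ : Op A' B C}

/-- The family `D` has the components which belong to `E₁`, `E₂` and `E₃`. -/
structure IsFamily (r₁ r₂ : ℕ) (ρ : Matrix A' A' ℂ) (E₁ E₂ E₃ : Op A' B C)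
    (D : Fin 2 → Fin 2 → Op A' B C) : Prop where
  eq₀₀ : D 0 0 = E₁
  eq₀₁ : D 0 1 = ((r₂ : ℂ) ^ 2 - 1) • E₂
  eq₁₀ : D 1 0 = ((r₁ : ℂ) ^ 2 - 1) • E₃
  eq₁₁ : D 1 1 = ρ ⊗ₖ (1 : Matrix (B × C) (B × C) ℂ) -
    (E₁ + ((r₂ : ℂ) ^ 2 - 1) • E₂ + ((r₁ : ℂ) ^ 2 - 1) • E₃)

theorem kronecker_one_transBC (ρ : Matrix A' A' ℂ) (p q : A' × (B × C)) :
    (ρ ⊗ₖ (1 : Matrix (B × C) (B × C) ℂ)) p q = (ρ ⊗ₖ (1 : Matrix (B × C) (B × C) ℂ))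
      (p.1, q.2) (q.1, p.2) := by
  simp [Matrix.one_apply, eq_comm]

theorem kronecker_one_transB (ρ : Matrix A' A' ℂ) (p q : A' × (B × C)) :
    (ρ ⊗ₖ (1 : Matrix (B × C) (B × C) ℂ)) p q = (ρ ⊗ₖ (1 : Matrix (B × C) (B × C) ℂ))
      (p.1, (q.2.1, p.2.2)) (q.1, (p.2.1, q.2.2)) := by
  simp [Matrix.one_apply, Prod.ext_iff, eq_comm]

theorem kronecker_one_transC (ρ : Matrix A' A' ℂ) (p q : A' × (B × C)) :
    (ρ ⊗ₖ (1 : Matrix (B × C) (B × C) ℂ)) p q = (ρ ⊗ₖ (1 : Matrix (B × C) (B × C) ℂ))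
      (p.1, (p.2.1, q.2.2)) (q.1, (q.2.1, p.2.2)) := by
  simp [Matrix.one_apply, Prod.ext_iff, eq_comm]

/-- The four sign pairs give the four inequalities of PPT_A up to the factor r₁r₂, because ρ ⊗ 1 is
invariant under transposition of BC. -/
theorem IsFamily.transBC_eq₀ (h : IsFamily r₁ r₂ ρ E₁ E₂ E₃ D) (h₁ : (r₁ : ℂ) ≠ 0)
    (h₂ : (r₂ : ℂ) ≠ 0) :
    transBC (∑ i, ∑ j, (coeff r₁ 0 i * coeff r₂ 0 j) • D i j) = ((r₁ : ℂ) * r₂) •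
      ((((r₂ : ℂ) ^ 2 - 1) / r₂) • transBC E₂ + (((r₁ : ℂ) ^ 2 - 1) / r₁) • transBC E₃ -
        (-((1 / ((r₁ : ℂ) * r₂)) • (ρ ⊗ₖ (1 : Matrix (B × C) (B × C) ℂ)))
      - (1 + 1 / (r₂ : ℂ) + 1 / (r₁ : ℂ)) • transBC E₁)) := by
  ext p q
  simp only [Fin.sum_univ_two, h.eq₀₀, h.eq₀₁, h.eq₁₀, h.eq₁₁, transBC, Matrix.of_apply, coeff,
    Matrix.neg_apply, Matrix.add_apply, Matrix.sub_apply, Matrix.smul_apply, smul_eq_mul,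
    Matrix.cons_val_zero, Matrix.cons_val_one, kronecker_one_transBC ρ p q]
  field_simp
  ring

theorem IsFamily.transBC_eq₁ (h : IsFamily r₁ r₂ ρ E₁ E₂ E₃ D) (h₁ : (r₁ : ℂ) ≠ 0)
    (h₂ : (r₂ : ℂ) ≠ 0) :
    transBC (∑ i, ∑ j, (coeff r₁ 1 i * coeff r₂ 1 j) • D i j) = ((r₁ : ℂ) * r₂) •
      ((1 / ((r₁ : ℂ) * r₂)) • (ρ ⊗ₖ (1 : Matrix (B × C) (B × C) ℂ))
      + (1 - 1 / (r₂ : ℂ) - 1 / (r₁ : ℂ)) • transBC E₁ -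
        ((((r₂ : ℂ) ^ 2 - 1) / r₂) • transBC E₂ + (((r₁ : ℂ) ^ 2 - 1) / r₁) • transBC E₃)) := by
  ext p q
  simp only [Fin.sum_univ_two, h.eq₀₀, h.eq₀₁, h.eq₁₀, h.eq₁₁, transBC, Matrix.of_apply, coeff,
    Matrix.add_apply, Matrix.sub_apply, Matrix.smul_apply, smul_eq_mul,
    Matrix.cons_val_zero, Matrix.cons_val_one, kronecker_one_transBC ρ p q]
  field_simp
  ring

theorem IsFamily.transBC_eq₂ (h : IsFamily r₁ r₂ ρ E₁ E₂ E₃ D) (h₁ : (r₁ : ℂ) ≠ 0)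
    (h₂ : (r₂ : ℂ) ≠ 0) :
    transBC (∑ i, ∑ j, (coeff r₁ 0 i * coeff r₂ 1 j) • D i j) = ((r₁ : ℂ) * r₂) •
      ((((r₂ : ℂ) ^ 2 - 1) / r₂) • transBC E₂ - (((r₁ : ℂ) ^ 2 - 1) / r₁) • transBC E₃ -
        (-((1 / ((r₁ : ℂ) * r₂)) • (ρ ⊗ₖ (1 : Matrix (B × C) (B × C) ℂ)))
      + (1 - 1 / (r₂ : ℂ) + 1 / (r₁ : ℂ)) • transBC E₁)) := by
  ext p q
  simp only [Fin.sum_univ_two, h.eq₀₀, h.eq₀₁, h.eq₁₀, h.eq₁₁, transBC, Matrix.of_apply, coeff,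
    Matrix.neg_apply, Matrix.add_apply, Matrix.sub_apply, Matrix.smul_apply, smul_eq_mul,
    Matrix.cons_val_zero, Matrix.cons_val_one, kronecker_one_transBC ρ p q]
  field_simp
  ring

theorem IsFamily.transBC_eq₃ (h : IsFamily r₁ r₂ ρ E₁ E₂ E₃ D) (h₁ : (r₁ : ℂ) ≠ 0)
    (h₂ : (r₂ : ℂ) ≠ 0) :
    transBC (∑ i, ∑ j, (coeff r₁ 1 i * coeff r₂ 0 j) • D i j) = ((r₁ : ℂ) * r₂) •
      ((1 / ((r₁ : ℂ) * r₂)) • (ρ ⊗ₖ (1 : Matrix (B × C) (B × C) ℂ))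
      - (1 + 1 / (r₂ : ℂ) - 1 / (r₁ : ℂ)) • transBC E₁ -
        ((((r₂ : ℂ) ^ 2 - 1) / r₂) • transBC E₂ - (((r₁ : ℂ) ^ 2 - 1) / r₁) • transBC E₃)) := by
  ext p q
  simp only [Fin.sum_univ_two, h.eq₀₀, h.eq₀₁, h.eq₁₀, h.eq₁₁, transBC, Matrix.of_apply, coeff,
    Matrix.add_apply, Matrix.sub_apply, Matrix.smul_apply, smul_eq_mul,
    Matrix.cons_val_zero, Matrix.cons_val_one, kronecker_one_transBC ρ p q]
  field_simp
  ring

theorem IsFamily.transB_eq₀ (h : IsFamily r₁ r₂ ρ E₁ E₂ E₃ D) :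
    transB (∑ i, coeff r₁ 0 i • D i 0) =
      ((r₁ : ℂ) + 1) • (transB E₁ - -(((r₁ : ℂ) - 1) • transB E₃)) := by
  ext p q
  simp only [Fin.sum_univ_two, h.eq₀₀, h.eq₁₀, transB, Matrix.of_apply, Matrix.neg_apply, coeff,
    Matrix.add_apply, Matrix.sub_apply, Matrix.smul_apply, smul_eq_mul, Matrix.cons_val_zero,
    Matrix.cons_val_one]
  ring

/-- The factor r₁ - 1 makes the component constraint void at r₁ = 1, whereas `b₂` is not. -/
theorem IsFamily.transB_eq₁ (h : IsFamily r₁ r₂ ρ E₁ E₂ E₃ D) :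
    transB (∑ i, coeff r₁ 1 i • D i 0) =
      ((r₁ : ℂ) - 1) • (((r₁ : ℂ) + 1) • transB E₃ - transB E₁) := by
  ext p q
  simp only [Fin.sum_univ_two, h.eq₀₀, h.eq₁₀, transB, Matrix.of_apply, coeff,
    Matrix.add_apply, Matrix.sub_apply, Matrix.smul_apply, smul_eq_mul, Matrix.cons_val_zero,
    Matrix.cons_val_one]
  ring

theorem IsFamily.transB_eq₂ (h : IsFamily r₁ r₂ ρ E₁ E₂ E₃ D) :
    transB (∑ i, coeff r₁ 0 i • D i 1) = ((r₁ : ℂ) * ((r₂ : ℂ) ^ 2 - 1)) • transB E₂ -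
      -(ρ ⊗ₖ (1 : Matrix (B × C) (B × C) ℂ) - ((r₁ : ℂ) ^ 2 - 1) • transB E₃ - transB E₁) := by
  ext p q
  simp only [Fin.sum_univ_two, h.eq₀₁, h.eq₁₁, transB, Matrix.of_apply, Matrix.neg_apply, coeff,
    Matrix.add_apply, Matrix.sub_apply, Matrix.smul_apply, smul_eq_mul, Matrix.cons_val_zero,
    Matrix.cons_val_one, kronecker_one_transB ρ p q]
  ring

theorem IsFamily.transB_eq₃ (h : IsFamily r₁ r₂ ρ E₁ E₂ E₃ D) :
    transB (∑ i, coeff r₁ 1 i • D i 1) =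
      ρ ⊗ₖ (1 : Matrix (B × C) (B × C) ℂ) - ((r₁ : ℂ) ^ 2 - 1) • transB E₃ - transB E₁ -
        ((r₁ : ℂ) * ((r₂ : ℂ) ^ 2 - 1)) • transB E₂ := by
  ext p q
  simp only [Fin.sum_univ_two, h.eq₀₁, h.eq₁₁, transB, Matrix.of_apply, coeff,
    Matrix.add_apply, Matrix.sub_apply, Matrix.smul_apply, smul_eq_mul, Matrix.cons_val_zero,
    Matrix.cons_val_one, kronecker_one_transB ρ p q]
  ring

theorem IsFamily.transC_eq₀ (h : IsFamily r₁ r₂ ρ E₁ E₂ E₃ D) :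
    transC (∑ j, coeff r₂ 0 j • D 0 j) =
      ((r₂ : ℂ) + 1) • (transC E₁ - -(((r₂ : ℂ) - 1) • transC E₂)) := by
  ext p q
  simp only [Fin.sum_univ_two, h.eq₀₀, h.eq₀₁, transC, Matrix.of_apply, Matrix.neg_apply, coeff,
    Matrix.add_apply, Matrix.sub_apply, Matrix.smul_apply, smul_eq_mul, Matrix.cons_val_zero,
    Matrix.cons_val_one]
  ring

theorem IsFamily.transC_eq₁ (h : IsFamily r₁ r₂ ρ E₁ E₂ E₃ D) :
    transC (∑ j, coeff r₂ 1 j • D 0 j) =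
      ((r₂ : ℂ) - 1) • (((r₂ : ℂ) + 1) • transC E₂ - transC E₁) := by
  ext p q
  simp only [Fin.sum_univ_two, h.eq₀₀, h.eq₀₁, transC, Matrix.of_apply, coeff,
    Matrix.add_apply, Matrix.sub_apply, Matrix.smul_apply, smul_eq_mul, Matrix.cons_val_zero,
    Matrix.cons_val_one]
  ring

theorem IsFamily.transC_eq₂ (h : IsFamily r₁ r₂ ρ E₁ E₂ E₃ D) :
    transC (∑ j, coeff r₂ 0 j • D 1 j) = ((r₂ : ℂ) * ((r₁ : ℂ) ^ 2 - 1)) • transC E₃ -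
      -(ρ ⊗ₖ (1 : Matrix (B × C) (B × C) ℂ) - ((r₂ : ℂ) ^ 2 - 1) • transC E₂ - transC E₁) := by
  ext p q
  simp only [Fin.sum_univ_two, h.eq₁₀, h.eq₁₁, transC, Matrix.of_apply, Matrix.neg_apply, coeff,
    Matrix.add_apply, Matrix.sub_apply, Matrix.smul_apply, smul_eq_mul, Matrix.cons_val_zero,
    Matrix.cons_val_one, kronecker_one_transC ρ p q]
  ring

theorem IsFamily.transC_eq₃ (h : IsFamily r₁ r₂ ρ E₁ E₂ E₃ D) :
    transC (∑ j, coeff r₂ 1 j • D 1 j) =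
      ρ ⊗ₖ (1 : Matrix (B × C) (B × C) ℂ) - ((r₂ : ℂ) ^ 2 - 1) • transC E₂ - transC E₁ -
        ((r₂ : ℂ) * ((r₁ : ℂ) ^ 2 - 1)) • transC E₃ := by
  ext p q
  simp only [Fin.sum_univ_two, h.eq₁₀, h.eq₁₁, transC, Matrix.of_apply, coeff,
    Matrix.add_apply, Matrix.sub_apply, Matrix.smul_apply, smul_eq_mul, Matrix.cons_val_zero,
    Matrix.cons_val_one, kronecker_one_transC ρ p q]
  ring

theorem IsFamily.feasiblePPT [DecidableEq A'] (h : IsFamily r₁ r₂ ρ E₁ E₂ E₃ D) (h₁ : 0 < r₁)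
    (h₂ : 0 < r₂) (hE : PPT r₁ r₂ ρ E₁ E₂ E₃) : FeasiblePPT r₁ r₂ D := by
  have h₁' : (r₁ : ℂ) ≠ 0 := by exact_mod_cast h₁.ne'
  have h₂' : (r₂ : ℂ) ≠ 0 := by exact_mod_cast h₂.ne'
  refine ⟨fun s t => ?_, fun s j => ?_, fun i t => ?_⟩
  · fin_cases s <;> fin_cases t
    · exact h.transBC_eq₀ h₁' h₂' ▸ (Matrix.le_iff.mp hE.a₁).smul (by positivity)
    · exact h.transBC_eq₂ h₁' h₂' ▸ (Matrix.le_iff.mp hE.a₃).smul (by positivity)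
    · exact h.transBC_eq₃ h₁' h₂' ▸ (Matrix.le_iff.mp hE.a₄).smul (by positivity)
    · exact h.transBC_eq₁ h₁' h₂' ▸ (Matrix.le_iff.mp hE.a₂).smul (by positivity)
  · fin_cases s <;> fin_cases j
    · exact h.transB_eq₀ ▸ (Matrix.le_iff.mp hE.b₁).smul (by positivity)
    · exact h.transB_eq₂ ▸ Matrix.le_iff.mp hE.b₃
    · exact h.transB_eq₁ ▸ (Matrix.le_iff.mp hE.b₂).smul (sub_one_nonneg h₁)
    · exact h.transB_eq₃ ▸ Matrix.le_iff.mp hE.b₄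
  · fin_cases i <;> fin_cases t
    · exact h.transC_eq₀ ▸ (Matrix.le_iff.mp hE.c₁).smul (by positivity)
    · exact h.transC_eq₁ ▸ (Matrix.le_iff.mp hE.c₂).smul (sub_one_nonneg h₂)
    · exact h.transC_eq₂ ▸ Matrix.le_iff.mp hE.c₃
    · exact h.transC_eq₃ ▸ Matrix.le_iff.mp hE.c₄

theorem IsFamily.ppt [DecidableEq A'] (h : IsFamily r₁ r₂ ρ E₁ E₂ E₃ D) (h₁ : 0 < r₁)
    (h₂ : 0 < r₂) (hb : r₁ = 1 → E₃ = E₁) (hc : r₂ = 1 → E₂ = E₁) (hD : FeasiblePPT r₁ r₂ D) :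
    PPT r₁ r₂ ρ E₁ E₂ E₃ := by
  have h₁' : (r₁ : ℂ) ≠ 0 := by exact_mod_cast h₁.ne'
  have h₂' : (r₂ : ℂ) ≠ 0 := by exact_mod_cast h₂.ne'
  have hr : (0 : ℂ) ≤ (r₁ : ℂ) * r₂ := by positivity
  have hr' := mul_ne_zero h₁' h₂'
  have k₁ : (r₁ : ℂ) + 1 ≠ 0 := by exact_mod_cast Nat.succ_ne_zero r₁
  have k₂ : (r₂ : ℂ) + 1 ≠ 0 := by exact_mod_cast Nat.succ_ne_zero r₂
  have b₁ := (posSemidef_smul_iff (by positivity) k₁).mp (h.transB_eq₀ ▸ hD.b 0 0)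
  have c₁ := (posSemidef_smul_iff (by positivity) k₂).mp (h.transC_eq₀ ▸ hD.c 0 0)
  refine ⟨Matrix.le_iff.mpr ?_, Matrix.le_iff.mpr ?_, Matrix.le_iff.mpr ?_, Matrix.le_iff.mpr ?_,
    Matrix.le_iff.mpr b₁, Matrix.le_iff.mpr ?_, Matrix.le_iff.mpr (h.transB_eq₂ ▸ hD.b 0 1),
    Matrix.le_iff.mpr (h.transB_eq₃ ▸ hD.b 1 1), Matrix.le_iff.mpr c₁, Matrix.le_iff.mpr ?_,
    Matrix.le_iff.mpr (h.transC_eq₂ ▸ hD.c 1 0), Matrix.le_iff.mpr (h.transC_eq₃ ▸ hD.c 1 1)⟩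
  · exact (posSemidef_smul_iff hr hr').mp (h.transBC_eq₀ h₁' h₂' ▸ hD.a 0 0)
  · exact (posSemidef_smul_iff hr hr').mp (h.transBC_eq₁ h₁' h₂' ▸ hD.a 1 1)
  · exact (posSemidef_smul_iff hr hr').mp (h.transBC_eq₂ h₁' h₂' ▸ hD.a 0 1)
  · exact (posSemidef_smul_iff hr hr').mp (h.transBC_eq₃ h₁' h₂' ▸ hD.a 1 0)
  -- At r₁ = 1 division by r₁ - 1 is impossible, but E₃ = E₁ reduces `b₂` to the content of `b₁`.
  · by_cases hr₁ : r₁ = 1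
    · subst hr₁
      rw [hb rfl]
      have : ((1 : ℕ) + 1 : ℂ) • transB E₁ - transB E₁ =
          transB E₁ - -(((1 : ℕ) - 1 : ℂ) • transB E₃) := by
        push_cast
        module
      rw [this]
      exact b₁
    · exact (posSemidef_smul_iff (sub_one_nonneg h₁) (sub_one_ne_zero hr₁)).mp
        (h.transB_eq₁ ▸ hD.b 1 0)
  · by_cases hr₂ : r₂ = 1
    · subst hr₂
      rw [hc rfl]
      have : ((1 : ℕ) + 1 : ℂ) • transC E₁ - transC E₁ =
          transC E₁ - -(((1 : ℕ) - 1 : ℂ) • transC E₂) := by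
        push_cast
        module
      rw [this]
      exact c₁
    · exact (posSemidef_smul_iff (sub_one_nonneg h₂) (sub_one_ne_zero hr₂)).mp
        (h.transC_eq₁ ▸ hD.c 0 1)

theorem IsFamily.sum_eq (h : IsFamily r₁ r₂ ρ E₁ E₂ E₃ D) :
    ∑ i, ∑ j, D i j = ρ ⊗ₖ (1 : Matrix (B × C) (B × C) ℂ) := by
  simp only [Fin.sum_univ_two, h.eq₀₀, h.eq₀₁, h.eq₁₀, h.eq₁₁]
  abel

theorem exists_isFamily (ρ : Matrix A' A' ℂ) (E₁ E₂ E₃ : Op A' B C) :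
    ∃ D, IsFamily r₁ r₂ ρ E₁ E₂ E₃ D :=
  ⟨![![E₁, ((r₂ : ℂ) ^ 2 - 1) • E₂], ![((r₁ : ℂ) ^ 2 - 1) • E₃,
    ρ ⊗ₖ 1 - (E₁ + ((r₂ : ℂ) ^ 2 - 1) • E₂ + ((r₁ : ℂ) ^ 2 - 1) • E₃)]], rfl, rfl, rfl, rfl⟩

theorem IsFamily.posSemidef [DecidableEq A'] {N : SuperOp A' (B × C)} {f : ℝ}
    (h : IsFamily r₁ r₂ ρ E₁ E₂ E₃ D) (hE : Basic N r₁ r₂ ρ f E₁ E₂ E₃) (h₁ : 0 < r₁)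
    (h₂ : 0 < r₂) (i j : Fin 2) : (D i j).PosSemidef := by
  fin_cases i <;> fin_cases j
  · exact h.eq₀₀ ▸ Matrix.nonneg_iff_posSemidef.mp hE.cp₁
  · exact h.eq₀₁ ▸ (Matrix.nonneg_iff_posSemidef.mp hE.cp₂).smul (sq_sub_one_nonneg h₂)
  · exact h.eq₁₀ ▸ (Matrix.nonneg_iff_posSemidef.mp hE.cp₃).smul (sq_sub_one_nonneg h₁)
  · exact h.eq₁₁ ▸ Matrix.le_iff.mp hE.bc_a

theorem IsFamily.feasibleNS [DecidableEq A'] (h : IsFamily r₁ r₂ ρ E₁ E₂ E₃ D) (h₁ : 0 < r₁)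
    (h₂ : 0 < r₂) (hρ : ρ.trace = 1) (hE : NS r₁ r₂ E₁ E₂ E₃) : FeasibleNS r₁ r₂ D where
  a_bc i j := by
    have h₁' : (r₁ : ℂ) ≠ 0 := by exact_mod_cast h₁.ne'
    have h₂' : (r₂ : ℂ) ≠ 0 := by exact_mod_cast h₂.ne'
    have hk : traceFst (ρ ⊗ₖ (1 : Matrix (B × C) (B × C) ℂ)) = 1 := by
      ext x x'
      change ∑ a, ρ a a * (1 : Matrix (B × C) (B × C) ℂ) x x' = _
      rw [← Finset.sum_mul, show ∑ a, ρ a a = 1 from hρ, one_mul]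
    fin_cases i <;> fin_cases j
    · simp [h.eq₀₀, hE.a_bc₁, rankProj]
    · simp [h.eq₀₁, hE.a_bc₂, rankProj, smul_smul]
    · simp [h.eq₁₀, hE.a_bc₃, rankProj, smul_smul]
    · simp only [Fin.mk_one, h.eq₁₁, map_sub, map_add, map_smul, hE.a_bc₁, hE.a_bc₂, hE.a_bc₃, hk,
        rankProj, Matrix.cons_val_one, Matrix.cons_val_zero]
      ext p q
      simp only [Matrix.add_apply, Matrix.sub_apply, Matrix.smul_apply, smul_eq_mul]
      field_simp
      ring
  b_ac := by
    rw [h.eq₀₀, h.eq₁₀]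
    exact hE.b_ac
  c_ab := by
    rw [h.eq₀₀, h.eq₀₁]
    exact hE.c_ab

/-- A positive operator of trace zero vanishes, and the trace of D 1 1 has the factor (r₁² - 1)(r₂²
- 1). -/
theorem FeasibleNS.eq_zero [DecidableEq A'] (h : FeasibleNS r₁ r₂ D) (hD : (D 1 1).PosSemidef)
    (hr : r₁ = 1 ∨ r₂ = 1) : D 1 1 = 0 := by
  have h₁ : traceFst (D 1 1) = 0 := by
    rw [h.a_bc]
    rcases hr with rfl | rfl <;> simp [rankProj]
  rw [← hD.trace_eq_zero_iff]
  have h₂ : (D 1 1).trace = (traceFst (D 1 1)).trace := by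
    simp only [Matrix.trace, Matrix.diag, traceFst, LinearMap.coe_mk, AddHom.coe_mk,
      Matrix.of_apply, Fintype.sum_prod_type (α₁ := A')]
    exact Finset.sum_comm
  rw [h₂, h₁, Matrix.trace_zero]

theorem IsFamily.feasible [DecidableEq A'] {N : SuperOp A' (B × C)} {f : ℝ}
    (h : IsFamily r₁ r₂ ρ E₁ E₂ E₃ D) (hE : Basic N r₁ r₂ ρ f E₁ E₂ E₃) (h₁ : 0 < r₁)
    (h₂ : 0 < r₂) (h' : r₁ = 1 ∨ r₂ = 1 → D 1 1 = 0) : Feasible r₁ r₂ ρ D where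
  posSemidef := h.posSemidef hE h₁ h₂
  sum_eq := h.sum_eq
  trace_input := hE.trace_input
  eq_zero₁ hr j := by
    fin_cases j
    · simp [h.eq₁₀, hr]
    · exact h' (Or.inl hr)
  eq_zero₂ hr i := by
    fin_cases i
    · simp [h.eq₀₁, hr]
    · exact h' (Or.inr hr)

/-- The operators `E₁`, `E₂` and `E₃` which belong to a feasible family. -/
theorem Feasible.exists_operators [DecidableEq A'] {N : SuperOp A' (B × C)} {f : ℝ}
    (hD : Feasible r₁ r₂ ρ D) (h₁ : 0 < r₁) (h₂ : 0 < r₂)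
    (hf : (f : ℂ) = (D 0 0 * N.choiᵀ).trace) :
    ∃ E₁ E₂ E₃, IsFamily r₁ r₂ ρ E₁ E₂ E₃ D ∧ Basic N r₁ r₂ ρ f E₁ E₂ E₃ ∧
      (r₁ = 1 → E₃ = E₁) ∧ (r₂ = 1 → E₂ = E₁) := by
  have hs := hD.sum_eq
  simp only [Fin.sum_univ_two] at hs
  have e₂ : D 0 1 = ((r₂ : ℂ) ^ 2 - 1) •
      (if r₂ = 1 then D 0 0 else ((r₂ : ℂ) ^ 2 - 1)⁻¹ • D 0 1) := by
    split_ifs with h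
    · simp [hD.eq_zero₂ h, h]
    · rw [smul_smul, mul_inv_cancel₀ (sq_sub_one_ne_zero h), one_smul]
  have e₃ : D 1 0 = ((r₁ : ℂ) ^ 2 - 1) •
      (if r₁ = 1 then D 0 0 else ((r₁ : ℂ) ^ 2 - 1)⁻¹ • D 1 0) := by
    split_ifs with h
    · simp [hD.eq_zero₁ h, h]
    · rw [smul_smul, mul_inv_cancel₀ (sq_sub_one_ne_zero h), one_smul]
  have e₁₁ : D 1 1 = ρ ⊗ₖ (1 : Matrix (B × C) (B × C) ℂ) - (D 0 0 + D 0 1 + D 1 0) := by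
    rw [← hs]
    abel
  -- If r = 1 the coefficient r² - 1 is zero and the family does not determine E₂ or E₃. The choice
  -- D 0 0 fulfils their positivity, trace and PPT conditions as well.
  refine ⟨D 0 0, if r₂ = 1 then D 0 0 else ((r₂ : ℂ) ^ 2 - 1)⁻¹ • D 0 1,
    if r₁ = 1 then D 0 0 else ((r₁ : ℂ) ^ 2 - 1)⁻¹ • D 1 0, ⟨rfl, e₂, e₃, ?_⟩,
    ⟨hD.trace_input, hf, Matrix.nonneg_iff_posSemidef.mpr (hD.posSemidef 0 0),
      Matrix.nonneg_iff_posSemidef.mpr ?_, Matrix.nonneg_iff_posSemidef.mpr ?_,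
      Matrix.le_iff.mpr ?_⟩, fun h => if_pos h, fun h => if_pos h⟩
  · rw [← e₂, ← e₃, e₁₁]
  · split_ifs
    · exact hD.posSemidef 0 0
    · exact (hD.posSemidef 0 1).smul (inv_nonneg.mpr (sq_sub_one_nonneg h₂))
  · split_ifs
    · exact hD.posSemidef 0 0
    · exact (hD.posSemidef 1 0).smul (inv_nonneg.mpr (sq_sub_one_nonneg h₁))
  · rw [← e₂, ← e₃, ← e₁₁]
    exact hD.posSemidef 1 1

theorem IsFamily.ns [DecidableEq A'] (h : IsFamily r₁ r₂ ρ E₁ E₂ E₃ D)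
    (hb : r₁ = 1 → E₃ = E₁) (hc : r₂ = 1 → E₂ = E₁) (hD : FeasibleNS r₁ r₂ D) :
    NS r₁ r₂ E₁ E₂ E₃ := by
  have a₁ : traceFst E₁ = ((r₁ : ℂ) ^ 2 * (r₂ : ℂ) ^ 2)⁻¹ • 1 := by
    rw [← h.eq₀₀, hD.a_bc]
    simp [rankProj]
  refine ⟨a₁, ?_, ?_, ?_, ?_⟩
  · by_cases hr : r₂ = 1
    · rw [hc hr, a₁]
    · have := hD.a_bc 0 1
      rw [h.eq₀₁, map_smul] at this
      simp only [rankProj, Matrix.cons_val_zero, Matrix.cons_val_one, one_mul] at this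
      rwa [mul_smul, smul_right_inj (sq_sub_one_ne_zero hr)] at this
  · by_cases hr : r₁ = 1
    · rw [hb hr, a₁]
    · have := hD.a_bc 1 0
      rw [h.eq₁₀, map_smul] at this
      simp only [rankProj, Matrix.cons_val_zero, Matrix.cons_val_one, mul_one] at this
      rwa [mul_smul, smul_right_inj (sq_sub_one_ne_zero hr)] at this
  · have := hD.b_ac
    rwa [h.eq₀₀, h.eq₁₀] at this
  · have := hD.c_ab
    rwa [h.eq₀₀, h.eq₀₁] at this

/-- D 1 1 is merged into D 0 1. The rows of `coeff 1` are (2, 1) and (0, 1), and index 1 has weight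
1 in every row of `coeff r₂`. So each new constraint is an old one, a sum of two old ones or
trivial. -/
theorem FeasiblePPT.exists_feasible_of_eq_one₁ (hD : FeasiblePPT 1 r₂ D) (h₂ : r₂ ≠ 1)
    (hp : ∀ i j, (D i j).PosSemidef)
    (hs : ∑ i, ∑ j, D i j = ρ ⊗ₖ (1 : Matrix (B × C) (B × C) ℂ)) (hρ : ρ.trace = 1)
    (e : D 1 0 = 0) :
    ∃ D' : Fin 2 → Fin 2 → Op A' B C, D' 0 0 = D 0 0 ∧ Feasible 1 r₂ ρ D' ∧
      FeasiblePPT 1 r₂ D' := by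
  obtain ⟨D', h₀₀, h₀₁, h₁⟩ : ∃ D' : Fin 2 → Fin 2 → Op A' B C, D' 0 0 = D 0 0 ∧
      D' 0 1 = D 0 1 + D 1 1 ∧ ∀ j, D' 1 j = 0 :=
    ⟨![![D 0 0, D 0 1 + D 1 1], ![0, 0]], rfl, rfl, fun j => by fin_cases j <;> rfl⟩
  have hc : coeff 1 1 0 = 0 := by simp [coeff]
  refine ⟨D', h₀₀, ⟨fun i j => ?_, ?_, hρ, fun _ => h₁, fun h => absurd h h₂⟩,
    ⟨fun s t => ?_, fun s j => ?_, fun i t => ?_⟩⟩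
  · fin_cases i
    · fin_cases j
      · exact h₀₀ ▸ hp 0 0
      · exact h₀₁ ▸ (hp 0 1).add (hp 1 1)
    · exact h₁ j ▸ Matrix.PosSemidef.zero
  · rw [← hs]
    simp [Fin.sum_univ_two, e, add_assoc, h₀₀, h₀₁, h₁]
  · fin_cases s
    -- The rows of `coeff 1` add up to (2, 2), so D 1 1 gets the same weight as D 0 1.
    · have k : transBC (∑ i, ∑ j, (coeff 1 0 i * coeff r₂ t j) • D' i j) =
          transBC (∑ i, ∑ j, (coeff 1 0 i * coeff r₂ t j) • D i j) +
          transBC (∑ i, ∑ j, (coeff 1 1 i * coeff r₂ t j) • D i j) := by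
        ext p q
        fin_cases t <;> simp [Fin.sum_univ_two, coeff, transBC, e, h₀₀, h₀₁, h₁] <;> ring
      exact k ▸ (hD.a 0 t).add (hD.a 1 t)
    · have k : transBC (∑ i, ∑ j, (coeff 1 1 i * coeff r₂ t j) • D' i j) = 0 := by
        ext p q
        simp [Fin.sum_univ_two, transBC, hc, h₁]
      exact k ▸ Matrix.PosSemidef.zero
  · fin_cases s
    · fin_cases j
      · have k : transB (∑ i, coeff 1 0 i • D' i 0) = transB (∑ i, coeff 1 0 i • D i 0) := by
          simp [Fin.sum_univ_two, e, h₀₀, h₁]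
        exact k ▸ hD.b 0 0
      · have k : transB (∑ i, coeff 1 0 i • D' i 1) =
            transB (∑ i, coeff 1 0 i • D i 1) + transB (∑ i, coeff 1 1 i • D i 1) := by
          ext p q
          simp [Fin.sum_univ_two, coeff, transB, h₀₁, h₁]
          ring
        exact k ▸ (hD.b 0 1).add (hD.b 1 1)
    · have k : transB (∑ i, coeff 1 1 i • D' i j) = 0 := by
        ext p q
        simp [Fin.sum_univ_two, transB, hc, h₁]
      exact k ▸ Matrix.PosSemidef.zero
  · fin_cases i
    · have k : transC (∑ j, coeff r₂ t j • D' 0 j) =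
          transC (∑ j, coeff r₂ t j • D 0 j) + transC (∑ j, coeff r₂ t j • D 1 j) := by
        ext p q
        fin_cases t <;> simp [Fin.sum_univ_two, coeff, transC, e, h₀₀, h₀₁] <;> ring
      exact k ▸ (hD.c 0 t).add (hD.c 1 t)
    · have k : transC (∑ j, coeff r₂ t j • D' 1 j) = 0 := by
        ext p q
        simp [transC, h₁]
      exact k ▸ Matrix.PosSemidef.zero

theorem FeasiblePPT.exists_feasible_of_eq_one₂ (hD : FeasiblePPT r₁ 1 D) (h₁ : r₁ ≠ 1)
    (hp : ∀ i j, (D i j).PosSemidef)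
    (hs : ∑ i, ∑ j, D i j = ρ ⊗ₖ (1 : Matrix (B × C) (B × C) ℂ)) (hρ : ρ.trace = 1)
    (e : D 0 1 = 0) :
    ∃ D' : Fin 2 → Fin 2 → Op A' B C, D' 0 0 = D 0 0 ∧ Feasible r₁ 1 ρ D' ∧
      FeasiblePPT r₁ 1 D' := by
  obtain ⟨D', h₀₀, h₁₀, h₂⟩ : ∃ D' : Fin 2 → Fin 2 → Op A' B C, D' 0 0 = D 0 0 ∧
      D' 1 0 = D 1 0 + D 1 1 ∧ ∀ i, D' i 1 = 0 :=
    ⟨![![D 0 0, 0], ![D 1 0 + D 1 1, 0]], rfl, rfl, fun i => by fin_cases i <;> rfl⟩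
  have hc : coeff 1 1 0 = 0 := by simp [coeff]
  refine ⟨D', h₀₀, ⟨fun i j => ?_, ?_, hρ, fun h => absurd h h₁, fun _ => h₂⟩,
    ⟨fun s t => ?_, fun s j => ?_, fun i t => ?_⟩⟩
  · fin_cases j
    · fin_cases i
      · exact h₀₀ ▸ hp 0 0
      · exact h₁₀ ▸ (hp 1 0).add (hp 1 1)
    · exact h₂ i ▸ Matrix.PosSemidef.zero
  · rw [← hs]
    simp [Fin.sum_univ_two, e, h₀₀, h₁₀, h₂]
  · fin_cases t
    · have k : transBC (∑ i, ∑ j, (coeff r₁ s i * coeff 1 0 j) • D' i j) =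
          transBC (∑ i, ∑ j, (coeff r₁ s i * coeff 1 0 j) • D i j) +
          transBC (∑ i, ∑ j, (coeff r₁ s i * coeff 1 1 j) • D i j) := by
        ext p q
        fin_cases s <;> simp [Fin.sum_univ_two, coeff, transBC, e, h₀₀, h₁₀, h₂] <;> ring
      exact k ▸ (hD.a s 0).add (hD.a s 1)
    · have k : transBC (∑ i, ∑ j, (coeff r₁ s i * coeff 1 1 j) • D' i j) = 0 := by
        ext p q
        simp [Fin.sum_univ_two, transBC, hc, h₂]
      exact k ▸ Matrix.PosSemidef.zero
  · fin_cases j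
    · have k : transB (∑ i, coeff r₁ s i • D' i 0) =
          transB (∑ i, coeff r₁ s i • D i 0) + transB (∑ i, coeff r₁ s i • D i 1) := by
        ext p q
        fin_cases s <;> simp [Fin.sum_univ_two, coeff, transB, e, h₀₀, h₁₀] <;> ring
      exact k ▸ (hD.b s 0).add (hD.b s 1)
    · have k : transB (∑ i, coeff r₁ s i • D' i 1) = 0 := by
        ext p q
        simp [transB, h₂]
      exact k ▸ Matrix.PosSemidef.zero
  · fin_cases t
    · fin_cases i
      · have k : transC (∑ j, coeff 1 0 j • D' 0 j) = transC (∑ j, coeff 1 0 j • D 0 j) := by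
          simp [Fin.sum_univ_two, e, h₀₀, h₂]
        exact k ▸ hD.c 0 0
      · have k : transC (∑ j, coeff 1 0 j • D' 1 j) =
            transC (∑ j, coeff 1 0 j • D 1 j) + transC (∑ j, coeff 1 1 j • D 1 j) := by
          ext p q
          simp [Fin.sum_univ_two, coeff, transC, h₁₀, h₂]
          ring
        exact k ▸ (hD.c 1 0).add (hD.c 1 1)
    · have k : transC (∑ j, coeff 1 1 j • D' i j) = 0 := by
        ext p q
        simp [Fin.sum_univ_two, transC, hc, h₂]
      exact k ▸ Matrix.PosSemidef.zero

/-- A family with PPT constraints can be made feasible without a change of its first component. -/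
theorem FeasiblePPT.exists_feasible (hD : FeasiblePPT r₁ r₂ D) (hr : 1 < r₁ * r₂)
    (hp : ∀ i j, (D i j).PosSemidef)
    (hs : ∑ i, ∑ j, D i j = ρ ⊗ₖ (1 : Matrix (B × C) (B × C) ℂ)) (hρ : ρ.trace = 1)
    (e₁ : r₁ = 1 → D 1 0 = 0) (e₂ : r₂ = 1 → D 0 1 = 0) :
    ∃ D' : Fin 2 → Fin 2 → Op A' B C, D' 0 0 = D 0 0 ∧ Feasible r₁ r₂ ρ D' ∧
      FeasiblePPT r₁ r₂ D' := by
  by_cases h₁ : r₁ = 1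
  · subst h₁
    exact hD.exists_feasible_of_eq_one₁ (by rintro rfl; simp at hr) hp hs hρ (e₁ rfl)
  · by_cases h₂ : r₂ = 1
    · subst h₂
      exact hD.exists_feasible_of_eq_one₂ h₁ hp hs hρ (e₂ rfl)
    · exact ⟨D, rfl, ⟨hp, hs, hρ, fun h => absurd h h₁, fun h => absurd h h₂⟩, hD⟩

/-- The components of a code give operators which satisfy the basic constraints. -/
theorem exists_operators_of_code [DecidableEq A'] [Nonempty B] [Nonempty C]
    (N : SuperOp A' (B × C)) (h₁ : 0 < r₁) (h₂ : 0 < r₂) (Z : ForwardAssistedCode A' B C r₁ r₂)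
    {f : ℝ} (hρ : Z.averageInput = ρ) (hf : Z.channelFidelity N = f) :
    ∃ E₁ E₂ E₃ : Op A' B C, Basic N r₁ r₂ ρ f E₁ E₂ E₃ ∧
      (Z.IsNoSignalling → NS r₁ r₂ E₁ E₂ E₃) ∧ (Z.IsPPTPreserving → PPT r₁ r₂ ρ E₁ E₂ E₃) := by
  have hD := feasible_components h₁ h₂ Z
  rw [hρ] at hD
  obtain ⟨E₁, E₂, E₃, hE, hE', hb, hc⟩ := hD.exists_operators (N := N) (f := f) h₁ h₂
    (by rw [← hf, fidelity_components])
  exact ⟨E₁, E₂, E₃, hE', fun hZ => hE.ns hb hc (feasibleNS_components h₁ h₂ Z hZ),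
    fun hZ => hE.ppt h₁ h₂ hb hc (feasiblePPT_components h₁ h₂ ((pptPreserving_iff _).mp hZ.pptA)
      ((cutB_pptPreserving_iff _).mp hZ.pptB) ((cutC_pptPreserving_iff _).mp hZ.pptC))⟩

end BroadcastSDP

end

/-! ### The characterisation of codes -/

theorem mainTheorem3 {A' B C : Type*} [Fintype A'] [DecidableEq A'] [Nonempty A']
    [Fintype B] [DecidableEq B] [Nonempty B] [Fintype C] [DecidableEq C] [Nonempty C]
    (N : SuperOp A' (B × C)) (hN : N.IsChannel)
    (r₁ r₂ : ℕ) (hr₁ : 0 < r₁) (hr₂ : 0 < r₂) (ρ : Matrix A' A' ℂ) (f : ℝ) :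
    ((∃ Z : ForwardAssistedCode A' B C r₁ r₂, Z.IsNoSignalling ∧
        Z.averageInput = ρ ∧ Z.channelFidelity N = f) ↔
      ∃ E₁ E₂ E₃ : BroadcastSDP.Op A' B C, BroadcastSDP.Basic N r₁ r₂ ρ f E₁ E₂ E₃ ∧
        BroadcastSDP.NS r₁ r₂ E₁ E₂ E₃) ∧
    ((∃ Z : ForwardAssistedCode A' B C r₁ r₂, Z.IsPPTPreserving ∧ Z.IsNoSignalling ∧
        Z.averageInput = ρ ∧ Z.channelFidelity N = f) ↔
      ∃ E₁ E₂ E₃ : BroadcastSDP.Op A' B C, BroadcastSDP.Basic N r₁ r₂ ρ f E₁ E₂ E₃ ∧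
        BroadcastSDP.NS r₁ r₂ E₁ E₂ E₃ ∧ BroadcastSDP.PPT r₁ r₂ ρ E₁ E₂ E₃) ∧
    (1 < r₁ * r₂ →
      ((∃ Z : ForwardAssistedCode A' B C r₁ r₂, Z.IsPPTPreserving ∧
          Z.averageInput = ρ ∧ Z.channelFidelity N = f) ↔
        ∃ E₁ E₂ E₃ : BroadcastSDP.Op A' B C, BroadcastSDP.Basic N r₁ r₂ ρ f E₁ E₂ E₃ ∧
          BroadcastSDP.PPT r₁ r₂ ρ E₁ E₂ E₃)) := by
  have key {E₁ E₂ E₃ : BroadcastSDP.Op A' B C} (hE : BroadcastSDP.Basic N r₁ r₂ ρ f E₁ E₂ E₃)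
      (hNS : BroadcastSDP.NS r₁ r₂ E₁ E₂ E₃) : ∃ Z : ForwardAssistedCode A' B C r₁ r₂,
      Z.IsNoSignalling ∧ Z.averageInput = ρ ∧ Z.channelFidelity N = f ∧
        (BroadcastSDP.PPT r₁ r₂ ρ E₁ E₂ E₃ → Z.IsPPTPreserving) := by
    obtain ⟨D, hD⟩ := BroadcastSDP.exists_isFamily (r₁ := r₁) (r₂ := r₂) ρ E₁ E₂ E₃
    have hDNS := hD.feasibleNS hr₁ hr₂ hE.trace_input hNS
    have hF := hD.feasible hE hr₁ hr₂ (hDNS.eq_zero (hD.posSemidef hE hr₁ hr₂ 1 1))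
    obtain ⟨Z, hZ, hρ, hf⟩ := hF.exists_code hr₁ hr₂ N
    refine ⟨Z, hF.isNoSignalling hDNS hr₁ hr₂ hZ, hρ, ?_,
      fun h => (hD.feasiblePPT hr₁ hr₂ h).isPPTPreserving hr₁ hr₂ hZ⟩
    rw [hf, hD.eq₀₀, hE.fidelity]
  refine ⟨⟨?_, ?_⟩, ⟨?_, ?_⟩, fun hr => ⟨?_, ?_⟩⟩
  · rintro ⟨Z, hZ, hρ, hf⟩
    obtain ⟨E₁, E₂, E₃, hE, hNS, -⟩ :=
      BroadcastSDP.exists_operators_of_code N hr₁ hr₂ Z hρ hf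
    exact ⟨E₁, E₂, E₃, hE, hNS hZ⟩
  · rintro ⟨E₁, E₂, E₃, hE, hNS⟩
    obtain ⟨Z, hZ, hρ, hf, -⟩ := key hE hNS
    exact ⟨Z, hZ, hρ, hf⟩
  · rintro ⟨Z, hP, hZ, hρ, hf⟩
    obtain ⟨E₁, E₂, E₃, hE, hNS, hPPT⟩ :=
      BroadcastSDP.exists_operators_of_code N hr₁ hr₂ Z hρ hf
    exact ⟨E₁, E₂, E₃, hE, hNS hZ, hPPT hP⟩
  · rintro ⟨E₁, E₂, E₃, hE, hNS, hPPT⟩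
    obtain ⟨Z, hZ, hρ, hf, hP⟩ := key hE hNS
    exact ⟨Z, hP hPPT, hZ, hρ, hf⟩
  · rintro ⟨Z, hP, hρ, hf⟩
    obtain ⟨E₁, E₂, E₃, hE, -, hPPT⟩ :=
      BroadcastSDP.exists_operators_of_code N hr₁ hr₂ Z hρ hf
    exact ⟨E₁, E₂, E₃, hE, hPPT hP⟩
  · rintro ⟨E₁, E₂, E₃, hE, hPPT⟩
    obtain ⟨D, hD⟩ := BroadcastSDP.exists_isFamily (r₁ := r₁) (r₂ := r₂) ρ E₁ E₂ E₃
    -- Without the trace conditions D 1 1 may be nonzero when r₁ = 1 or r₂ = 1. The modified family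
    -- keeps D 0 0, hence the fidelity.
    obtain ⟨D', h₀₀, hF, hP⟩ := (hD.feasiblePPT hr₁ hr₂ hPPT).exists_feasible hr
      (hD.posSemidef hE hr₁ hr₂) hD.sum_eq hE.trace_input
      (fun h => by simp [hD.eq₁₀, h]) (fun h => by simp [hD.eq₀₁, h])
    obtain ⟨Z, hZ, hρ, hf⟩ := hF.exists_code hr₁ hr₂ N
    refine ⟨Z, hP.isPPTPreserving hr₁ hr₂ hZ, hρ, ?_⟩
    rw [hf, h₀₀, hD.eq₀₀, hE.fidelity]
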